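/- **Setting.** All vector spaces are real; $E,F,G$ are Banach spaces. A path $Z:[0,\infty)\to E$ is *càdlàg* if it is right-continuous and has a left limit $Z_{t-}$ at every $t>0$; put $Z_{0-}=Z_0$ and $\Delta Z_t=Z_t-Z_{t-}$. It has *finite variation* if its variation on every compact interval is finite. A *partition* of $[0,\infty)$ is $\pi=\{(t_i,t_{i+1}]: i\ge 0\}$ with $0=t_0<t_1<\dots\to\infty$. For $I=(r,s]\in\pi$ write $\delta Z_t(I)=Z_{s\wedge t}-Z_{r\wedge t}$, and for $t>0$ let $\pi(t)=(\underline\pi(t),\overline\pi(t)]$ be the interval of $\pi$ containing $t$. Let $(\pi_n)_{n\ge0}$ be a sequence of partitions. * $Z$ has *finite 2-variation along $(\pi_n)$* if $\sup_n\sum_{I\in\pi_n}\|\delta Z_t(I)\|^2<\infty$ for all $t\ge0$. * $(\pi_n)$ *approximates $Z$ from the left* if $Z(\underline{\pi_n}(t))\to Z_{t-}$ for all $t>0$. * $(\pi_n)$ satisfies *Condition (C) for $Z$* if, with $D_\varepsilon=\{t:\|\Delta Z_t\|>\varepsilon\}$ and $J_\varepsilon(Z)_t=\sum_{0<s\le t,\,s\in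 D_\varepsilon}\Delta Z_s$: (C1) for all $t\ge 0$, $\varepsilon>0$ there is $N$ such that $I\cap[0,t]\cap D_\varepsilon$ has at most one element for all $n\ge N$, $I\in\pi_n$; (C2) $\delta Z_t(\pi_n(s))\to\Delta Z_s$ whenever $\Delta Z_s\ne0$ and $t\ge s$; (C3) for all $t\ge 0$, $\limsup_{\varepsilon\downarrow0}\limsup_{n\to\infty}\sup_{I\in\pi_n}\sup_{u,v\in I\cap[0,t]}\|(Z-J_\varepsilon(Z))_u-(Z-J_\varepsilon(Z))_v\|=0$. A *reasonable crossnorm* on $E\otimes F$ is a norm $\alpha$ with $\alpha(x\otimes y)\le\|x\|\|y\|$ such that each functional $x^*\otimes y^*$ ($x^*\in E^*$, $y^*\in F^*$) is $\alpha$-bounded with norm at most $\|x^*\|\|y^*\|$; $E\widehat\otimes_\alpha F$ is the completion. A *uniform crossnorm* $\alpha$ assigns a reasonable crossnorm to every pair of Banach spaces in such a way that for bounded operators $T:E_1\to E_2$, $S:F_1\to F_2$ the operator $T\otimes S:E_1\widehat\otimes_\alpha F_1\to E_2\widehat\otimes_\alpha F_2$ is bounded with $\|T\otimes S\|\le\|T\|\|S\|$;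 write $T^{\otimes2}=T\otimes T$. A path ${}^\alpha[Z,Z]:[0,\infty)\to E\widehat\otimes_\alpha E$ is the *strong* (resp. *weak*) *$\alpha$-tensor quadratic variation* of $Z$ along $(\pi_n)$ if it is càdlàg, of finite variation, $\sum_{I\in\pi_n}\delta Z_t(I)^{\otimes2}\to{}^\alpha[Z,Z]_t$ in norm (resp. weakly) for all $t\ge0$, and $\Delta\,{}^\alpha[Z,Z]_t=(\Delta Z_t)^{\otimes2}$ for all $t\ge0$. Finally, $C_{\mathcal K}(S,S')$ is the set of functions $S\to S'$ whose restriction to every compact subset of $S$ is continuous. **Theorem.** Let $\alpha$ be a uniform crossnorm. Let $A:[0,\infty)\to F$ be càdlàg of finite variation, and let $X:[0,\infty)\to E$ be càdlàg with strong (resp. weak) $\alpha$-tensor quadratic variation ${}^\alpha[X,X]$ and finite 2-variation along $(\pi_n)$. Assume that $(\pi_n)$ satisfies Condition (C) for the $F\times E$-valued path $(A,X)$ and approximates it from the left. Let $f:F\times E\to G$ be once Gâteaux differentiable in $a\in F$ and twice Gâteaux differentiable in $x\in E$, with $D_af\in C_{\mathcal K}(F\times E,\mathcal L(F,G))$, $D_xf\in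 C_{\mathcal K}(F\times E,\mathcal L(E,G))$, and such that $D_x^2f$ extends to a function in $C_{\mathcal K}(F\times E,\mathcal L(E\widehat\otimes_\alpha E,G))$, that is, there is $\Phi$ in this space with $\Phi(a,x)(h\otimes k)=D_x^2f(a,x)(h,k)$ for all $a,x,h,k$. Then for every $t\ge0$ the Itô–Föllmer integral $$Y_t=\int_0^tD_xf(A_{s-},X_{s-})\,\mathrm dX_s:=\lim_{n\to\infty}\sum_{(r,s]\in\pi_n}D_xf(A_r,X_r)\bigl(X_{s\wedge t}-X_{r\wedge t}\bigr)$$ exists as a limit in norm (resp. in the weak topology) of $G$, the path $Y$ is càdlàg, and $Y$ has strong (resp. weak) $\alpha$-tensor quadratic variation along $(\pi_n)$, given by $${}^\alpha[Y,Y]_t=\int_{(0,t]}D_xf(A_{s-},X_{s-})^{\otimes2}\,\mathrm d\,{}^\alpha[X,X]_s,\qquad t\ge0,$$ where the integrand is Bochner integrable on $(0,t]$ with respect to the total variation of the $E\widehat\otimes_\alpha E$-valued Stieltjes measure of ${}^\alpha[X,X]$. -/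

import Mathlib

open Set Filter Topology MeasureTheory
open scoped NNReal ENNReal TensorProduct

universe u v w

noncomputable section

namespace ItoFollmer

/-! ### Reasonable and uniform crossnorms, completed tensor products -/

section Tensor

/-- A reasonable crossnorm on the algebraic tensor product `E ⊗ F`: a norm `α` with
`α (x ⊗ y) ≤ ‖x‖ ‖y‖` such that every functional `φ ⊗ ψ` is bounded for `α`, with norm at most
`‖φ‖ ‖ψ‖`. -/
structure ReasonableCrossnorm (E : Type u) (F : Type v)
    [NormedAddCommGroup E] [NormedSpace ℝ E] [NormedAddCommGroup F] [NormedSpace ℝ F]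
    extends Seminorm ℝ (E ⊗[ℝ] F) where
  eq_zero_of_apply_eq_zero : ∀ z : E ⊗[ℝ] F, toSeminorm z = 0 → z = 0
  apply_tmul_le : ∀ (x : E) (y : F), toSeminorm (x ⊗ₜ[ℝ] y) ≤ ‖x‖ * ‖y‖
  dual_tmul_le : ∀ (φ : E →L[ℝ] ℝ) (ψ : F →L[ℝ] ℝ) (z : E ⊗[ℝ] F),
    ‖LinearMap.mul' ℝ ℝ (TensorProduct.map (φ : E →ₗ[ℝ] ℝ) (ψ : F →ₗ[ℝ] ℝ) z)‖
      ≤ ‖φ‖ * ‖ψ‖ * toSeminorm z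

variable {E : Type u} {F : Type v}
  [NormedAddCommGroup E] [NormedSpace ℝ E] [NormedAddCommGroup F] [NormedSpace ℝ F]

/-- The algebraic tensor product `E ⊗ F`, to be normed by `α`. -/
def NormedTensor (_α : ReasonableCrossnorm E F) : Type (max u v) := E ⊗[ℝ] F

instance (α : ReasonableCrossnorm E F) : AddCommGroup (NormedTensor α) :=
  inferInstanceAs (AddCommGroup (E ⊗[ℝ] F))

instance (α : ReasonableCrossnorm E F) : Module ℝ (NormedTensor α) :=
  inferInstanceAs (Module ℝ (E ⊗[ℝ] F))

instance (α : ReasonableCrossnorm E F) : Norm (NormedTensor α) :=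
  ⟨fun z => α.toSeminorm z⟩

theorem NormedTensor.core (α : ReasonableCrossnorm E F) :
    NormedSpace.Core ℝ (NormedTensor α) where
  norm_nonneg z := apply_nonneg α.toSeminorm z
  norm_smul c z := map_smul_eq_mul α.toSeminorm c z
  norm_triangle x y := map_add_le_add α.toSeminorm x y
  norm_eq_zero_iff z :=
    ⟨α.eq_zero_of_apply_eq_zero z, fun h => by rw [h]; exact map_zero α.toSeminorm⟩

instance (α : ReasonableCrossnorm E F) : NormedAddCommGroup (NormedTensor α) :=
  NormedAddCommGroup.ofCore (NormedTensor.core α)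

instance (α : ReasonableCrossnorm E F) : NormedSpace ℝ (NormedTensor α) :=
  NormedSpace.ofCore (NormedTensor.core α)

/-- The completion of `E ⊗ F` with respect to the norm `α`. -/
abbrev CompletedTensor (α : ReasonableCrossnorm E F) : Type (max u v) :=
  UniformSpace.Completion (NormedTensor α)

/-- The elementary tensor `x ⊗ y`, as an element of the normed space `(E ⊗ F, α)`. -/
def NormedTensor.tmul (α : ReasonableCrossnorm E F) (x : E) (y : F) : NormedTensor α :=
  x ⊗ₜ[ℝ] y

/-- The canonical bilinear map `(x, y) ↦ x ⊗ y` into the completed tensor product. -/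
def tmulL (α : ReasonableCrossnorm E F) : E →L[ℝ] F →L[ℝ] CompletedTensor α :=
  LinearMap.mkContinuous₂
    (LinearMap.mk₂ ℝ (fun x y => (NormedTensor.tmul α x y : CompletedTensor α))
      (fun x x' y => by
        rw [← UniformSpace.Completion.coe_add]
        exact congrArg _ (TensorProduct.add_tmul x x' y))
      (fun c x y => by
        rw [← UniformSpace.Completion.coe_smul]
        exact congrArg _ (TensorProduct.smul_tmul' c x y).symm)
      (fun x y y' => by
        rw [← UniformSpace.Completion.coe_add]
        exact congrArg _ (TensorProduct.tmul_add x y y'))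
      (fun c x y => by
        rw [← UniformSpace.Completion.coe_smul]
        exact congrArg _ (TensorProduct.tmul_smul c x y))) 1
    (fun x y => by
      rw [one_mul, LinearMap.mk₂_apply, UniformSpace.Completion.norm_coe]
      exact α.apply_tmul_le x y)

theorem tmulL_apply (α : ReasonableCrossnorm E F) (x : E) (y : F) :
    tmulL α x y = (NormedTensor.tmul α x y : CompletedTensor α) := rfl

/-- A uniform crossnorm: a choice of a reasonable crossnorm on `E ⊗ F` for all Banach spaces
`E`, `F`, such that `T ⊗ S` is bounded, with norm at most `‖T‖ ‖S‖`, for all bounded operators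
`T`, `S`. -/
structure UniformCrossnorm where
  norm : ∀ (E F : Type u) [NormedAddCommGroup E] [NormedSpace ℝ E] [CompleteSpace E]
    [NormedAddCommGroup F] [NormedSpace ℝ F] [CompleteSpace F], ReasonableCrossnorm E F
  norm_map_le : ∀ {E₁ E₂ F₁ F₂ : Type u}
    [NormedAddCommGroup E₁] [NormedSpace ℝ E₁] [CompleteSpace E₁]
    [NormedAddCommGroup E₂] [NormedSpace ℝ E₂] [CompleteSpace E₂]
    [NormedAddCommGroup F₁] [NormedSpace ℝ F₁] [CompleteSpace F₁]
    [NormedAddCommGroup F₂] [NormedSpace ℝ F₂] [CompleteSpace F₂]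
    (T : E₁ →L[ℝ] E₂) (S : F₁ →L[ℝ] F₂) (z : E₁ ⊗[ℝ] F₁),
    (norm E₂ F₂).toSeminorm (TensorProduct.map (T : E₁ →ₗ[ℝ] E₂) (S : F₁ →ₗ[ℝ] F₂) z)
      ≤ ‖T‖ * ‖S‖ * (norm E₁ F₁).toSeminorm z

variable {E₁ E₂ F₁ F₂ : Type u}
    [NormedAddCommGroup E₁] [NormedSpace ℝ E₁] [CompleteSpace E₁]
    [NormedAddCommGroup E₂] [NormedSpace ℝ E₂] [CompleteSpace E₂]
    [NormedAddCommGroup F₁] [NormedSpace ℝ F₁] [CompleteSpace F₁]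
    [NormedAddCommGroup F₂] [NormedSpace ℝ F₂] [CompleteSpace F₂]

/-- The operator `T ⊗ S` on the algebraic tensor products normed by `α`. -/
def UniformCrossnorm.mapAlg (α : UniformCrossnorm.{u}) (T : E₁ →L[ℝ] E₂) (S : F₁ →L[ℝ] F₂) :
    NormedTensor (α.norm E₁ F₁) →L[ℝ] NormedTensor (α.norm E₂ F₂) :=
  LinearMap.mkContinuous
    (TensorProduct.map (T : E₁ →ₗ[ℝ] E₂) (S : F₁ →ₗ[ℝ] F₂) :
      (E₁ ⊗[ℝ] F₁) →ₗ[ℝ] (E₂ ⊗[ℝ] F₂)) (‖T‖ * ‖S‖) (α.norm_map_le T S)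

/-- The operator `T ⊗ S` on the completed tensor products. -/
def UniformCrossnorm.map (α : UniformCrossnorm.{u}) (T : E₁ →L[ℝ] E₂) (S : F₁ →L[ℝ] F₂) :
    CompletedTensor (α.norm E₁ F₁) →L[ℝ] CompletedTensor (α.norm E₂ F₂) :=
  (α.mapAlg T S).completion

theorem UniformCrossnorm.map_tmulL (α : UniformCrossnorm.{u}) (T : E₁ →L[ℝ] E₂)
    (S : F₁ →L[ℝ] F₂) (x : E₁) (y : F₁) :
    α.map T S (tmulL (α.norm E₁ F₁) x y) = tmulL (α.norm E₂ F₂) (T x) (S y) := by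
  rw [tmulL_apply, tmulL_apply, UniformCrossnorm.map, ContinuousLinearMap.completion_apply_coe]
  rfl

end Tensor

/-! ### Paths and partitions -/

section Paths

variable {E : Type u} [NormedAddCommGroup E]

/-- A path is right-continuous everywhere and has a left limit at every `t > 0`. -/
def IsCadlag (X : ℝ≥0 → E) : Prop :=
  (∀ t, ContinuousWithinAt X (Ici t) t) ∧ ∀ t, 0 < t → ∃ l, Tendsto X (𝓝[<] t) (𝓝 l)

/-- Finite variation on compact intervals. -/
def HasFiniteVariation (X : ℝ≥0 → E) : Prop := LocallyBoundedVariationOn X univ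

theorem HasFiniteVariation.boundedVariationOn_min {X : ℝ≥0 → E} (hX : HasFiniteVariation X) (t : ℝ≥0) :
    BoundedVariationOn (fun s => X (min s t)) univ := by
  have h := hX 0 t (mem_univ _) (mem_univ _)
  rw [univ_inter] at h
  refine ne_top_of_le_ne_top h ?_
  exact eVariationOn.comp_le_of_monotoneOn X (fun s => min s t)
    (fun a _ b _ hab => min_le_min_right t hab) (fun a _ => ⟨zero_le, min_le_right a t⟩)

/-- The jump `ΔX_t = X_t - X_{t-}`, with the convention `X_{0-} = X_0`. -/
def jump (X : ℝ≥0 → E) (t : ℝ≥0) : E := X t - Function.leftLim X t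

/-- The set of times at which the jump of `X` has norm larger than `ε`. -/
def bigJumpTimes (X : ℝ≥0 → E) (ε : ℝ) : Set ℝ≥0 := {t | ε < ‖jump X t‖}

/-- The sum of all jumps of `X` on `]0, t]` of norm larger than `ε`. For a càdlàg path this is a
finite sum. -/
def bigJumpSum (X : ℝ≥0 → E) (ε : ℝ) (t : ℝ≥0) : E :=
  ∑ᶠ s ∈ Ioc 0 t ∩ bigJumpTimes X ε, jump X s

/-- A partition `0 = t₀ < t₁ < ⋯ → ∞` of the half-line into the intervals `]tᵢ, tᵢ₊₁]`. -/
structure HalfLinePartition where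
  pts : ℕ → ℝ≥0
  pts_zero : pts 0 = 0
  strictMono : StrictMono pts
  tendsto : Tendsto pts atTop atTop

namespace HalfLinePartition

variable (π : HalfLinePartition)

theorem exists_le (s : ℝ≥0) : ∃ i, s ≤ π.pts (i + 1) := by
  obtain ⟨i, hi⟩ := (π.tendsto.eventually_ge_atTop s).exists
  exact ⟨i, hi.trans (π.strictMono.monotone (Nat.le_succ i))⟩

open Classical in
/-- The index of the interval of `π` that contains `s > 0`. -/
def index (s : ℝ≥0) : ℕ := Nat.find (π.exists_le s)

/-- The left endpoint of the interval of `π` that contains `s > 0`. -/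
def lower (s : ℝ≥0) : ℝ≥0 := π.pts (π.index s)

/-- The right endpoint of the interval of `π` that contains `s > 0`. -/
def upper (s : ℝ≥0) : ℝ≥0 := π.pts (π.index s + 1)

theorem mem_Ioc_lower_upper {s : ℝ≥0} (hs : 0 < s) : s ∈ Ioc (π.lower s) (π.upper s) := by
  classical
  refine ⟨?_, Nat.find_spec (π.exists_le s)⟩
  by_contra! h
  unfold lower at h
  rcases Nat.eq_zero_or_pos (π.index s) with h0 | h0
  · rw [h0, π.pts_zero] at h
    exact absurd hs (not_lt.2 h)
  · refine Nat.find_min (π.exists_le s) (m := π.index s - 1) (Nat.sub_lt h0 one_pos) ?_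
    rwa [show π.index s - 1 + 1 = π.index s by omega]

end HalfLinePartition

/-- The increment `X_{s ∧ t} - X_{r ∧ t}` over the `i`-th interval `]r, s]` of the partition. -/
def incr (π : HalfLinePartition) (X : ℝ≥0 → E) (t : ℝ≥0) (i : ℕ) : E :=
  X (min (π.pts (i + 1)) t) - X (min (π.pts i) t)

/-- The oscillation `sup_{]r, s] ∈ π} sup {‖X_u - X_v‖ : u, v ∈ ]r, s] ∩ [0, t]}`, as an extended
nonnegative real. -/
def oscPlus (π : HalfLinePartition) (X : ℝ≥0 → E) (t : ℝ≥0) : ℝ≥0∞ :=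
  ⨆ i : ℕ, ⨆ u ∈ Ioc (π.pts i) (π.pts (i + 1)) ∩ Iic t,
    ⨆ v ∈ Ioc (π.pts i) (π.pts (i + 1)) ∩ Iic t, edist (X u) (X v)

/-- Condition (C) on a sequence of partitions, relative to the path `X`. -/
structure ConditionC (π : ℕ → HalfLinePartition) (X : ℝ≥0 → E) : Prop where
  subsingleton : ∀ (t : ℝ≥0) (ε : ℝ), 0 < ε → ∃ N, ∀ n, N ≤ n → ∀ i,
    (Ioc ((π n).pts i) ((π n).pts (i + 1)) ∩ Iic t ∩ bigJumpTimes X ε).Subsingleton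
  tendsto_incr : ∀ s, jump X s ≠ 0 → ∀ t, s ≤ t →
    Tendsto (fun n => incr (π n) X t ((π n).index s)) atTop (𝓝 (jump X s))
  limsup_osc : ∀ t, limsup (fun ε : ℝ =>
    limsup (fun n => oscPlus (π n) (X - bigJumpSum X ε) t) atTop) (𝓝[>] 0) = 0

/-- The sequence of partitions approximates the path `X` from the left. -/
def ApproximatesFromLeft (π : ℕ → HalfLinePartition) (X : ℝ≥0 → E) : Prop :=
  ∀ t, 0 < t → Tendsto (fun n => X ((π n).lower t)) atTop (𝓝 (Function.leftLim X t))

/-- Finite 2-variation along a sequence of partitions. The sums have only finitely many nonzero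
terms. -/
def HasFiniteTwoVariation (π : ℕ → HalfLinePartition) (X : ℝ≥0 → E) : Prop :=
  ∀ t, BddAbove (range fun n => ∑ᶠ i, ‖incr (π n) X t i‖ ^ 2)

/-! ### The vector measure of a path of finite variation -/

variable [CompleteSpace E]

/-- The vector measure `dQ` of the path of finite variation `Q` stopped at `t`. If `Q` is
right-continuous, it has mass `Q_b - Q_a` on `]a, b]` whenever `a ≤ b ≤ t`. -/
def stieltjesMeasure (Q : ℝ≥0 → E) (hQ : HasFiniteVariation Q) (t : ℝ≥0) :
    VectorMeasure ℝ≥0 E :=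
  (hQ.boundedVariationOn_min t).vectorMeasure

theorem stieltjesMeasure_Ioc {Q : ℝ≥0 → E} (hQ : HasFiniteVariation Q) (hc : IsCadlag Q)
    {a b t : ℝ≥0} (hab : a ≤ b) (hbt : b ≤ t) :
    stieltjesMeasure Q hQ t (Ioc a b) = Q b - Q a := by
  have hr : ∀ s, Function.rightLim (fun s => Q (min s t)) s = Q (min s t) := fun s => by
    refine ContinuousWithinAt.rightLim_eq ?_
    refine ContinuousWithinAt.comp (t := Ici (min s t)) (hc.1 (min s t)) ?_
      (fun x hx => min_le_min_right t hx)
    fun_prop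
  rw [stieltjesMeasure, BoundedVariationOn.vectorMeasure_Ioc _ hab, hr, hr, min_eq_left hbt,
    min_eq_left (hab.trans hbt)]

end Paths

/-! ### Quadratic variation and integrals -/

section Integrals

variable {E : Type u} {F : Type v} {G : Type w}
  [NormedAddCommGroup E] [NormedSpace ℝ E] [NormedAddCommGroup F] [NormedSpace ℝ F]
  [NormedAddCommGroup G] [NormedSpace ℝ G]

/-- The two modes of convergence: in norm, or in the weak topology. -/
inductive Mode
  | strong
  | weak

/-- Convergence of a sequence in a normed space, in norm or weakly. -/
def Mode.Converges (m : Mode) (x : ℕ → G) (l : G) : Prop :=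
  match m with
  | .strong => Tendsto x atTop (𝓝 l)
  | .weak => ∀ φ : G →L[ℝ] ℝ, Tendsto (fun n => φ (x n)) atTop (𝓝 (φ l))

/-- `Q` is the (strong or weak) `B`-quadratic covariation of `(X, Y)` along the sequence `π`. The
sums have only finitely many nonzero terms. -/
structure IsQuadraticCovariation (m : Mode) (B : E →L[ℝ] F →L[ℝ] G) (π : ℕ → HalfLinePartition)
    (X : ℝ≥0 → E) (Y : ℝ≥0 → F) (Q : ℝ≥0 → G) : Prop where
  isCadlag : IsCadlag Q
  hasFiniteVariation : HasFiniteVariation Q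
  converges : ∀ t, m.Converges
    (fun n => ∑ᶠ i, B (incr (π n) X t i) (incr (π n) Y t i)) (Q t)
  jump_eq : ∀ t, jump Q t = B (jump X t) (jump Y t)

/-- `Q` is the (strong or weak) `α`-tensor quadratic variation of `X` along `π`. -/
def IsTensorQuadraticVariation (m : Mode) (α : ReasonableCrossnorm E E)
    (π : ℕ → HalfLinePartition) (X : ℝ≥0 → E) (Q : ℝ≥0 → CompletedTensor α) : Prop :=
  IsQuadraticCovariation m (tmulL α) π X X Q

/-- `Y_t` is the Itô-Föllmer integral `∫_0^t ξ_{s-} dX_s` for every `t`: the limit, in norm or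
weakly, of the left Riemann sums along `π`. The sums have only finitely many nonzero terms. -/
def IsItoFollmerIntegral (m : Mode) (π : ℕ → HalfLinePartition)
    (ξ : ℝ≥0 → E →L[ℝ] G) (X : ℝ≥0 → E) (Y : ℝ≥0 → G) : Prop :=
  ∀ t, m.Converges (fun n => ∑ᶠ i, ξ ((π n).pts i) (incr (π n) X t i)) (Y t)

variable [CompleteSpace E]

/-- The integral `∫_{]0, t]} ξ_s dQ_s` exists: `ξ` is Bochner integrable on `]0, t]` with respect
to the total variation of `dQ`. -/
def StieltjesIntegrable (ξ : ℝ≥0 → E →L[ℝ] G) (Q : ℝ≥0 → E) (hQ : HasFiniteVariation Q)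
    (t : ℝ≥0) : Prop :=
  (stieltjesMeasure Q hQ t).IntegrableOn ξ (Ioc 0 t)

/-- The vector Stieltjes integral `∫_{]0, t]} ξ_s dQ_s` of an operator-valued function. -/
def stieltjesIntegral (ξ : ℝ≥0 → E →L[ℝ] G) (Q : ℝ≥0 → E) (hQ : HasFiniteVariation Q)
    (t : ℝ≥0) : G :=
  ((stieltjesMeasure Q hQ t).restrict (Ioc 0 t)).integral ξ
    (ContinuousLinearMap.id ℝ (E →L[ℝ] G))

end Integrals

/-! ### Differentiability -/

section Calculus

variable {E : Type u} {G : Type v}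
  [NormedAddCommGroup E] [NormedSpace ℝ E] [NormedAddCommGroup G] [NormedSpace ℝ G]

/-- The bounded operator `T` is the Gâteaux derivative of `g` at `x`. -/
def HasGateauxDerivAt (g : E → G) (T : E →L[ℝ] G) (x : E) : Prop :=
  ∀ h, HasLineDerivAt ℝ g (T h) x h

/-- The restriction of `g` to every compact set is continuous. -/
def ContinuousOnCompacts {S : Type u} {S' : Type v} [TopologicalSpace S] [TopologicalSpace S']
    (g : S → S') : Prop :=
  ∀ K, IsCompact K → ContinuousOn g K

end Calculus

end ItoFollmer

end

/-!
Write `Z = (A, X)`, `δZ` for the increment of `Z` over an interval `]r, s]` of a partition, and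
`R_A = ∫ D_a f(Z_-) dA`, `R_Q = ∫ D_x² f(Z_-) dQ`. The integral is constructed through the Itô
formula: `Y` is *defined* as
`f(Z_t) - f(Z_0) - R_A(t) - ½ R_Q(t) - ∑_{u ≤ t} ρ(Z_{u-}, Z_u)`, where `ρ` is the Taylor
remainder of `f`, of first order in `a` and second order in `x`. Everything follows from an
expansion of its increments (`ItoData.exists_path`):
`δY = D_x f(Z_r) δX + ½ D_x² f(Z_r) (δX ⊗ δX - δQ) + e`, where the errors `e` are absolutely
summable and `∑ ‖e‖ → 0`.

Two facts control `e`. Left-point Riemann sums approximate Stieltjes integrals with absolutely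
small errors, by dominated convergence with respect to the variation measure
(`sumNormTendstoZero_apply_incr_sub`). The remainders `ρ(Z_r, Z_s)` are absolutely close to the sums
of the `ρ(Z_{u-}, Z_u)` over the jumps in `]r, s]` (`sumNormTendstoZero_apply_sub_sumUpTo`):
finitely many big jumps are resolved exactly in the limit by Condition (C), while on the other
intervals `ρ` is a small multiple of `‖δA‖ + ‖δX‖²`, whose sum is bounded. A uniform Taylor estimate
is available because the range of a càdlàg path on `[0, t]` is relatively compact.

The defects `d = δX ⊗ δX - δQ` are handled by two properties.

* They become small uniformly over the intervals, in norm, even if the quadratic variation is only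
  weak (`IsQuadraticCovariation.eventually_norm_defect_le`). This uses the condition on the jumps of
  `Q`. Along an ultrafilter, the left endpoints of offending intervals converge from one side to
  some `r₀`, and so do the right endpoints to some `s₀`. If `r₀ = s₀`, the limit of the defects is
  zero by continuity or by the jump condition. If `r₀ < s₀`, then the increments of the quadratic
  sums between `r₀` and `s₀` come from one single interval, and this determines the increments of
  `Q` there.
* For a càdlàg operator-valued path `ξ` the sums `∑ ξ(r) d` converge to zero in the given mode
  (`IsQuadraticCovariation.converges_sum_apply_defect`): `ξ` is uniformly close to a step function
  on `[0, t]`, the sum of all `‖d‖` is bounded, and the sums of the `d` themselves converge to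
  zero.

Convergence of the Riemann sums to `Y` is then immediate. Since `∑ ‖d‖² ≤ sup ‖d‖ ∑ ‖d‖ → 0`, the
square sum of `δY - D_x f(Z_r) δX` tends to zero, and by the Cauchy–Schwarz inequality
`∑ δY ⊗ δY` has the same limit as `∑ (D_x f(Z_r))^{⊗2} (δX ⊗ δX)`. Splitting
`δX ⊗ δX = d + δQ` identifies this limit as the integral of `(D_x f(Z_-))^{⊗2}` with respect to `Q`.
-/

namespace ItoFollmer

/-! ### Strong and weak convergence -/

section Mode

variable {G : Type*} [NormedAddCommGroup G] [NormedSpace ℝ G]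
  {H : Type*} [NormedAddCommGroup H] [NormedSpace ℝ H] {m : Mode} {x y : ℕ → G} {l l' : G}

theorem Mode.converges_of_tendsto (m : Mode) (h : Tendsto x atTop (𝓝 l)) : m.Converges x l := by
  cases m
  · exact h
  · exact fun φ => (φ.continuous.tendsto l).comp h

theorem Mode.Converges.add (hx : m.Converges x l) (hy : m.Converges y l') :
    m.Converges (fun n => x n + y n) (l + l') := by
  cases m
  · exact Tendsto.add hx hy
  · intro φ
    simpa using (hx φ).add (hy φ)

theorem Mode.Converges.map (T : G →L[ℝ] H) (hx : m.Converges x l) :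
    m.Converges (fun n => T (x n)) (T l) := by
  cases m
  · exact (T.continuous.tendsto l).comp hx
  · exact fun φ => hx (φ.comp T)

theorem Mode.Converges.neg (hx : m.Converges x l) : m.Converges (fun n => -x n) (-l) :=
  hx.map (-ContinuousLinearMap.id ℝ G)

theorem Mode.Converges.sub (hx : m.Converges x l) (hy : m.Converges y l') :
    m.Converges (fun n => x n - y n) (l - l') := by
  simpa only [sub_eq_add_neg] using hx.add hy.neg

/-- A sequence which can be approximated in norm, up to any `ε > 0`, by sequences converging
to `l` converges to `l`. -/
theorem Mode.converges_of_approx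
    (h : ∀ ε > 0, ∃ y : ℕ → G, m.Converges y l ∧ ∀ᶠ n in atTop, ‖x n - y n‖ ≤ ε) :
    m.Converges x l := by
  cases m
  · refine Metric.tendsto_nhds.2 fun ε hε => ?_
    obtain ⟨y, hy, hxy⟩ := h (ε / 2) (half_pos hε)
    filter_upwards [hxy, (Metric.tendsto_nhds.1 hy) (ε / 2) (half_pos hε)] with n h1 h2
    rw [← dist_eq_norm] at h1
    linarith [dist_triangle (x n) (y n) l]
  · intro φ
    refine Metric.tendsto_nhds.2 fun ε hε => ?_
    have hpos : 0 < ‖φ‖ + 1 := by positivity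
    obtain ⟨y, hy, hxy⟩ := h (ε / (2 * (‖φ‖ + 1))) (by positivity)
    filter_upwards [hxy, (Metric.tendsto_nhds.1 (hy φ)) (ε / 2) (half_pos hε)] with n h1 h2
    have h3 : dist (φ (x n)) (φ (y n)) ≤ ε / 2 := by
      rw [dist_eq_norm, ← map_sub]
      calc ‖φ (x n - y n)‖ ≤ ‖φ‖ * ‖x n - y n‖ := φ.le_opNorm _
        _ ≤ (‖φ‖ + 1) * (ε / (2 * (‖φ‖ + 1))) := by gcongr; linarith
        _ = ε / 2 := by field_simp
    linarith [dist_triangle (φ (x n)) (φ (y n)) (φ l)]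

/-- If a strongly or weakly convergent sequence converges in norm along some finer filter, the two
limits agree. -/
theorem Mode.Converges.eq_of_tendsto {𝒰 : Filter ℕ} [𝒰.NeBot] (h𝒰 : 𝒰 ≤ atTop)
    (hx : m.Converges x l) (hx' : Tendsto x 𝒰 (𝓝 l')) : l = l' := by
  cases m
  · exact tendsto_nhds_unique (Tendsto.mono_left hx h𝒰) hx'
  · refine SeparatingDual.eq_iff_forall_dual_eq (R := ℝ) |>.2 fun φ => ?_
    exact tendsto_nhds_unique (Tendsto.mono_left (hx φ) h𝒰) ((φ.continuous.tendsto l').comp hx')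

end Mode

/-! ### Càdlàg paths -/

section Cadlag

variable {E : Type*} [NormedAddCommGroup E] {F : Type*} [NormedAddCommGroup F] {X Y : ℝ≥0 → E}

theorem leftLim_zero (X : ℝ≥0 → E) : Function.leftLim X 0 = X 0 :=
  leftLim_eq_of_isBot fun _ => zero_le

theorem jump_zero (X : ℝ≥0 → E) : jump X 0 = 0 := by
  rw [jump, leftLim_zero, sub_self]

theorem nhdsLT_neBot {t : ℝ≥0} (ht : 0 < t) : (𝓝[<] t).NeBot :=
  nhdsLT_neBot_of_exists_lt ⟨0, ht⟩

theorem IsCadlag.tendsto_leftLim (hX : IsCadlag X) (t : ℝ≥0) :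
    Tendsto X (𝓝[<] t) (𝓝 (Function.leftLim X t)) := by
  rcases eq_or_ne t 0 with rfl | ht
  · rw [show Iio (0 : ℝ≥0) = ∅ by ext; simp, nhdsWithin_empty]
    exact tendsto_bot
  · exact tendsto_leftLim_of_tendsto (hX.2 t (pos_iff_ne_zero.2 ht))

theorem IsCadlag.tendsto_right (hX : IsCadlag X) (t : ℝ≥0) : Tendsto X (𝓝[≥] t) (𝓝 (X t)) :=
  hX.1 t

theorem leftLim_eq_of_tendsto_pos {t : ℝ≥0} (ht : 0 < t) {l : E} (h : Tendsto X (𝓝[<] t) (𝓝 l)) :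
    Function.leftLim X t = l :=
  haveI := nhdsLT_neBot ht
  leftLim_eq_of_tendsto h

theorem IsCadlag.comp {g : E → F} (hg : Continuous g) (hX : IsCadlag X) :
    IsCadlag fun t => g (X t) :=
  ⟨fun t => hg.continuousAt.comp_continuousWithinAt (hX.1 t),
    fun t _ => ⟨_, (hg.tendsto _).comp (hX.tendsto_leftLim t)⟩⟩

theorem IsCadlag.leftLim_comp {g : E → F} (hg : Continuous g) (hX : IsCadlag X) (t : ℝ≥0) :
    Function.leftLim (fun t => g (X t)) t = g (Function.leftLim X t) := by
  rcases eq_or_ne t 0 with rfl | ht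
  · rw [leftLim_zero, leftLim_zero]
  · exact leftLim_eq_of_tendsto_pos (pos_iff_ne_zero.2 ht)
      ((hg.tendsto _).comp (hX.tendsto_leftLim t))

theorem IsCadlag.prodMk {Y : ℝ≥0 → F} (hX : IsCadlag X) (hY : IsCadlag Y) :
    IsCadlag fun t => (X t, Y t) :=
  ⟨fun t => (hX.1 t).prodMk (hY.1 t),
    fun t _ => ⟨_, (hX.tendsto_leftLim t).prodMk_nhds (hY.tendsto_leftLim t)⟩⟩

theorem IsCadlag.leftLim_prodMk {Y : ℝ≥0 → F} (hX : IsCadlag X) (hY : IsCadlag Y) (t : ℝ≥0) :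
    Function.leftLim (fun t => (X t, Y t)) t = (Function.leftLim X t, Function.leftLim Y t) := by
  rcases eq_or_ne t 0 with rfl | ht
  · simp only [leftLim_zero]
  · exact leftLim_eq_of_tendsto_pos (pos_iff_ne_zero.2 ht)
      ((hX.tendsto_leftLim t).prodMk_nhds (hY.tendsto_leftLim t))

theorem IsCadlag.sub (hX : IsCadlag X) (hY : IsCadlag Y) : IsCadlag fun t => X t - Y t :=
  (hX.prodMk hY).comp continuous_sub

theorem IsCadlag.leftLim_sub (hX : IsCadlag X) (hY : IsCadlag Y) (t : ℝ≥0) :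
    Function.leftLim (fun t => X t - Y t) t = Function.leftLim X t - Function.leftLim Y t :=
  ((hX.prodMk hY).leftLim_comp continuous_sub t).trans (by rw [hX.leftLim_prodMk hY])

theorem IsCadlag.jump_sub (hX : IsCadlag X) (hY : IsCadlag Y) (t : ℝ≥0) :
    jump (fun t => X t - Y t) t = jump X t - jump Y t := by
  rw [jump, hX.leftLim_sub hY, jump, jump]
  abel

/-- `[a, b[` is a short piece of the path `X`: its oscillation there is at most `ε`. -/
def OscStep (X : ℝ≥0 → E) (ε : ℝ) (a b : ℝ≥0) : Prop :=
  a ≤ b ∧ ∀ u ∈ Ico a b, ∀ v ∈ Ico a b, ‖X u - X v‖ ≤ ε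

/-- A càdlàg path has, for every `ε > 0`, a finite subdivision `0 = s₀ ≤ ⋯ ≤ s_k = t` with
oscillation at most `ε` on every `[s_j, s_{j+1}[`. The subdivision is encoded as a chain of
steps. -/
theorem IsCadlag.reflTransGen_oscStep (hX : IsCadlag X) {ε : ℝ} (hε : 0 < ε) (t : ℝ≥0) :
    Relation.ReflTransGen (OscStep X ε) 0 t := by
  -- Near every limit value the oscillation is small.
  have key : ∀ {l : E} {s : Set ℝ≥0}, (∀ u ∈ s, ‖X u - l‖ < ε / 2) →
      ∀ u ∈ s, ∀ v ∈ s, ‖X u - X v‖ ≤ ε := by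
    intro l s hs u hu v hv
    have h1 := hs u hu
    have h2 := hs v hv
    rw [← dist_eq_norm] at *
    linarith [dist_triangle_right (X u) (X v) l]
  set S : Set ℝ≥0 := {b | Relation.ReflTransGen (OscStep X ε) 0 b} with hS
  by_contra hcon
  have h0 : (0 : ℝ≥0) ∈ S := Relation.ReflTransGen.refl
  -- Everything up to the supremum `c` of the set of times reached before `t` is reached.
  set c := sSup (S ∩ Iic t) with hc
  have hbdd : BddAbove (S ∩ Iic t) := ⟨t, fun x hx => hx.2⟩
  have hne : (S ∩ Iic t).Nonempty := ⟨0, h0, mem_Iic.2 zero_le⟩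
  have hct : c ≤ t := csSup_le hne fun x hx => hx.2
  have hcS : c ∈ S := by
    rcases eq_or_ne c 0 with h | h
    · rw [h]; exact h0
    have hcpos : 0 < c := pos_iff_ne_zero.2 h
    have hev : ∀ᶠ u in 𝓝[<] c, ‖X u - Function.leftLim X c‖ < ε / 2 := by
      have := (Metric.tendsto_nhds.1 (hX.tendsto_leftLim c)) (ε / 2) (half_pos hε)
      simpa only [dist_eq_norm] using this
    obtain ⟨d, hd, hdc⟩ := (mem_nhdsLT_iff_exists_Ioo_subset' hcpos).1 hev
    obtain ⟨b, hb, hdb⟩ := exists_lt_of_lt_csSup hne (show d < sSup (S ∩ Iic t) from hd)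
    have hbc : b ≤ c := le_csSup hbdd hb
    exact hb.1.tail ⟨hbc, key fun u hu => hdc ⟨hdb.trans_le hu.1, hu.2⟩⟩
  have hlt : c < t := lt_of_le_of_ne hct fun h => hcon (h ▸ hcS)
  have hev : ∀ᶠ u in 𝓝[≥] c, ‖X u - X c‖ < ε / 2 := by
    have := (Metric.tendsto_nhds.1 (hX.tendsto_right c)) (ε / 2) (half_pos hε)
    simpa only [dist_eq_norm] using this
  obtain ⟨d, hd, hcd⟩ := (mem_nhdsGE_iff_exists_Ico_subset' hlt).1 hev
  have hmin : c < min d t := lt_min hd hlt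
  have : min d t ∈ S := hcS.tail
    ⟨hmin.le, key fun u hu => hcd ⟨hu.1, hu.2.trans_le (min_le_left _ _)⟩⟩
  exact (le_csSup hbdd ⟨this, mem_Iic.2 (min_le_right _ _)⟩).not_gt hmin

theorem IsCadlag.isCompact_closure_image [CompleteSpace E] (hX : IsCadlag X) (t : ℝ≥0) :
    IsCompact (closure (X '' Iic t)) := by
  refine TotallyBounded.isCompact_of_isClosed (TotallyBounded.closure ?_) isClosed_closure
  refine Metric.totallyBounded_iff.2 fun ε hε => ?_
  have : ∃ S : Set E, S.Finite ∧ X '' Iio t ⊆ ⋃ y ∈ S, Metric.ball y ε := by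
    induction hX.reflTransGen_oscStep (half_pos hε) t with
    | refl => exact ⟨∅, finite_empty, by simp⟩
    | @tail b c _ hbc ih =>
      obtain ⟨S, hS, hXS⟩ := ih
      refine ⟨insert (X b) S, hS.insert _, ?_⟩
      rintro _ ⟨u, hu, rfl⟩
      rw [biUnion_insert]
      rcases lt_or_ge u b with h | h
      · exact Or.inr (hXS ⟨u, h, rfl⟩)
      · have hb : b < c := h.trans_lt hu
        refine Or.inl ?_
        rw [Metric.mem_ball, dist_eq_norm]
        linarith [hbc.2 u ⟨h, hu⟩ b ⟨le_rfl, hb⟩]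
  obtain ⟨S, hS, hXS⟩ := this
  refine ⟨insert (X t) S, hS.insert _, ?_⟩
  rw [biUnion_insert, ← Iio_union_right, image_union, image_singleton]
  rintro y (hy | rfl)
  · exact Or.inr (hXS hy)
  · exact Or.inl (Metric.mem_ball_self hε)

theorem IsCadlag.leftLim_mem_closure (hX : IsCadlag X) {s t : ℝ≥0} (hs : s ≤ t) :
    Function.leftLim X s ∈ closure (X '' Iic t) := by
  rcases eq_or_ne s 0 with rfl | h
  · rw [leftLim_zero]
    exact subset_closure ⟨0, hs, rfl⟩
  · have := nhdsLT_neBot (pos_iff_ne_zero.2 h)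
    refine mem_closure_of_tendsto (hX.tendsto_leftLim s) ?_
    filter_upwards [self_mem_nhdsWithin] with u hu
    exact ⟨u, (le_of_lt hu).trans hs, rfl⟩

theorem IsCadlag.exists_norm_le (hX : IsCadlag X) (t : ℝ≥0) :
    ∃ C, 0 ≤ C ∧ (∀ s ≤ t, ‖X s‖ ≤ C) ∧ ∀ s ≤ t, ‖Function.leftLim X s‖ ≤ C := by
  have : ∃ C, ∀ s < t, ‖X s‖ ≤ C := by
    induction hX.reflTransGen_oscStep one_pos t with
    | refl => exact ⟨0, by simp⟩
    | @tail b c _ hbc ih =>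
      obtain ⟨C, hC⟩ := ih
      refine ⟨max C (‖X b‖ + 1), fun s hs => ?_⟩
      rcases lt_or_ge s b with h | h
      · exact (hC s h).trans (le_max_left _ _)
      · refine le_max_of_le_right ?_
        have := hbc.2 s ⟨h, hs⟩ b ⟨le_rfl, h.trans_lt hs⟩
        linarith [norm_sub_norm_le (X s) (X b)]
  obtain ⟨C, hC⟩ := this
  have h1 : ∀ s ≤ t, ‖X s‖ ≤ max C ‖X t‖ := fun s hs => by
    rcases hs.lt_or_eq with h | rfl
    · exact (hC s h).trans (le_max_left _ _)
    · exact le_max_right _ _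
  refine ⟨max C ‖X t‖, (norm_nonneg _).trans (le_max_right _ _), h1, fun s hs => ?_⟩
  have h2 : closure (X '' Iic t) ⊆ Metric.closedBall 0 (max C ‖X t‖) := by
    refine closure_minimal ?_ Metric.isClosed_closedBall
    rintro _ ⟨u, hu, rfl⟩
    simpa using h1 u hu
  simpa using h2 (hX.leftLim_mem_closure hs)

end Cadlag

/-! ### Sums along a partition -/

section Partition

variable {E : Type*} [NormedAddCommGroup E] (π : HalfLinePartition)

theorem HalfLinePartition.mono : Monotone π.pts := π.strictMono.monotone

theorem HalfLinePartition.lt_succ (i : ℕ) : π.pts i < π.pts (i + 1) := π.strictMono i.lt_succ_self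

theorem HalfLinePartition.exists_le_pts (t : ℝ≥0) : ∃ N, t ≤ π.pts N :=
  (π.tendsto.eventually_ge_atTop t).exists

theorem HalfLinePartition.index_eq {s : ℝ≥0} {i : ℕ}
    (h : s ∈ Ioc (π.pts i) (π.pts (i + 1))) : π.index s = i := by
  have hs : 0 < s := zero_le.trans_lt h.1
  obtain ⟨h1, h2⟩ := π.mem_Ioc_lower_upper hs
  have h3 := π.strictMono.lt_iff_lt.1 (h1.trans_le h.2)
  have h4 := π.strictMono.lt_iff_lt.1 (h.1.trans_le h2)
  omega

theorem HalfLinePartition.lower_eq {s : ℝ≥0} {i : ℕ}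
    (h : s ∈ Ioc (π.pts i) (π.pts (i + 1))) : π.lower s = π.pts i := by
  rw [lower, π.index_eq h]

theorem HalfLinePartition.lower_zero : π.lower 0 = 0 := by
  have : π.index 0 = 0 := by
    classical
    exact (Nat.find_eq_zero _).2 zero_le
  rw [lower, this, π.pts_zero]

theorem HalfLinePartition.lower_le (s : ℝ≥0) : π.lower s ≤ s := by
  rcases eq_or_ne s 0 with rfl | hs
  · exact π.lower_zero.le
  · exact (π.mem_Ioc_lower_upper (pos_iff_ne_zero.2 hs)).1.le

theorem HalfLinePartition.measurable_index : Measurable π.index := by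
  refine Monotone.measurable fun s t hst => ?_
  classical
  exact Nat.find_mono fun i hi => hst.trans hi

variable {π}

theorem finsum_eq_sum_range {g : ℕ → E} {t : ℝ≥0} {N : ℕ} (hg : ∀ i, t ≤ π.pts i → g i = 0)
    (hN : t ≤ π.pts N) : ∑ᶠ i, g i = ∑ i ∈ Finset.range N, g i := by
  refine finsum_eq_sum_of_support_subset _ fun i hi => ?_
  rw [Finset.coe_range, mem_Iio]
  by_contra! h
  exact hi (hg i (hN.trans (π.mono h)))

theorem incr_of_le {X : ℝ≥0 → E} {t : ℝ≥0} {i : ℕ} (h : t ≤ π.pts i) : incr π X t i = 0 := by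
  rw [incr, min_eq_right h, min_eq_right (h.trans (π.mono i.le_succ)), sub_self]

theorem incr_of_ge {X : ℝ≥0 → E} {t : ℝ≥0} {i : ℕ} (h : π.pts (i + 1) ≤ t) :
    incr π X t i = X (π.pts (i + 1)) - X (π.pts i) := by
  rw [incr, min_eq_left h, min_eq_left ((π.mono i.le_succ).trans h)]

theorem sum_incr {X : ℝ≥0 → E} {t : ℝ≥0} (N : ℕ) :
    ∑ i ∈ Finset.range N, incr π X t i = X (min (π.pts N) t) - X 0 := by
  simp only [incr]
  rw [Finset.sum_range_sub (fun i => X (min (π.pts i) t)), π.pts_zero, min_eq_left zero_le]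

theorem sum_incr_eq {X : ℝ≥0 → E} {t : ℝ≥0} {N : ℕ} (hN : t ≤ π.pts N) :
    ∑ i ∈ Finset.range N, incr π X t i = X t - X 0 := by
  rw [sum_incr, min_eq_right hN]

end Partition

/-! ### Vector measures on the half-line -/

section Measure

variable {E : Type*} [NormedAddCommGroup E]

theorem vectorMeasure_ext_Ioc {μ ν : VectorMeasure ℝ≥0 E} (h0 : μ {0} = ν {0})
    (h : ∀ b, μ (Ioc 0 b) = ν (Ioc 0 b)) : μ = ν := by
  have hIic : ∀ b, μ (Iic b) = ν (Iic b) := fun b => by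
    have hd : Disjoint {0} (Ioc 0 b) := by simp
    have hu : Iic b = {0} ∪ Ioc 0 b := by
      ext x
      simp only [mem_Iic, singleton_union, mem_insert_iff, mem_Ioc]
      constructor
      · intro hx
        rcases eq_or_ne x 0 with h | h
        · exact Or.inl h
        · exact Or.inr ⟨pos_iff_ne_zero.2 h, hx⟩
      · rintro (rfl | hx)
        · exact zero_le
        · exact hx.2
    rw [hu, VectorMeasure.of_union hd (measurableSet_singleton 0) measurableSet_Ioc,
      VectorMeasure.of_union hd (measurableSet_singleton 0) measurableSet_Ioc, h0, h]
  refine VectorMeasure.ext_of_generateFrom (range Iic) ?_ ?_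
    (by simpa using isPiSystem_image_Iic (univ : Set ℝ≥0)) ?_
  · rintro _ ⟨b, rfl⟩
    exact hIic b
  · rw [← borel_eq_generateFrom_Iic]
    exact BorelSpace.measurable_eq
  · have hun : (univ : Set ℝ≥0) = ⋃ n : ℕ, Iic (n : ℝ≥0) := by
      refine (eq_univ_of_forall fun x => ?_).symm
      obtain ⟨n, hn⟩ := exists_nat_ge x
      exact mem_iUnion.2 ⟨n, hn⟩
    have hm : Monotone fun n : ℕ => Iic (n : ℝ≥0) := fun i j hij =>
      Iic_subset_Iic.2 (Nat.cast_le.2 hij)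
    rw [hun]
    refine tendsto_nhds_unique
      (VectorMeasure.tendsto_vectorMeasure_iUnion_atTop_nat hm fun _ => measurableSet_Iic) ?_
    simp only [hIic]
    exact VectorMeasure.tendsto_vectorMeasure_iUnion_atTop_nat hm fun _ => measurableSet_Iic

variable [CompleteSpace E]

/-- The vector measure of a function of bounded variation on the half-line has finite total
variation: away from the origin it is dominated by the Stieltjes measure of the variation. -/
theorem isFiniteMeasure_variation_vectorMeasure {f : ℝ≥0 → E} (hf : BoundedVariationOn f univ) :
    IsFiniteMeasure hf.vectorMeasure.variation := by
  set M : Measure ℝ≥0 := (hf.stieltjesFunctionRightLim 0).measure with hM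
  have hMf : IsFiniteMeasure M := by
    apply StieltjesFunction.isFiniteMeasure_of_forall_abs_le
      (C := (eVariationOn f.rightLim univ).toReal) _ (fun x ↦ ?_)
    exact variationOnFromTo.abs_le_eVariationOn hf.rightLim
  have A : ∀ s ∈ {s | ∃ u v, u ≤ v ∧ s = Ioc u v},
      ‖AddContent.onIoc f.rightLim s‖ₑ ≤ M s := by
    rintro s ⟨u, v, huv, rfl⟩
    rw [AddContent.onIoc_apply huv, hM, StieltjesFunction.measure_Ioc,
      BoundedVariationOn.stieltjesFunctionRightLim_apply,
      BoundedVariationOn.stieltjesFunctionRightLim_apply,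
      ← variationOnFromTo.add hf.rightLim.locallyBoundedVariationOn
      (mem_univ 0) (mem_univ u) (mem_univ v)]
    simp only [add_sub_cancel_left, variationOnFromTo, huv, ↓reduceIte, univ_inter]
    rw [ENNReal.ofReal_toReal ((eVariationOn.mono _ (subset_univ _)).trans_lt
      hf.rightLim.lt_top).ne, ← edist_eq_enorm_sub]
    exact eVariationOn.edist_le _ (right_mem_Icc.2 huv) (left_mem_Icc.2 huv)
  have B : (inferInstance : MeasurableSpace ℝ≥0)
      = MeasurableSpace.generateFrom {s : Set ℝ≥0 | ∃ u v, u ≤ v ∧ s = Ioc u v} := by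
    rw [BorelSpace.measurable_eq (α := ℝ≥0), borel_eq_generateFrom_Ioc_le ℝ≥0]
    refine congrArg MeasurableSpace.generateFrom (Set.ext fun s => ⟨?_, ?_⟩)
    · rintro ⟨u, v, huv, rfl⟩
      exact ⟨u, v, huv, rfl⟩
    · rintro ⟨u, v, huv, rfl⟩
      exact ⟨u, v, huv, rfl⟩
  obtain ⟨m, hm, hmM⟩ :=
    VectorMeasure.exists_extension_of_isSetSemiring_of_le_measure_of_generateFrom
      IsSetSemiring.Ioc A B
  set c := hf.vectorMeasure {0} - m {0} with hc
  have hsing : MeasurableSet ({0} : Set ℝ≥0) := measurableSet_singleton 0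
  have heq : hf.vectorMeasure = m + VectorMeasure.dirac 0 c := by
    refine vectorMeasure_ext_Ioc ?_ fun b => ?_
    · rw [add_apply, VectorMeasure.dirac_apply_of_mem hsing (mem_singleton _), hc]
      abel
    · rw [add_apply, VectorMeasure.dirac_apply_of_notMem (by simp), add_zero,
        hm _ ⟨0, b, zero_le, rfl⟩, AddContent.onIoc_apply zero_le, hf.vectorMeasure_Ioc zero_le]
  have hle : hf.vectorMeasure.variation ≤ M + ‖c‖ₑ • Measure.dirac 0 := by
    rw [heq]
    refine VectorMeasure.variation_add_le.trans (add_le_add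
      (VectorMeasure.variation_le_of_forall_enorm_le fun s _ => hmM s) ?_)
    rw [VectorMeasure.variation_dirac]
  have : IsFiniteMeasure (M + ‖c‖ₑ • Measure.dirac (0 : ℝ≥0)) := by
    have : IsFiniteMeasure (‖c‖ₑ • Measure.dirac (0 : ℝ≥0)) :=
      Measure.smul_finite _ enorm_ne_top
    infer_instance
  exact isFiniteMeasure_of_le _ hle

end Measure

/-! ### Stieltjes integrals of operator-valued functions -/

section Stieltjes

variable {E : Type*} [NormedAddCommGroup E] [CompleteSpace E] {Q : ℝ≥0 → E}

instance (hQ : HasFiniteVariation Q) (t : ℝ≥0) :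
    IsFiniteMeasure (stieltjesMeasure Q hQ t).variation :=
  isFiniteMeasure_variation_vectorMeasure _

theorem stieltjesMeasure_singleton (hQ : HasFiniteVariation Q) (hc : IsCadlag Q) {s t : ℝ≥0}
    (hst : s ≤ t) : stieltjesMeasure Q hQ t {s} = jump Q s := by
  have hr : Function.rightLim (fun s => Q (min s t)) s = Q (min s t) := by
    refine ContinuousWithinAt.rightLim_eq ?_
    refine ContinuousWithinAt.comp (t := Ici (min s t)) (hc.1 (min s t)) ?_
      (fun x hx => min_le_min_right t hx)
    fun_prop
  have hl : Function.leftLim (fun s => Q (min s t)) s = Function.leftLim Q s := by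
    rcases eq_or_ne s 0 with rfl | h
    · rw [leftLim_zero, leftLim_zero, min_eq_left hst]
    · refine leftLim_eq_of_tendsto_pos (pos_iff_ne_zero.2 h)
        ((hc.tendsto_leftLim s).congr' ?_)
      filter_upwards [self_mem_nhdsWithin] with u hu
      rw [min_eq_left ((le_of_lt hu).trans hst)]
  rw [stieltjesMeasure, BoundedVariationOn.vectorMeasure_singleton, hr, hl, min_eq_left hst, jump]

/-- Stopping the path later does not change its measure on `]0, t]`. -/
theorem stieltjesMeasure_restrict (hQ : HasFiniteVariation Q) (hc : IsCadlag Q) {t T : ℝ≥0}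
    (htT : t ≤ T) : (stieltjesMeasure Q hQ t).restrict (Ioc 0 t)
      = (stieltjesMeasure Q hQ T).restrict (Ioc 0 t) := by
  refine vectorMeasure_ext_Ioc ?_ fun b => ?_
  · rw [VectorMeasure.restrict_apply _ measurableSet_Ioc (measurableSet_singleton 0),
      VectorMeasure.restrict_apply _ measurableSet_Ioc (measurableSet_singleton 0)]
    simp
  · rw [VectorMeasure.restrict_apply _ measurableSet_Ioc measurableSet_Ioc,
      VectorMeasure.restrict_apply _ measurableSet_Ioc measurableSet_Ioc, Ioc_inter_Ioc,
      sup_idem, stieltjesMeasure_Ioc hQ hc zero_le inf_le_right,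
      stieltjesMeasure_Ioc hQ hc zero_le (inf_le_right.trans htT)]

theorem norm_sub_le_variation (hQ : HasFiniteVariation Q) (hc : IsCadlag Q) {a b T : ℝ≥0}
    (hab : a ≤ b) (hb : b ≤ T) :
    ‖Q b - Q a‖ ≤ (stieltjesMeasure Q hQ T).variation.real (Ioc a b) := by
  rw [← stieltjesMeasure_Ioc hQ hc hab hb]
  exact VectorMeasure.norm_measure_le_variation

/-- Telescoping for a finite measure along a stopped partition. -/
theorem sum_measure_Ioc_le (μ : Measure ℝ≥0) [IsFiniteMeasure μ] (π : HalfLinePartition)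
    (t : ℝ≥0) (N : ℕ) :
    ∑ i ∈ Finset.range N, μ.real (Ioc (min (π.pts i) t) (min (π.pts (i + 1)) t))
      ≤ μ.real (Ioc 0 t) := by
  have h : ∀ i, μ.real (Ioc (min (π.pts i) t) (min (π.pts (i + 1)) t))
      = μ.real (Ioc 0 (min (π.pts (i + 1)) t)) - μ.real (Ioc 0 (min (π.pts i) t)) := fun i => by
    have hm : min (π.pts i) t ≤ min (π.pts (i + 1)) t := min_le_min_right t (π.mono i.le_succ)
    rw [← Ioc_union_Ioc_eq_Ioc zero_le hm, measureReal_union (Ioc_disjoint_Ioc_of_le le_rfl)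
      measurableSet_Ioc]
    ring
  simp only [h]
  rw [Finset.sum_range_sub (fun i => μ.real (Ioc 0 (min (π.pts i) t)))]
  exact (sub_le_self _ measureReal_nonneg).trans
    (measureReal_mono (Ioc_subset_Ioc_right (min_le_right _ _)))

theorem exists_sum_norm_incr_le (hQ : HasFiniteVariation Q) (hc : IsCadlag Q) (t : ℝ≥0) :
    ∃ C, 0 ≤ C ∧ ∀ (π : HalfLinePartition) (N : ℕ),
      ∑ i ∈ Finset.range N, ‖incr π Q t i‖ ≤ C := by
  refine ⟨_, measureReal_nonneg, fun π N => (Finset.sum_le_sum fun i _ => ?_).trans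
    (sum_measure_Ioc_le (stieltjesMeasure Q hQ t).variation π t N)⟩
  exact norm_sub_le_variation hQ hc (min_le_min_right t (π.mono i.le_succ)) (min_le_right _ _)

theorem exists_sum_norm_jump_le (hQ : HasFiniteVariation Q) (hc : IsCadlag Q) (t : ℝ≥0) :
    ∃ C, 0 ≤ C ∧ ∀ S : Finset ℝ≥0, (∀ s ∈ S, s ≤ t) → ∑ s ∈ S, ‖jump Q s‖ ≤ C := by
  refine ⟨(stieltjesMeasure Q hQ t).variation.real univ, measureReal_nonneg, fun S hS => ?_⟩
  calc ∑ s ∈ S, ‖jump Q s‖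
      ≤ ∑ s ∈ S, (stieltjesMeasure Q hQ t).variation.real {s} := by
        refine Finset.sum_le_sum fun s hs => ?_
        rw [← stieltjesMeasure_singleton hQ hc (hS s hs)]
        exact VectorMeasure.norm_measure_le_variation
    _ = (stieltjesMeasure Q hQ t).variation.real S := sum_measureReal_singleton S
    _ ≤ _ := measureReal_mono (subset_univ _)

/-- The left limits of a path are a measurable function, as the limit of the functions which are
constant on each interval of the partitions. -/
theorem stronglyMeasurable_leftLim {H : Type*} [NormedAddCommGroup H]
    {ξ : ℝ≥0 → H} {π : ℕ → HalfLinePartition} (hL : ApproximatesFromLeft π ξ) :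
    StronglyMeasurable (Function.leftLim ξ) := by
  refine stronglyMeasurable_of_tendsto (f := fun n s => ξ ((π n).lower s)) atTop (fun n => ?_)
    (tendsto_pi_nhds.2 fun s => ?_)
  · exact (StronglyMeasurable.of_discrete (f := fun i => ξ ((π n).pts i))).comp_measurable
      (π n).measurable_index
  · rcases eq_or_ne s 0 with rfl | hs
    · simp only [HalfLinePartition.lower_zero, leftLim_zero]
      exact tendsto_const_nhds
    · exact hL s (pos_iff_ne_zero.2 hs)

variable [NormedSpace ℝ E] {G : Type*} [NormedAddCommGroup G] [NormedSpace ℝ G]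

/-- A strongly measurable function which is bounded on compact intervals. -/
structure IsLocBddMeasurable {H : Type*} [NormedAddCommGroup H] (η : ℝ≥0 → H) : Prop where
  stronglyMeasurable : StronglyMeasurable η
  bounded : ∀ T, ∃ C, 0 ≤ C ∧ ∀ s ≤ T, ‖η s‖ ≤ C

theorem IsCadlag.isLocBddMeasurable_leftLim {H : Type*} [NormedAddCommGroup H]
    {ξ : ℝ≥0 → H} (hξ : IsCadlag ξ) {π : ℕ → HalfLinePartition}
    (hL : ApproximatesFromLeft π ξ) : IsLocBddMeasurable (Function.leftLim ξ) where
  stronglyMeasurable := stronglyMeasurable_leftLim hL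
  bounded T := by
    obtain ⟨C, hC, -, h⟩ := hξ.exists_norm_le T
    exact ⟨C, hC, h⟩

variable {η : ℝ≥0 → E →L[ℝ] G}

theorem IsLocBddMeasurable.integrableOn (hη : IsLocBddMeasurable η) (hQ : HasFiniteVariation Q)
    {T : ℝ≥0} {S : Set ℝ≥0} (hS : S ⊆ Iic T) (hSm : MeasurableSet S) (T' : ℝ≥0) :
    (stieltjesMeasure Q hQ T').IntegrableOn η S := by
  obtain ⟨C, hC, h⟩ := hη.bounded T
  rw [VectorMeasure.IntegrableOn, VectorMeasure.Integrable, VectorMeasure.variation_restrict hSm]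
  refine Integrable.of_bound hη.stronglyMeasurable.aestronglyMeasurable C ?_
  exact (ae_restrict_iff' hSm).2 (Eventually.of_forall fun s hs => h s (hS hs))

theorem IsLocBddMeasurable.stieltjesIntegrable (hη : IsLocBddMeasurable η)
    (hQ : HasFiniteVariation Q) (t : ℝ≥0) : StieltjesIntegrable η Q hQ t :=
  hη.integrableOn hQ (fun _ hs => hs.2) measurableSet_Ioc t

theorem stieltjesIntegral_sub (hη : IsLocBddMeasurable η) (hQ : HasFiniteVariation Q)
    (hc : IsCadlag Q) {a b T : ℝ≥0} (hab : a ≤ b) (hbT : b ≤ T) :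
    stieltjesIntegral η Q hQ b - stieltjesIntegral η Q hQ a
      = ((stieltjesMeasure Q hQ T).restrict (Ioc a b)).integral η
        (ContinuousLinearMap.id ℝ (E →L[ℝ] G)) := by
  rw [stieltjesIntegral, stieltjesIntegral, stieltjesMeasure_restrict hQ hc hbT,
    stieltjesMeasure_restrict hQ hc (hab.trans hbT), ← Ioc_union_Ioc_eq_Ioc zero_le hab,
    VectorMeasure.setIntegral_union (Ioc_disjoint_Ioc_of_le le_rfl) measurableSet_Ioc
      measurableSet_Ioc
      (hη.integrableOn hQ (T := T) (fun _ hs => hs.2.trans (hab.trans hbT)) measurableSet_Ioc T)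
      (hη.integrableOn hQ (T := T) (fun _ hs => hs.2.trans hbT) measurableSet_Ioc T)]
  abel

theorem norm_setIntegral_le (hQ : HasFiniteVariation Q) {T : ℝ≥0} {S : Set ℝ≥0} {C : ℝ}
    (hC : 0 ≤ C) (h : ∀ s ∈ S, ‖η s‖ ≤ C) :
    ‖((stieltjesMeasure Q hQ T).restrict S).integral η (ContinuousLinearMap.id ℝ (E →L[ℝ] G))‖
      ≤ C * (stieltjesMeasure Q hQ T).variation.real S := by
  refine (VectorMeasure.norm_setIntegral_le_of_norm_le_const h).trans ?_
  have h1 : ‖ContinuousLinearMap.id ℝ (E →L[ℝ] G)‖ ≤ 1 := ContinuousLinearMap.norm_id_le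
  have : C * ‖ContinuousLinearMap.id ℝ (E →L[ℝ] G)‖ ≤ C * 1 := by gcongr
  rw [mul_one] at this
  gcongr

/-- A path whose increments are dominated by a finite measure is right-continuous. -/
theorem continuousWithinAt_of_norm_sub_le {H : Type*} [NormedAddCommGroup H]
    {R : ℝ≥0 → H} {μ : Measure ℝ≥0} [IsFiniteMeasure μ]
    {C : ℝ} {t T : ℝ≥0} (htT : t < T)
    (h : ∀ s, t ≤ s → s ≤ T → ‖R s - R t‖ ≤ C * μ.real (Ioc t s)) :
    ContinuousWithinAt R (Ici t) t := by
  have h1 : Tendsto (fun s => μ (Ioc t s)) (𝓝[≥] t) (𝓝 0) := by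
    have h2 : Tendsto (fun s => μ (Ioc t s)) (𝓝[>] t) (𝓝 0) := by
      have := tendsto_measure_biInter_gt (μ := μ) (s := fun s => Ioc t s) (a := t)
        (fun s _ => measurableSet_Ioc.nullMeasurableSet)
        (fun i j _ hij => Ioc_subset_Ioc_right hij) ⟨T, htT, measure_ne_top _ _⟩
      have he : ⋂ r, ⋂ (_ : r > t), Ioc t r = ∅ := by
        ext x
        simp only [mem_iInter, mem_Ioc, mem_empty_iff_false, iff_false, not_forall]
        by_contra! hx
        obtain ⟨r, hr, hrx⟩ := exists_between (hx T htT).1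
        exact (hx r hr).2.not_gt hrx
      rwa [he, measure_empty] at this
    rw [← Ioi_insert, nhdsWithin_insert]
    refine Tendsto.sup ?_ h2
    rw [tendsto_pure_left]
    intro s hs
    simpa using mem_of_mem_nhds hs
  have h2 : Tendsto (fun s => C * μ.real (Ioc t s)) (𝓝[≥] t) (𝓝 0) := by
    simpa [Measure.real] using
      ((ENNReal.tendsto_toReal ENNReal.zero_ne_top).comp h1).const_mul C
  rw [ContinuousWithinAt, tendsto_iff_norm_sub_tendsto_zero]
  refine squeeze_zero' (Eventually.of_forall fun _ => norm_nonneg _) ?_ h2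
  filter_upwards [self_mem_nhdsWithin, mem_nhdsWithin_of_mem_nhds (Iic_mem_nhds htT)]
    with s hs hsT
  exact h s hs hsT

/-- A path whose distance to a point is dominated by the mass of `]s, t[` has that point as left
limit at `t`. -/
theorem tendsto_nhdsLT_of_norm_sub_le {H : Type*} [NormedAddCommGroup H]
    {R : ℝ≥0 → H} {μ : Measure ℝ≥0} [IsFiniteMeasure μ]
    {C : ℝ} {t : ℝ≥0} {l : H} (h : ∀ s < t, ‖R s - l‖ ≤ C * μ.real (Ioo s t)) :
    Tendsto R (𝓝[<] t) (𝓝 l) := by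
  rcases eq_or_ne t 0 with rfl | ht
  · rw [show Iio (0 : ℝ≥0) = ∅ by ext; simp, nhdsWithin_empty]
    exact tendsto_bot
  have ht' : 0 < t := pos_iff_ne_zero.2 ht
  have h1 : Tendsto (fun s => μ (Ioo s t)) (𝓝[<] t) (𝓝 0) := by
    have := tendsto_measure_biInter_gt (ι := ℝ≥0ᵒᵈ) (μ := μ)
      (s := fun s => Ioo (OrderDual.ofDual s) t) (a := OrderDual.toDual t)
      (fun s _ => measurableSet_Ioo.nullMeasurableSet)
      (fun i j _ hij => Ioo_subset_Ioo_left hij)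
      ⟨OrderDual.toDual 0, ht', measure_ne_top _ _⟩
    have he : ⋂ r, ⋂ (_ : r > OrderDual.toDual t), Ioo (OrderDual.ofDual r) t = ∅ := by
      ext x
      simp only [mem_iInter, mem_Ioo, mem_empty_iff_false, iff_false, not_forall]
      by_contra! hx
      have hx0 := (hx (OrderDual.toDual 0) ht').2
      exact lt_irrefl x (hx (OrderDual.toDual x) hx0).1
    rw [he, measure_empty] at this
    exact this
  have h2 : Tendsto (fun s => C * μ.real (Ioo s t)) (𝓝[<] t) (𝓝 0) := by
    simpa [Measure.real] using
      ((ENNReal.tendsto_toReal ENNReal.zero_ne_top).comp h1).const_mul C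
  rw [tendsto_iff_norm_sub_tendsto_zero]
  refine squeeze_zero' (Eventually.of_forall fun _ => norm_nonneg _) ?_ h2
  filter_upwards [self_mem_nhdsWithin] with s hs
  exact h s hs

theorem tendsto_leftLim_stieltjesIntegral [CompleteSpace G] (hη : IsLocBddMeasurable η)
    (hQ : HasFiniteVariation Q) (hc : IsCadlag Q) (t : ℝ≥0) :
    Tendsto (stieltjesIntegral η Q hQ) (𝓝[<] t)
      (𝓝 (stieltjesIntegral η Q hQ t - η t (jump Q t))) := by
  obtain ⟨C, hC, h⟩ := hη.bounded t
  refine tendsto_nhdsLT_of_norm_sub_le (μ := (stieltjesMeasure Q hQ t).variation) (C := C)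
    fun s hs => ?_
  have h1 := stieltjesIntegral_sub hη hQ hc hs.le le_rfl
  have h2 : Ioc s t = Ioo s t ∪ {t} := (Ioo_union_right hs).symm
  rw [h2, VectorMeasure.setIntegral_union (by simp) measurableSet_Ioo (measurableSet_singleton t)
      (hη.integrableOn hQ (T := t) (fun _ hs => hs.2.le) measurableSet_Ioo t)
      (hη.integrableOn hQ (T := t) (by simp) (measurableSet_singleton t) t),
    VectorMeasure.integral_singleton, stieltjesMeasure_singleton hQ hc le_rfl] at h1
  have h3 : stieltjesIntegral η Q hQ s - (stieltjesIntegral η Q hQ t - η t (jump Q t))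
      = -((stieltjesMeasure Q hQ t).restrict (Ioo s t)).integral η
        (ContinuousLinearMap.id ℝ (E →L[ℝ] G)) := by
    rw [sub_eq_iff_eq_add] at h1
    rw [h1]
    simp only [ContinuousLinearMap.id_apply]
    abel
  rw [h3, norm_neg]
  exact norm_setIntegral_le hQ hC fun u hu => h u hu.2.le

theorem isCadlag_stieltjesIntegral [CompleteSpace G] (hη : IsLocBddMeasurable η)
    (hQ : HasFiniteVariation Q) (hc : IsCadlag Q) : IsCadlag (stieltjesIntegral η Q hQ) := by
  refine ⟨fun t => ?_, fun t _ => ⟨_, tendsto_leftLim_stieltjesIntegral hη hQ hc t⟩⟩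
  obtain ⟨C, hC, h⟩ := hη.bounded (t + 1)
  refine continuousWithinAt_of_norm_sub_le (μ := (stieltjesMeasure Q hQ (t + 1)).variation)
    (C := C) (lt_add_one t) fun s hs hs' => ?_
  rw [stieltjesIntegral_sub hη hQ hc hs hs']
  exact norm_setIntegral_le hQ hC fun u hu => h u (hu.2.trans hs')

theorem jump_stieltjesIntegral [CompleteSpace G] (hη : IsLocBddMeasurable η)
    (hQ : HasFiniteVariation Q) (hc : IsCadlag Q) (t : ℝ≥0) :
    jump (stieltjesIntegral η Q hQ) t = η t (jump Q t) := by
  rcases eq_or_ne t 0 with rfl | ht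
  · rw [jump_zero, jump_zero, map_zero]
  · rw [jump, leftLim_eq_of_tendsto_pos (pos_iff_ne_zero.2 ht)
      (tendsto_leftLim_stieltjesIntegral hη hQ hc t)]
    abel

theorem hasFiniteVariation_stieltjesIntegral (hη : IsLocBddMeasurable η)
    (hQ : HasFiniteVariation Q) (hc : IsCadlag Q) :
    HasFiniteVariation (stieltjesIntegral η Q hQ) := by
  intro a b _ _
  obtain ⟨C, hC, h⟩ := hη.bounded b
  set μ := (stieltjesMeasure Q hQ b).variation
  set M : ℝ≥0 → ℝ := fun t => C * μ.real (Ioc 0 t) with hM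
  have hMmono : Monotone M := fun s t hst =>
    mul_le_mul_of_nonneg_left (measureReal_mono (Ioc_subset_Ioc_right hst)) hC
  have hle : ∀ s t, s ≤ t → t ≤ b →
      edist (stieltjesIntegral η Q hQ t) (stieltjesIntegral η Q hQ s) ≤ edist (M t) (M s) := by
    intro s t hst htb
    rw [edist_dist, edist_dist, dist_eq_norm, stieltjesIntegral_sub hη hQ hc hst htb]
    refine ENNReal.ofReal_le_ofReal ((norm_setIntegral_le hQ hC
      fun u hu => h u (hu.2.trans htb)).trans ?_)
    rw [Real.dist_eq]
    refine le_trans (le_of_eq ?_) (le_abs_self _)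
    change C * μ.real (Ioc s t) = C * μ.real (Ioc 0 t) - C * μ.real (Ioc 0 s)
    rw [← Ioc_union_Ioc_eq_Ioc zero_le hst, measureReal_union (Ioc_disjoint_Ioc_of_le le_rfl)
      measurableSet_Ioc]
    ring
  refine ne_top_of_le_ne_top ?_ (iSup_mono fun p => Finset.sum_le_sum fun i _ =>
    hle _ _ (p.2.2.1 i.le_succ) (p.2.2.2 (i + 1)).2.2)
  exact hMmono.monotoneOn _ |>.locallyBoundedVariationOn a b (mem_univ _) (mem_univ _)

/-- Freezing the integrand on `]a, b]` changes the integral by at most the integral of the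
change. -/
theorem norm_apply_sub_stieltjesIntegral_le [CompleteSpace G] (hη : IsLocBddMeasurable η)
    (hQ : HasFiniteVariation Q) (hc : IsCadlag Q) {a b T : ℝ≥0} (hab : a ≤ b) (hbT : b ≤ T)
    (c : E →L[ℝ] G) :
    ‖c (Q b - Q a) - (stieltjesIntegral η Q hQ b - stieltjesIntegral η Q hQ a)‖
      ≤ ∫ u in Ioc a b, ‖c - η u‖ ∂(stieltjesMeasure Q hQ T).variation := by
  have hi := hη.integrableOn hQ (T := T) (S := Ioc a b) (fun _ hs => hs.2.trans hbT)
    measurableSet_Ioc T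
  have hcst : (stieltjesMeasure Q hQ T).IntegrableOn (fun _ => c) (Ioc a b) := by
    rw [VectorMeasure.IntegrableOn, VectorMeasure.Integrable,
      VectorMeasure.variation_restrict measurableSet_Ioc]
    exact integrable_const c
  have h1 := VectorMeasure.setIntegral_const (μ := stieltjesMeasure Q hQ T) (s := Ioc a b)
    (B := ContinuousLinearMap.id ℝ (E →L[ℝ] G)) c
  rw [stieltjesMeasure_Ioc hQ hc hab hbT, ContinuousLinearMap.id_apply] at h1
  rw [stieltjesIntegral_sub hη hQ hc hab hbT, ← h1, ← VectorMeasure.integral_fun_sub hcst hi]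
  refine VectorMeasure.norm_integral_le_integral_norm.trans ?_
  rw [VectorMeasure.variation_restrict measurableSet_Ioc]
  refine (mul_le_of_le_one_left (integral_nonneg fun _ => norm_nonneg _)
    ContinuousLinearMap.norm_id_le)

end Stieltjes

/-! ### The defect of the quadratic variation -/

section QuadraticVariation

variable {E : Type*} [NormedAddCommGroup E] [NormedSpace ℝ E]
  {H : Type*} [NormedAddCommGroup H] [NormedSpace ℝ H]
  {m : Mode} {B : E →L[ℝ] E →L[ℝ] H} {π : ℕ → HalfLinePartition} {X : ℝ≥0 → E} {Q : ℝ≥0 → H}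

theorem tendsto_apply_apply (B : E →L[ℝ] E →L[ℝ] H) {ι : Type*} {l : Filter ι} {g : ι → E} {x : E}
    (h : Tendsto g l (𝓝 x)) : Tendsto (fun n => B (g n) (g n)) l (𝓝 (B x x)) :=
  ((B.continuous₂.comp (continuous_id.prodMk continuous_id)).tendsto x).comp h

/-- The defect `B(δX, δX) - δQ` of the quadratic variation `Q` on the `i`-th interval of the
partition, all paths being stopped at `t`. -/
noncomputable def defect (B : E →L[ℝ] E →L[ℝ] H) (π : HalfLinePartition) (X : ℝ≥0 → E)
    (Q : ℝ≥0 → H) (t : ℝ≥0) (i : ℕ) : H :=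
  B (incr π X t i) (incr π X t i) - incr π Q t i

theorem defect_of_le {π : HalfLinePartition} {t : ℝ≥0} {i : ℕ} (h : t ≤ π.pts i) :
    defect B π X Q t i = 0 := by
  rw [defect, incr_of_le h, incr_of_le h, map_zero, sub_zero]

theorem defect_of_ge {π : HalfLinePartition} {s t : ℝ≥0} {i : ℕ} (hs : π.pts (i + 1) ≤ s)
    (ht : π.pts (i + 1) ≤ t) : defect B π X Q s i = defect B π X Q t i := by
  simp only [defect, incr_of_ge hs, incr_of_ge ht]

theorem IsQuadraticCovariation.converges_defect (hQ : IsQuadraticCovariation m B π X X Q)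
    (t : ℝ≥0) : m.Converges (fun n => ∑ᶠ i, defect B (π n) X Q t i) 0 := by
  have hQ0 : Q 0 = 0 := by
    have h := hQ.converges 0
    have h0 : ∀ n, ∑ᶠ i, B (incr (π n) X 0 i) (incr (π n) X 0 i) = 0 := fun n => by
      refine finsum_eq_zero_of_forall_eq_zero fun i => ?_
      rw [incr_of_le zero_le, map_zero]
    simp only [h0] at h
    exact h.eq_of_tendsto (𝒰 := atTop) le_rfl tendsto_const_nhds
  have h := (hQ.converges t).sub (m.converges_of_tendsto (tendsto_const_nhds (x := Q t)))
  rw [sub_self] at h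
  convert h using 2 with n
  obtain ⟨N, hN⟩ := (π n).exists_le_pts t
  rw [finsum_eq_sum_range (fun i hi => defect_of_le hi) hN,
    finsum_eq_sum_range (fun i hi => by rw [incr_of_le hi, map_zero]) hN]
  simp only [defect, Finset.sum_sub_distrib]
  rw [sum_incr_eq hN, hQ0, sub_zero]

/-- Along an ultrafilter, a bounded sequence of times converges, and it eventually stays on one side
of its limit `r₀`. It thus picks out a one-sided limit at `r₀` of every càdlàg path. -/
theorem exists_oneSided_limit {𝒰 : Ultrafilter ℕ} {r : ℕ → ℝ≥0} {t : ℝ≥0} (hr : ∀ n, r n ≤ t) :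
    ∃ r₀, ((∀ᶠ n in 𝒰, r n < r₀) ∧ Tendsto r 𝒰 (𝓝[<] r₀)) ∨
      ((∀ᶠ n in 𝒰, r₀ ≤ r n) ∧ Tendsto r 𝒰 (𝓝[≥] r₀)) := by
  obtain ⟨r₀, -, h⟩ := (isCompact_Icc (a := (0 : ℝ≥0)) (b := t)).ultrafilter_le_nhds (𝒰.map r)
    (by
      rw [le_principal_iff, Ultrafilter.mem_coe, Ultrafilter.mem_map]
      exact Filter.mem_of_superset Filter.univ_mem fun n _ => ⟨zero_le, hr n⟩)
  have hr₀ : Tendsto r 𝒰 (𝓝 r₀) := h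
  refine ⟨r₀, ?_⟩
  rcases 𝒰.em (fun n => r n < r₀) with h1 | h1
  · exact Or.inl ⟨h1, tendsto_nhdsWithin_iff.2 ⟨hr₀, h1⟩⟩
  · simp only [not_lt] at h1
    exact Or.inr ⟨h1, tendsto_nhdsWithin_iff.2 ⟨hr₀, h1⟩⟩

/-- If, along an ultrafilter `𝒰`, the `i n`-th interval of the partition contains `[v, v']` and
`X` converges to `x` at its left endpoint, then `Q v' - Q v` is determined by `X` through the
single interval. -/
theorem IsQuadraticCovariation.sub_eq_of_mem (hQ : IsQuadraticCovariation m B π X X Q)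
    {𝒰 : Ultrafilter ℕ} (h𝒰 : (𝒰 : Filter ℕ) ≤ atTop) {i : ℕ → ℕ} {x : E}
    (hx : Tendsto (fun n => X ((π n).pts (i n))) 𝒰 (𝓝 x)) {v v' : ℝ≥0} (hvv : v ≤ v')
    (hv : ∀ᶠ n in 𝒰, (π n).pts (i n) ≤ v) (hv' : ∀ᶠ n in 𝒰, v' ≤ (π n).pts (i n + 1)) :
    Q v' - Q v = B (X v' - x) (X v' - x) - B (X v - x) (X v - x) := by
  have h := (hQ.converges v').sub (hQ.converges v)
  refine h.eq_of_tendsto h𝒰 ?_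
  have hlim : ∀ u, Tendsto (fun n => B (X u - X ((π n).pts (i n))) (X u - X ((π n).pts (i n)))) 𝒰
      (𝓝 (B (X u - x) (X u - x))) := fun u =>
    tendsto_apply_apply B (hx.const_sub (X u))
  refine ((hlim v').sub (hlim v)).congr' ?_
  filter_upwards [hv, hv'] with n hn hn'
  obtain ⟨N, hN⟩ := (π n).exists_le_pts v'
  have hz : ∀ u, ∀ j, u ≤ (π n).pts j → B (incr (π n) X u j) (incr (π n) X u j) = 0 :=
    fun u j hj => by rw [incr_of_le hj, map_zero]
  set N' := max N (i n + 1)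
  have hN' : v' ≤ (π n).pts N' := hN.trans ((π n).mono (le_max_left _ _))
  rw [finsum_eq_sum_range (hz v') hN', finsum_eq_sum_range (hz v) (hvv.trans hN'),
    ← Finset.sum_sub_distrib, Finset.sum_eq_single (i n)]
  · simp only [incr]
    rw [min_eq_right hn', min_eq_right (hvv.trans hn'), min_eq_left hn, min_eq_left (hn.trans hvv)]
  · intro j _ hj
    rcases lt_or_gt_of_ne hj with h | h
    · have h1 : (π n).pts (j + 1) ≤ v := ((π n).mono h).trans hn
      rw [incr_of_ge h1, incr_of_ge (h1.trans hvv), sub_self]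
    · have h1 : v' ≤ (π n).pts j := hn'.trans ((π n).mono h)
      rw [hz v' j h1, hz v j (hvv.trans h1), sub_self]
  · intro h
    exact absurd (Finset.mem_range.2 ((lt_add_one _).trans_le (le_max_right N (i n + 1)))) h

/-- The defect of the quadratic variation tends to zero in norm, uniformly over the intervals of
the partition, even when the quadratic variation is only a weak limit. Along an ultrafilter the
endpoints of the intervals converge, to points `r₀ ≤ s₀`. If `r₀ = s₀`, the intervals shrink to
a point and the claim is the jump condition; if `r₀ < s₀`, then the interval `]r₀, s₀[` is
eventually not subdivided and `Q` is explicitly given by `X` there. -/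
theorem IsQuadraticCovariation.eventually_norm_defect_le
    (hQ : IsQuadraticCovariation m B π X X Q) (hX : IsCadlag X) (t : ℝ≥0) {ε : ℝ} (hε : 0 < ε) :
    ∀ᶠ n in atTop, ∀ i, ‖defect B (π n) X Q t i‖ ≤ ε := by
  by_contra hcon
  have hcon' : ∃ᶠ n in atTop, ∃ i, ε < ‖defect B (π n) X Q t i‖ := by
    simpa only [Filter.not_eventually, not_forall, not_le] using hcon
  obtain ⟨i, hi⟩ : ∃ i : ℕ → ℕ, ∃ᶠ n in atTop, ε < ‖defect B (π n) X Q t (i n)‖ := by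
    classical
    refine ⟨fun n => if h : ∃ i, ε < ‖defect B (π n) X Q t i‖ then h.choose else 0,
      hcon'.mono fun n hn => ?_⟩
    simp only [dif_pos hn]
    exact hn.choose_spec
  obtain ⟨𝒰, h𝒰, hU⟩ : ∃ 𝒰 : Ultrafilter ℕ, (𝒰 : Filter ℕ) ≤ atTop ∧
      ∀ᶠ n in 𝒰, ε < ‖defect B (π n) X Q t (i n)‖ := by
    have : (atTop ⊓ 𝓟 {n | ε < ‖defect B (π n) X Q t (i n)‖}).NeBot :=
      Filter.frequently_mem_iff_neBot.1 hi
    obtain ⟨𝒰, h⟩ := Ultrafilter.exists_le (atTop ⊓ 𝓟 {n | ε < ‖defect B (π n) X Q t (i n)‖})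
    exact ⟨𝒰, h.trans inf_le_left, le_principal_iff.1 (h.trans inf_le_right)⟩
  have hQc := hQ.isCadlag
  -- The interval starts before `t`, since its defect does not vanish.
  have hlt : ∀ᶠ n in 𝒰, (π n).pts (i n) < t := by
    filter_upwards [hU] with n hn
    by_contra! h
    rw [defect_of_le h, norm_zero] at hn
    exact absurd hn hε.not_gt
  set r : ℕ → ℝ≥0 := fun n => min ((π n).pts (i n)) t with hr
  set s : ℕ → ℝ≥0 := fun n => min ((π n).pts (i n + 1)) t with hs
  have hrs : ∀ n, r n ≤ s n := fun n => min_le_min_right t ((π n).mono (i n).le_succ)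
  have hr_eq : ∀ᶠ n in 𝒰, r n = (π n).pts (i n) := hlt.mono fun n hn => min_eq_left hn.le
  obtain ⟨r₀, hr₀⟩ := exists_oneSided_limit (𝒰 := 𝒰) (r := r) fun n => min_le_right _ t
  obtain ⟨s₀, hs₀⟩ := exists_oneSided_limit (𝒰 := 𝒰) (r := s) fun n => min_le_right _ t
  have hrt : Tendsto r 𝒰 (𝓝 r₀) := hr₀.elim (fun h => tendsto_nhds_of_tendsto_nhdsWithin h.2)
    fun h => tendsto_nhds_of_tendsto_nhdsWithin h.2
  have hst : Tendsto s 𝒰 (𝓝 s₀) := hs₀.elim (fun h => tendsto_nhds_of_tendsto_nhdsWithin h.2)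
    fun h => tendsto_nhds_of_tendsto_nhdsWithin h.2
  have hle : r₀ ≤ s₀ := le_of_tendsto_of_tendsto' hrt hst hrs
  -- It suffices to identify the limits of `X` and `Q` at the endpoints.
  suffices hlim : ∃ xr xs qr qs, Tendsto (fun n => X (r n)) 𝒰 (𝓝 xr) ∧
      Tendsto (fun n => X (s n)) 𝒰 (𝓝 xs) ∧ Tendsto (fun n => Q (r n)) 𝒰 (𝓝 qr) ∧
      Tendsto (fun n => Q (s n)) 𝒰 (𝓝 qs) ∧ B (xs - xr) (xs - xr) = qs - qr by
    obtain ⟨xr, xs, qr, qs, h1, h2, h3, h4, h5⟩ := hlim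
    have h6 : Tendsto (fun n => defect B (π n) X Q t (i n)) 𝒰
        (𝓝 (B (xs - xr) (xs - xr) - (qs - qr))) :=
      (tendsto_apply_apply B (h2.sub h1)).sub (h4.sub h3)
    rw [h5, sub_self] at h6
    have h7 := h6.norm
    rw [norm_zero] at h7
    obtain ⟨n, hn, hn'⟩ := (hU.and (h7.eventually_lt_const hε)).exists
    exact absurd hn hn'.not_gt
  have hjump : Q r₀ - Function.leftLim Q r₀
      = B (X r₀ - Function.leftLim X r₀) (X r₀ - Function.leftLim X r₀) := hQ.jump_eq r₀
  rcases hle.eq_or_lt with heq | hlt₀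
  · -- The intervals shrink to a point.
    rw [← heq] at hs₀
    rcases hr₀ with ⟨hr1, hr2⟩ | ⟨hr1, hr2⟩ <;> rcases hs₀ with ⟨hs1, hs2⟩ | ⟨hs1, hs2⟩
    · exact ⟨_, _, _, _, (hX.tendsto_leftLim r₀).comp hr2, (hX.tendsto_leftLim r₀).comp hs2,
        (hQc.tendsto_leftLim r₀).comp hr2, (hQc.tendsto_leftLim r₀).comp hs2, by simp⟩
    · exact ⟨_, _, _, _, (hX.tendsto_leftLim r₀).comp hr2, (hX.tendsto_right r₀).comp hs2,
        (hQc.tendsto_leftLim r₀).comp hr2, (hQc.tendsto_right r₀).comp hs2, hjump.symm⟩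
    · obtain ⟨n, hn, hn'⟩ := (hr1.and hs1).exists
      exact absurd (hn.trans (hrs n)) hn'.not_ge
    · exact ⟨_, _, _, _, (hX.tendsto_right r₀).comp hr2, (hX.tendsto_right r₀).comp hs2,
        (hQc.tendsto_right r₀).comp hr2, (hQc.tendsto_right r₀).comp hs2, by simp⟩
  -- The limit interval is nondegenerate: `Q - B(X - xr, X - xr)` is constant inside it.
  obtain ⟨w, hrw, hws⟩ := exists_between hlt₀
  have hs_le : ∀ n, s n ≤ (π n).pts (i n + 1) := fun n => min_le_left _ _
  obtain ⟨xr, qr, hxr, hqr, hleft⟩ : ∃ xr qr, Tendsto (fun n => X (r n)) 𝒰 (𝓝 xr) ∧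
      Tendsto (fun n => Q (r n)) 𝒰 (𝓝 qr) ∧ Q w - B (X w - xr) (X w - xr) = qr := by
    have hbefore : ∀ v, r₀ < v → ∀ᶠ n in 𝒰, (π n).pts (i n) ≤ v := fun v hv => by
      filter_upwards [hr_eq, hrt.eventually_lt_const hv] with n h1 h2
      exact h1 ▸ h2.le
    have hafter : ∀ᶠ n in 𝒰, w ≤ (π n).pts (i n + 1) := by
      filter_upwards [hst.eventually_const_lt hws] with n h1
      exact h1.le.trans (hs_le n)
    rcases hr₀ with ⟨hr1, hr2⟩ | ⟨hr1, hr2⟩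
    · have hx := (hX.tendsto_leftLim r₀).comp hr2
      refine ⟨_, _, hx, (hQc.tendsto_leftLim r₀).comp hr2, ?_⟩
      have hx' : Tendsto (fun n => X ((π n).pts (i n))) 𝒰 (𝓝 (Function.leftLim X r₀)) :=
        hx.congr' (hr_eq.mono fun n hn => by simp [hn])
      have := hQ.sub_eq_of_mem h𝒰 hx' hrw.le (by
        filter_upwards [hr_eq, hr1] with n h1 h2
        exact h1 ▸ h2.le) hafter
      rw [← hjump, sub_eq_iff_eq_add] at this
      rw [this]
      abel
    · have hx := (hX.tendsto_right r₀).comp hr2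
      refine ⟨_, _, hx, (hQc.tendsto_right r₀).comp hr2, ?_⟩
      have hx' : Tendsto (fun n => X ((π n).pts (i n))) 𝒰 (𝓝 (X r₀)) :=
        hx.congr' (hr_eq.mono fun n hn => by simp [hn])
      have hX' : Tendsto (fun v => X v - X r₀) (𝓝[>] r₀) (𝓝 0) := by
        have := ((hX.tendsto_right r₀).mono_left (nhdsWithin_mono r₀ Ioi_subset_Ici_self)).sub_const
          (X r₀)
        rwa [sub_self] at this
      have hg : Tendsto (fun v => Q v - B (X v - X r₀) (X v - X r₀)) (𝓝[>] r₀) (𝓝 (Q r₀)) := by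
        have := ((hQc.tendsto_right r₀).mono_left (nhdsWithin_mono r₀ Ioi_subset_Ici_self)).sub
          (tendsto_apply_apply B hX')
        simpa using this
      refine tendsto_nhds_unique (tendsto_const_nhds.congr' ?_) hg
      filter_upwards [Ioc_mem_nhdsGT hrw] with v hv
      have := hQ.sub_eq_of_mem h𝒰 hx' hv.2 (hbefore v hv.1) hafter
      rw [sub_eq_iff_eq_add] at this
      rw [this]
      abel
  have hx' : Tendsto (fun n => X ((π n).pts (i n))) 𝒰 (𝓝 xr) :=
    hxr.congr' (hr_eq.mono fun n hn => by simp [hn])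
  have hbefore : ∀ᶠ n in 𝒰, (π n).pts (i n) ≤ w := by
    filter_upwards [hr_eq, hrt.eventually_lt_const hrw] with n h1 h2
    exact h1 ▸ h2.le
  obtain ⟨xs, qs, hxs, hqs, hright⟩ : ∃ xs qs, Tendsto (fun n => X (s n)) 𝒰 (𝓝 xs) ∧
      Tendsto (fun n => Q (s n)) 𝒰 (𝓝 qs) ∧
      Q w - B (X w - xr) (X w - xr) = qs - B (xs - xr) (xs - xr) := by
    rcases hs₀ with ⟨hs1, hs2⟩ | ⟨hs1, hs2⟩
    · refine ⟨_, _, (hX.tendsto_leftLim s₀).comp hs2, (hQc.tendsto_leftLim s₀).comp hs2, ?_⟩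
      have hX' := (hX.tendsto_leftLim s₀).sub_const xr
      have hg := (hQc.tendsto_leftLim s₀).sub (tendsto_apply_apply B hX')
      have := nhdsLT_neBot (zero_le.trans_lt hws)
      refine tendsto_nhds_unique (tendsto_const_nhds.congr' ?_) hg
      filter_upwards [Ico_mem_nhdsLT hws] with v hv
      have := hQ.sub_eq_of_mem h𝒰 hx' hv.1 hbefore (by
        filter_upwards [hst.eventually_const_lt hv.2] with n h1
        exact h1.le.trans (hs_le n))
      rw [sub_eq_iff_eq_add] at this
      rw [this]
      abel
    · refine ⟨_, _, (hX.tendsto_right s₀).comp hs2, (hQc.tendsto_right s₀).comp hs2, ?_⟩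
      have := hQ.sub_eq_of_mem h𝒰 hx' hws.le hbefore (by
        filter_upwards [hs1] with n h1
        exact h1.trans (hs_le n))
      rw [sub_eq_iff_eq_add] at this
      rw [this]
      abel
  refine ⟨xr, xs, qr, qs, hxr, hxs, hqr, hqs, ?_⟩
  rw [← hleft, hright]
  abel

end QuadraticVariation

/-! ### Riemann sums against the defect -/

section QuadraticVariation

variable {E : Type*} [NormedAddCommGroup E] [NormedSpace ℝ E]
  {H : Type*} [NormedAddCommGroup H] [NormedSpace ℝ H]
  {G : Type*} [NormedAddCommGroup G] [NormedSpace ℝ G]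
  {m : Mode} {B : E →L[ℝ] E →L[ℝ] H} {π : ℕ → HalfLinePartition} {X : ℝ≥0 → E} {Q : ℝ≥0 → H}

/-- Bound for one term when a step `[b, c[` is added to the subdivision: up to the intervals
containing `b` or `c`, only intervals inside `[b, c]` contribute, and there `ξ` is close
to `ξ b`. -/
theorem norm_apply_defect_sub_le {π : HalfLinePartition} {ξ : ℝ≥0 → H →L[ℝ] G} {ε δ M : ℝ}
    {b c t : ℝ≥0} (hstep : OscStep ξ ε b c) (hct : c ≤ t) (hM : 0 ≤ M) (hδ : 0 ≤ δ) (hε : 0 ≤ ε)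
    (hξ : ∀ s ≤ t, ‖ξ s‖ ≤ M) (hb : ∀ i, ‖defect B π X Q b i‖ ≤ δ)
    (hc : ∀ i, ‖defect B π X Q c i‖ ≤ δ) (i : ℕ) :
    ‖(ξ (π.pts i) - ξ b) (defect B π X Q c i - defect B π X Q b i)‖
      ≤ ε * ((if π.pts (i + 1) ≤ c then ‖defect B π X Q t i‖ else 0)
          - (if π.pts (i + 1) ≤ b then ‖defect B π X Q t i‖ else 0))
        + ((if i = π.index b then 4 * M * δ else 0)
          + (if i = π.index c then 4 * M * δ else 0)) := by
  have hbc := hstep.1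
  have hind : ∀ j : ℕ, (0 : ℝ) ≤ if i = j then 4 * M * δ else 0 := fun j => by
    split_ifs <;> positivity
  have hbound : π.pts i < c →
      ‖(ξ (π.pts i) - ξ b) (defect B π X Q c i - defect B π X Q b i)‖ ≤ 4 * M * δ := fun h => by
    refine (ContinuousLinearMap.le_opNorm _ _).trans ?_
    calc _ ≤ (M + M) * (δ + δ) := by
          gcongr
          · exact (norm_sub_le _ _).trans
              (add_le_add (hξ _ (h.le.trans hct)) (hξ _ (hbc.trans hct)))
          · exact (norm_sub_le _ _).trans (add_le_add (hc i) (hb i))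
      _ = 4 * M * δ := by ring
  have h1 := hind (π.index b)
  have h2 := hind (π.index c)
  rcases le_or_gt (π.pts (i + 1)) b with hi | hi
  · rw [defect_of_ge (hi.trans hbc) hi, sub_self, map_zero, norm_zero, if_pos hi,
      if_pos (hi.trans hbc), sub_self, mul_zero, zero_add]
    exact add_nonneg h1 h2
  rw [if_neg hi.not_ge, sub_zero]
  rcases le_or_gt c (π.pts i) with hi' | hi'
  · rw [defect_of_le hi', defect_of_le (hbc.trans hi'), sub_self, map_zero, norm_zero,
      if_neg ((hi'.trans_lt (π.lt_succ i)).not_ge), mul_zero, zero_add]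
    exact add_nonneg h1 h2
  have hnn : 0 ≤ ε * (if π.pts (i + 1) ≤ c then ‖defect B π X Q t i‖ else 0) := by
    split_ifs <;> positivity
  rcases lt_or_ge (π.pts i) b with hib | hib
  · rw [if_pos (π.index_eq ⟨hib, hi.le⟩).symm]
    linarith [hbound hi']
  rcases le_or_gt (π.pts (i + 1)) c with hic | hic
  · rw [if_pos hic, defect_of_le hib, sub_zero, defect_of_ge hic (hic.trans hct)]
    have h3 := hstep.2 (π.pts i) ⟨hib, hi'⟩ b ⟨le_rfl, hib.trans_lt hi'⟩
    have h4 := (ξ (π.pts i) - ξ b).le_of_opNorm_le h3 (defect B π X Q t i)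
    linarith
  · rw [if_pos (π.index_eq ⟨hi', hic.le⟩).symm]
    linarith [hbound hi']

/-- Left-point sums of a càdlàg integrand against the defect of the quadratic variation tend to
zero. The integrand is almost constant on the steps of a finite subdivision; on each of them, the
sum of the defects tends to zero, and the intervals which overlap two steps are negligible because
single defects are uniformly small. -/
theorem IsQuadraticCovariation.converges_sum_apply_defect
    (hQ : IsQuadraticCovariation m B π X X Q) (hX : IsCadlag X) {t : ℝ≥0} {C : ℝ}
    (hC : ∀ n N, ∑ i ∈ Finset.range N, ‖defect B (π n) X Q t i‖ ≤ C)
    {ξ : ℝ≥0 → H →L[ℝ] G} (hξ : IsCadlag ξ) :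
    m.Converges (fun n => ∑ᶠ i, ξ ((π n).pts i) (defect B (π n) X Q t i)) 0 := by
  have hC0 : 0 ≤ C := by simpa using hC 0 0
  obtain ⟨M, hM, hξM, -⟩ := hξ.exists_norm_le t
  choose N hN using fun n => (π n).exists_le_pts t
  set S : ℕ → ℝ≥0 → G := fun n b =>
    ∑ i ∈ Finset.range (N n), ξ ((π n).pts i) (defect B (π n) X Q b i) with hS
  set w : ℕ → ℝ≥0 → ℝ := fun n b =>
    ∑ i ∈ Finset.range (N n), if (π n).pts (i + 1) ≤ b then ‖defect B (π n) X Q t i‖ else 0 with hw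
  have hwC : ∀ n b, w n b ≤ C := fun n b => by
    refine (Finset.sum_le_sum fun i _ => ?_).trans (hC n (N n))
    split_ifs
    · exact le_rfl
    · exact norm_nonneg _
  have hw0 : ∀ n b, 0 ≤ w n b := fun n b => Finset.sum_nonneg fun i _ => by
    split_ifs
    · exact norm_nonneg _
    · exact le_rfl
  have key : ∀ ε > 0, ∀ b, Relation.ReflTransGen (OscStep ξ ε) 0 b → b ≤ t →
      ∃ U : ℕ → G, m.Converges U 0 ∧
        ∀ δ > 0, ∀ᶠ n in atTop, ‖S n b - U n‖ ≤ ε * w n b + δ := by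
    intro ε hε b hb
    induction hb with
    | refl =>
      refine fun _ => ⟨fun _ => 0, m.converges_of_tendsto tendsto_const_nhds, fun δ hδ =>
        Eventually.of_forall fun n => ?_⟩
      have : S n 0 = 0 := Finset.sum_eq_zero fun i _ => by rw [defect_of_le zero_le, map_zero]
      rw [this, sub_zero, norm_zero]
      have := hw0 n 0
      positivity
    | @tail b c _ hbc ih =>
      intro hct
      have hbt := hbc.1.trans hct
      obtain ⟨U, hU, hSU⟩ := ih hbt
      have hT : ∀ d ≤ t, m.Converges
          (fun n => ∑ i ∈ Finset.range (N n), defect B (π n) X Q d i) 0 := fun d hd => by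
        convert hQ.converges_defect d using 2 with n
        exact (finsum_eq_sum_range (fun i hi => defect_of_le hi) (hd.trans (hN n))).symm
      refine ⟨fun n => U n + ξ b (∑ i ∈ Finset.range (N n), defect B (π n) X Q c i
        - ∑ i ∈ Finset.range (N n), defect B (π n) X Q b i), ?_, fun δ hδ => ?_⟩
      · simpa using hU.add (((hT c hct).sub (hT b hbt)).map (ξ b))
      -- Each of the two exceptional intervals contributes at most `δ / 4`.
      set δ' := δ / (16 * (M + 1)) with hδ'
      have hδ'pos : 0 < δ' := by positivity
      filter_upwards [hSU (δ / 2) (half_pos hδ), hQ.eventually_norm_defect_le hX b hδ'pos,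
        hQ.eventually_norm_defect_le hX c hδ'pos] with n h1 h2 h3
      have hdiff : S n c - (U n + ξ b (∑ i ∈ Finset.range (N n), defect B (π n) X Q c i
          - ∑ i ∈ Finset.range (N n), defect B (π n) X Q b i))
          = (S n b - U n) + ∑ i ∈ Finset.range (N n), (ξ ((π n).pts i) - ξ b)
            (defect B (π n) X Q c i - defect B (π n) X Q b i) := by
        simp only [hS, map_sub, map_sum, sub_apply, Finset.sum_sub_distrib]
        abel
      have hsum : ‖∑ i ∈ Finset.range (N n), (ξ ((π n).pts i) - ξ b)
            (defect B (π n) X Q c i - defect B (π n) X Q b i)‖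
          ≤ ε * (w n c - w n b) + (4 * M * δ' + 4 * M * δ') := by
        refine (norm_sum_le _ _).trans ((Finset.sum_le_sum fun i _ =>
          norm_apply_defect_sub_le hbc hct hM hδ'pos.le hε.le hξM h2 h3 i).trans ?_)
        rw [Finset.sum_add_distrib, ← Finset.mul_sum, Finset.sum_sub_distrib,
          Finset.sum_add_distrib]
        have hone : ∀ j : ℕ, ∑ i ∈ Finset.range (N n), (if i = j then 4 * M * δ' else 0)
            ≤ 4 * M * δ' := fun j => by
          rw [Finset.sum_ite_eq']
          split_ifs
          · exact le_rfl
          · positivity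
        linarith [hone ((π n).index b), hone ((π n).index c)]
      have hMδ : 4 * M * δ' ≤ δ / 4 := by
        rw [hδ', mul_div_assoc', div_le_div_iff₀ (by positivity) (by norm_num)]
        nlinarith
      rw [hdiff]
      refine (norm_add_le _ _).trans ?_
      linarith
  refine Mode.converges_of_approx fun ε hε => ?_
  have hε' : 0 < ε / (2 * (C + 1)) := by positivity
  obtain ⟨U, hU, hSU⟩ := key _ hε' t (hξ.reflTransGen_oscStep hε' t) le_rfl
  refine ⟨U, hU, ?_⟩
  filter_upwards [hSU (ε / 2) (half_pos hε)] with n hn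
  rw [finsum_eq_sum_range (fun i hi => by rw [defect_of_le hi, map_zero]) (hN n)]
  refine hn.trans ?_
  have : ε / (2 * (C + 1)) * w n t ≤ ε / 2 := by
    calc ε / (2 * (C + 1)) * w n t ≤ ε / (2 * (C + 1)) * (C + 1) := by
          gcongr
          linarith [hwC n t]
      _ = ε / 2 := by field_simp
  linarith

end QuadraticVariation

/-! ### Absolutely small errors -/

section SumNorm

variable {G : Type*} [NormedAddCommGroup G] {g h : ℕ → ℕ → G}

/-- The total norm `∑ i, ‖g n i‖` tends to zero as `n → ∞`. -/
def SumNormTendstoZero (g : ℕ → ℕ → G) : Prop :=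
  ∀ ε > 0, ∀ᶠ n in atTop, ∀ N, ∑ i ∈ Finset.range N, ‖g n i‖ ≤ ε

theorem SumNormTendstoZero.of_norm_le {G' : Type*} [NormedAddCommGroup G'] {k : ℕ → ℕ → G'}
    (hg : SumNormTendstoZero g) (h : ∀ n i, ‖k n i‖ ≤ ‖g n i‖) : SumNormTendstoZero k :=
  fun ε hε => (hg ε hε).mono fun n hn N => (Finset.sum_le_sum fun i _ => h n i).trans (hn N)

theorem SumNormTendstoZero.add (hg : SumNormTendstoZero g) (hh : SumNormTendstoZero h) :
    SumNormTendstoZero fun n i => g n i + h n i := fun ε hε => by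
  filter_upwards [hg (ε / 2) (half_pos hε), hh (ε / 2) (half_pos hε)] with n h1 h2 N
  refine (Finset.sum_le_sum fun i _ => norm_add_le _ _).trans ?_
  rw [Finset.sum_add_distrib]
  linarith [h1 N, h2 N]

theorem SumNormTendstoZero.const_mul {a : ℕ → ℕ → ℝ} (ha : SumNormTendstoZero a) (C : ℝ) :
    SumNormTendstoZero fun n i => C * a n i := fun ε hε => by
  filter_upwards [ha (ε / (|C| + 1)) (by positivity)] with n hn N
  simp only [norm_mul, ← Finset.mul_sum, Real.norm_eq_abs C]
  calc |C| * ∑ i ∈ Finset.range N, ‖a n i‖ ≤ (|C| + 1) * (ε / (|C| + 1)) := by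
        gcongr
        · linarith
        · exact hn N
    _ = ε := by field_simp

theorem SumNormTendstoZero.tendsto_sum (hg : SumNormTendstoZero g) (N : ℕ → ℕ) :
    Tendsto (fun n => ∑ i ∈ Finset.range (N n), g n i) atTop (𝓝 0) := by
  refine Metric.tendsto_nhds.2 fun ε hε => ?_
  filter_upwards [hg (ε / 2) (half_pos hε)] with n hn
  rw [dist_zero_right]
  linarith [norm_sum_le (Finset.range (N n)) (g n), hn (N n)]

end SumNorm

/-! ### Riemann–Stieltjes sums -/

section StieltjesSums

variable {E : Type*} [NormedAddCommGroup E] [NormedSpace ℝ E] [CompleteSpace E]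
  {G : Type*} [NormedAddCommGroup G] [NormedSpace ℝ G] [CompleteSpace G] {Q : ℝ≥0 → E}

/-- Left-point Riemann sums approximate the Stieltjes integral, with summable errors: the integrand
`ξ` evaluated at the left endpoint of the current interval tends to the left limit of `ξ`, so that
the total error tends to zero by dominated convergence. -/
theorem sumNormTendstoZero_apply_incr_sub {π : ℕ → HalfLinePartition} {ξ : ℝ≥0 → E →L[ℝ] G}
    (hξ : IsCadlag ξ) (hL : ApproximatesFromLeft π ξ) (hQ : HasFiniteVariation Q)
    (hc : IsCadlag Q) (t : ℝ≥0) :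
    SumNormTendstoZero fun n i => ξ ((π n).pts i) (incr (π n) Q t i)
      - incr (π n) (stieltjesIntegral (Function.leftLim ξ) Q hQ) t i := by
  have hη := hξ.isLocBddMeasurable_leftLim hL
  set μ := (stieltjesMeasure Q hQ t).variation with hμ
  obtain ⟨C, hC, hC1, hC2⟩ := hξ.exists_norm_le t
  set g : ℕ → ℝ≥0 → ℝ := fun n u => ‖ξ ((π n).lower u) - Function.leftLim ξ u‖ with hg
  have hgm : ∀ n, StronglyMeasurable (g n) := fun n =>
    (((StronglyMeasurable.of_discrete (f := fun i => ξ ((π n).pts i))).comp_measurable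
      (π n).measurable_index).sub hη.stronglyMeasurable).norm
  have hgC : ∀ n, ∀ u ≤ t, g n u ≤ C + C := fun n u hu =>
    (norm_sub_le _ _).trans (add_le_add (hC1 _ (((π n).lower_le u).trans hu)) (hC2 u hu))
  have hgi : ∀ n, ∀ S ⊆ Iic t, MeasurableSet S → IntegrableOn (g n) S μ := fun n S hS hSm => by
    refine Integrable.of_bound (hgm n).aestronglyMeasurable (C + C)
      ((ae_restrict_iff' hSm).2 (Eventually.of_forall fun u hu => ?_))
    rw [Real.norm_of_nonneg (norm_nonneg _)]
    exact hgC n u (hS hu)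
  have hlim : Tendsto (fun n => ∫ u in Ioc 0 t, g n u ∂μ) atTop (𝓝 0) := by
    have := tendsto_integral_of_dominated_convergence (μ := μ.restrict (Ioc 0 t)) (F := g)
      (f := fun _ => (0 : ℝ)) (fun _ => C + C) (fun n => (hgm n).aestronglyMeasurable)
      (integrable_const _)
      (fun n => (ae_restrict_iff' measurableSet_Ioc).2 (Eventually.of_forall fun u hu => by
        rw [Real.norm_of_nonneg (norm_nonneg _)]
        exact hgC n u hu.2))
      ((ae_restrict_iff' measurableSet_Ioc).2 (Eventually.of_forall fun u hu =>
        tendsto_iff_norm_sub_tendsto_zero.1 (hL u hu.1)))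
    simpa using this
  intro ε hε
  filter_upwards [hlim.eventually_lt_const hε] with n hn N
  set M : ℝ≥0 → ℝ := fun b => ∫ u in Ioc 0 b, g n u ∂μ with hM
  have hterm : ∀ i, ‖ξ ((π n).pts i) (incr (π n) Q t i)
      - incr (π n) (stieltjesIntegral (Function.leftLim ξ) Q hQ) t i‖ ≤ incr (π n) M t i := by
    intro i
    set a := min ((π n).pts i) t with ha
    set b := min ((π n).pts (i + 1)) t with hb
    have hab : a ≤ b := min_le_min_right t ((π n).mono i.le_succ)
    have hbt : b ≤ t := min_le_right _ _
    refine (norm_apply_sub_stieltjesIntegral_le hη hQ hc hab hbt _).trans (le_of_eq ?_)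
    have h1 : ∫ u in Ioc a b, ‖ξ ((π n).pts i) - Function.leftLim ξ u‖ ∂μ
        = ∫ u in Ioc a b, g n u ∂μ := by
      refine setIntegral_congr_fun measurableSet_Ioc fun u hu => ?_
      have hui : u ∈ Ioc ((π n).pts i) ((π n).pts (i + 1)) := by
        refine ⟨?_, hu.2.trans (min_le_left _ _)⟩
        by_contra! h
        exact absurd (le_min h (hu.2.trans hbt)) hu.1.not_ge
      simp only [hg]
      rw [(π n).lower_eq hui]
    rw [h1]
    change _ = M b - M a
    simp only [hM]
    rw [← Ioc_union_Ioc_eq_Ioc zero_le hab, setIntegral_union (Ioc_disjoint_Ioc_of_le le_rfl)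
      measurableSet_Ioc (hgi n _ (fun u hu => hu.2.trans (hab.trans hbt)) measurableSet_Ioc)
      (hgi n _ (fun u hu => hu.2.trans hbt) measurableSet_Ioc)]
    ring
  refine (Finset.sum_le_sum fun i _ => hterm i).trans ?_
  rw [sum_incr]
  have hM0 : M 0 = 0 := by simp [hM]
  rw [hM0, sub_zero]
  refine le_trans ?_ hn.le
  exact setIntegral_mono_set (hgi n _ (fun u hu => hu.2) measurableSet_Ioc)
    (Eventually.of_forall fun u => norm_nonneg _)
    (Ioc_subset_Ioc_right (min_le_right _ _)).eventuallyLE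

end StieltjesSums

/-! ### Sums over jumps -/

section JumpSum

variable {G : Type*} [NormedAddCommGroup G] {p : ℝ≥0 → G}

/-- The path `b ↦ ∑_{0 < u ≤ b} p u`. -/
noncomputable def sumUpTo (p : ℝ≥0 → G) (b : ℝ≥0) : G := ∑' u, (Ioc 0 b).indicator p u

/-- The family `p` is absolutely summable on compact intervals. -/
def LocSummable (p : ℝ≥0 → G) : Prop := ∀ t, Summable ((Ioc 0 t).indicator fun u => ‖p u‖)

theorem LocSummable.of_norm_le {G' : Type*} [NormedAddCommGroup G'] {q : ℝ≥0 → G'}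
    (hp : LocSummable p) (h : ∀ u, ‖q u‖ ≤ ‖p u‖) : LocSummable q := fun t => by
  refine Summable.of_nonneg_of_le (fun u => indicator_nonneg (fun _ _ => norm_nonneg _) u)
    (fun u => indicator_le_indicator (h u)) (hp t)

variable [CompleteSpace G]

theorem LocSummable.summable_indicator (hp : LocSummable p) {t : ℝ≥0} {S : Set ℝ≥0}
    (hS : S ⊆ Ioc 0 t) : Summable (S.indicator p) := by
  refine Summable.of_norm_bounded (hp t) fun u => ?_
  rw [norm_indicator_eq_indicator_norm]
  exact indicator_le_indicator_of_subset hS (fun _ => norm_nonneg _) u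

theorem LocSummable.sumUpTo_sub (hp : LocSummable p) {a b : ℝ≥0} (hab : a ≤ b) :
    sumUpTo p b - sumUpTo p a = ∑' u, (Ioc a b).indicator p u := by
  rw [sumUpTo, sumUpTo, ← (hp.summable_indicator (t := b) le_rfl).tsum_sub
    (hp.summable_indicator (t := a) le_rfl)]
  refine tsum_congr fun u => ?_
  rw [← Ioc_union_Ioc_eq_Ioc zero_le hab, indicator_union_of_disjoint
    (Ioc_disjoint_Ioc_of_le le_rfl)]
  exact add_sub_cancel_left _ _

theorem LocSummable.isCadlag (hp : LocSummable p) : IsCadlag (sumUpTo p) ∧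
    ∀ t, 0 < t → Function.leftLim (sumUpTo p) t = sumUpTo p t - p t := by
  have hbound : ∀ {T : ℝ≥0} {S : Set ℝ≥0}, S ⊆ Ioc 0 T →
      ∀ u, ‖S.indicator p u‖ ≤ (Ioc 0 T).indicator (fun u => ‖p u‖) u := fun hS u => by
    rw [norm_indicator_eq_indicator_norm]
    exact indicator_le_indicator_of_subset hS (fun _ => norm_nonneg _) u
  have hright : ∀ t, ContinuousWithinAt (sumUpTo p) (Ici t) t := fun t => by
    refine tendsto_tsum_of_dominated_convergence (hp (t + 1)) (fun u => ?_) ?_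
    · refine tendsto_const_nhds.congr' ?_
      rcases le_or_gt u t with h | h
      · filter_upwards [self_mem_nhdsWithin] with s hs
        have : u ∈ Ioc 0 t ↔ u ∈ Ioc 0 s := ⟨fun hu => ⟨hu.1, h.trans hs⟩, fun hu => ⟨hu.1, h⟩⟩
        by_cases hu : u ∈ Ioc 0 t
        · rw [indicator_of_mem hu, indicator_of_mem (this.1 hu)]
        · rw [indicator_of_notMem hu, indicator_of_notMem fun h => hu (this.2 h)]
      · filter_upwards [mem_nhdsWithin_of_mem_nhds (Iio_mem_nhds h)] with s hs
        rw [indicator_of_notMem fun hu => hu.2.not_gt h, indicator_of_notMem fun hu =>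
          hu.2.not_gt hs]
    · filter_upwards [mem_nhdsWithin_of_mem_nhds (Iic_mem_nhds (lt_add_one t))] with s hs
      exact hbound (Ioc_subset_Ioc_right hs)
  have hleft : ∀ t, 0 < t → Tendsto (sumUpTo p) (𝓝[<] t) (𝓝 (sumUpTo p t - p t)) := fun t ht => by
    have h1 : sumUpTo p t - p t = ∑' u, (Ioo 0 t).indicator p u := by
      have h2 : ∑' u, ({t} : Set ℝ≥0).indicator p u = p t := by
        have h3 : ∀ u, u ≠ t → ({t} : Set ℝ≥0).indicator p u = 0 := fun u hu =>
          indicator_of_notMem (mem_singleton_iff.not.2 hu) p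
        rw [tsum_eq_single t h3, indicator_of_mem (mem_singleton t)]
      rw [sub_eq_iff_eq_add, ← h2, ← (hp.summable_indicator (t := t)
        Ioo_subset_Ioc_self).tsum_add (hp.summable_indicator (t := t) (by simpa using ht)), sumUpTo]
      refine tsum_congr fun u => ?_
      rw [← Ioo_union_right ht, indicator_union_of_disjoint (by simp)]
    rw [h1]
    refine tendsto_tsum_of_dominated_convergence (hp t) (fun u => ?_) ?_
    · refine tendsto_const_nhds.congr' ?_
      rcases lt_or_ge u t with h | h
      · filter_upwards [Ico_mem_nhdsLT h] with s hs
        have : u ∈ Ioo 0 t ↔ u ∈ Ioc 0 s := ⟨fun hu => ⟨hu.1, hs.1⟩, fun hu => ⟨hu.1, h⟩⟩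
        by_cases hu : u ∈ Ioo 0 t
        · rw [indicator_of_mem hu, indicator_of_mem (this.1 hu)]
        · rw [indicator_of_notMem hu, indicator_of_notMem fun h => hu (this.2 h)]
      · filter_upwards [self_mem_nhdsWithin] with s hs
        rw [indicator_of_notMem fun hu => hu.2.not_ge h, indicator_of_notMem fun hu =>
          (hu.2.trans_lt hs).not_ge h]
    · filter_upwards [self_mem_nhdsWithin] with s hs
      exact hbound (Ioc_subset_Ioc_right (le_of_lt hs))
  exact ⟨⟨hright, fun t ht => ⟨_, hleft t ht⟩⟩,
    fun t ht => leftLim_eq_of_tendsto_pos ht (hleft t ht)⟩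

theorem LocSummable.jump_sumUpTo (hp : LocSummable p) {t : ℝ≥0} (ht : 0 < t) :
    jump (sumUpTo p) t = p t := by
  rw [jump, hp.isCadlag.2 t ht]
  abel

end JumpSum

/-! ### Two-point functions along the intervals of the partition -/

section JumpRemainder

variable {V : Type*} [NormedAddCommGroup V] {G : Type*} [NormedAddCommGroup G]
  {π : ℕ → HalfLinePartition} {Z : ℝ≥0 → V} {ρ : V → V → G} {κ : V → ℝ}

/-- Under Condition (C), the increments of `Z` over the intervals of the partition without big
jumps are eventually small. -/
theorem ConditionC.exists_eventually_norm_incr_le (hC : ConditionC π Z) (hZ : IsCadlag Z)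
    (t : ℝ≥0) {δ : ℝ} (hδ : 0 < δ) : ∃ ε, 0 < ε ∧ ε ≤ δ ∧ ∀ᶠ n in atTop, ∀ i,
      Ioc ((π n).pts i) ((π n).pts (i + 1)) ∩ Iic t ∩ bigJumpTimes Z ε = ∅ →
        ‖incr (π n) Z t i‖ ≤ δ := by
  have h1 : ∀ᶠ ε : ℝ in 𝓝[>] 0,
      limsup (fun n => oscPlus (π n) (Z - bigJumpSum Z ε) t) atTop < ENNReal.ofReal δ := by
    refine eventually_lt_of_limsup_lt ?_
    rw [hC.limsup_osc t]
    exact ENNReal.ofReal_pos.2 hδ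
  obtain ⟨ε, hε, hεpos, hεδ⟩ := (h1.and (Ioc_mem_nhdsGT hδ)).exists
  refine ⟨ε, hεpos, hεδ, ?_⟩
  filter_upwards [eventually_lt_of_limsup_lt hε] with n hn i hi
  rcases le_or_gt t ((π n).pts i) with hti | hti
  · rw [incr_of_le hti, norm_zero]
    exact hδ.le
  set a := (π n).pts i with ha
  set b := min ((π n).pts (i + 1)) t with hb
  have hab : a < b := lt_min ((π n).lt_succ i) hti
  have hIoc : Ioc a ((π n).pts (i + 1)) ∩ Iic t = Ioc a b := by
    ext u
    simp only [mem_inter_iff, mem_Ioc, mem_Iic, hb, le_min_iff, and_assoc]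
  -- On such an interval `Z` has the same increments as `Z` minus its big jumps.
  have hnear : ∀ u ∈ Ioc a b, ‖Z b - Z u‖ ≤ δ := fun u hu => by
    have hJ : bigJumpSum Z ε u = bigJumpSum Z ε b := by
      have : Ioc 0 u ∩ bigJumpTimes Z ε = Ioc 0 b ∩ bigJumpTimes Z ε := by
        ext s
        refine ⟨fun hs => ⟨⟨hs.1.1, hs.1.2.trans hu.2⟩, hs.2⟩, fun hs => ⟨⟨hs.1.1, ?_⟩, hs.2⟩⟩
        by_contra! hus
        have : s ∈ Ioc a ((π n).pts (i + 1)) ∩ Iic t ∩ bigJumpTimes Z ε := by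
          rw [hIoc]
          exact ⟨⟨hu.1.trans hus, hs.1.2⟩, hs.2⟩
        rw [hi] at this
        exact this
      rw [bigJumpSum, bigJumpSum, this]
    have hosc : edist ((Z - bigJumpSum Z ε) b) ((Z - bigJumpSum Z ε) u)
        ≤ oscPlus (π n) (Z - bigJumpSum Z ε) t := by
      rw [← hIoc] at hu
      have hbm : b ∈ Ioc a ((π n).pts (i + 1)) ∩ Iic t := by
        rw [hIoc]
        exact ⟨hab, le_rfl⟩
      exact le_iSup_of_le i (le_iSup₂_of_le b hbm (le_iSup₂_of_le u hu le_rfl))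
    have h2 := hosc.trans hn.le
    rw [edist_dist, ENNReal.ofReal_le_ofReal_iff hδ.le, dist_eq_norm, Pi.sub_apply, Pi.sub_apply,
      hJ, sub_sub_sub_cancel_right] at h2
    exact h2
  have hlim : Tendsto (fun u => ‖Z b - Z u‖) (𝓝[>] a) (𝓝 ‖Z b - Z a‖) :=
    (((hZ.tendsto_right a).mono_left (nhdsWithin_mono a Ioi_subset_Ici_self)).const_sub (Z b)).norm
  have : ‖Z b - Z a‖ ≤ δ := le_of_tendsto hlim (by
    filter_upwards [Ioc_mem_nhdsGT hab] with u hu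
    exact hnear u hu)
  rwa [incr, min_eq_left hti.le]

/-- At a jump time `u`, the endpoints of the interval of the partition containing `u` see the
values of the path just before and at `u`. -/
theorem ConditionC.tendsto_apply_endpoints (hC : ConditionC π Z) (hL : ApproximatesFromLeft π Z)
    (hρ : Continuous (Function.uncurry ρ)) {u t : ℝ≥0} (hu : jump Z u ≠ 0) (hut : u ≤ t) :
    Tendsto (fun n => ρ (Z (min ((π n).pts ((π n).index u)) t))
      (Z (min ((π n).pts ((π n).index u + 1)) t))) atTop (𝓝 (ρ (Function.leftLim Z u) (Z u))) := by
  have hu0 : 0 < u := by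
    rw [pos_iff_ne_zero]
    rintro rfl
    exact hu (jump_zero Z)
  have h1 := hL u hu0
  have h2 := h1.add (hC.tendsto_incr u hu t hut)
  rw [jump, add_sub_cancel] at h2
  have h3 := (hρ.tendsto (Function.leftLim Z u, Z u)).comp (h1.prodMk_nhds h2)
  refine h3.congr fun n => ?_
  have h4 : min ((π n).pts ((π n).index u)) t = (π n).lower u :=
    min_eq_left (((π n).lower_le u).trans hut)
  simp only [Function.comp_apply, Function.uncurry_apply_pair, incr]
  rw [h4, add_sub_cancel]

variable [CompleteSpace G]

/-- Let `ρ` be a two-point function which near the diagonal is small compared with a control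
function `κ` of the increment, and suppose that `κ` of the increments and of the jumps of `Z` is
summable. Then the values of `ρ` over the intervals of the partition approximate the values of `ρ`
over the jumps of `Z`, with errors whose sum tends to zero. -/
theorem sumNormTendstoZero_apply_sub_sumUpTo (hZ : IsCadlag Z) (hC : ConditionC π Z)
    (hL : ApproximatesFromLeft π Z) (hρ : Continuous (Function.uncurry ρ)) (hκ : ∀ v, 0 ≤ κ v)
    {t : ℝ≥0}
    (hsmall : ∀ η > 0, ∃ δ > 0, ∀ z ∈ closure (Z '' Iic t), ∀ w, ‖w - z‖ ≤ δ →
      ‖ρ z w‖ ≤ η * κ (w - z))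
    (hinc : ∃ C, ∀ n N, ∑ i ∈ Finset.range N, κ (incr (π n) Z t i) ≤ C)
    (hjmp : ∃ C, ∀ S : Finset ℝ≥0, (∀ s ∈ S, s ≤ t) → ∑ s ∈ S, κ (jump Z s) ≤ C)
    (hfin : ∀ ε > 0, (Iic t ∩ bigJumpTimes Z ε).Finite)
    (hp : LocSummable fun u => ρ (Function.leftLim Z u) (Z u)) :
    SumNormTendstoZero fun n i =>
      ρ (Z (min ((π n).pts i) t)) (Z (min ((π n).pts (i + 1)) t))
        - incr (π n) (sumUpTo fun u => ρ (Function.leftLim Z u) (Z u)) t i := by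
  classical
  set p : ℝ≥0 → G := fun u => ρ (Function.leftLim Z u) (Z u) with hpdef
  obtain ⟨C₁, hC₁⟩ := hinc
  obtain ⟨C₂, hC₂⟩ := hjmp
  have hC₁0 : 0 ≤ C₁ := by simpa using hC₁ 0 0
  have hC₂0 : 0 ≤ C₂ := by simpa using hC₂ ∅ (by simp)
  intro ε₀ hε₀
  set η := ε₀ / (C₁ + C₂ + 1) with hη
  have hηpos : 0 < η := by positivity
  obtain ⟨δ, hδ, hδρ⟩ := hsmall η hηpos
  obtain ⟨ε, hε, hεδ, hincr⟩ := hC.exists_eventually_norm_incr_le hZ t hδ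
  obtain ⟨N₀, hN₀⟩ := hC.subsingleton t ε hε
  set D : Finset ℝ≥0 := (hfin ε hε).toFinset with hD
  have hmemD : ∀ u, u ∈ D ↔ u ≤ t ∧ ε < ‖jump Z u‖ := fun u => by
    simp [hD, bigJumpTimes]
  set r : ℕ → ℕ → G := fun n i =>
    ρ (Z (min ((π n).pts i) t)) (Z (min ((π n).pts (i + 1)) t)) with hr
  -- The contributions of the big jumps.
  have hbig : ∀ᶠ n in atTop, ∀ u ∈ D, ‖r n ((π n).index u) - p u‖ ≤ η / (D.card + 1) := by
    rw [eventually_all_finset]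
    intro u hu
    have hu' := (hmemD u).1 hu
    have hne : jump Z u ≠ 0 := norm_pos_iff.1 (hε.trans hu'.2)
    have := hC.tendsto_apply_endpoints hL hρ hne hu'.1
    have h2 := (tendsto_iff_norm_sub_tendsto_zero.1 this).eventually_lt_const
      (show 0 < η / (D.card + 1) by positivity)
    exact h2.mono fun n hn => hn.le
  -- The norms of the contributions of the remaining jumps.
  set q : ℝ≥0 → ℝ := (D : Set ℝ≥0)ᶜ.indicator fun u => ‖p u‖ with hq
  have hq0 : ∀ u, 0 ≤ q u := fun u => indicator_nonneg (fun _ _ => norm_nonneg _) u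
  have hqp : ∀ u, q u ≤ ‖p u‖ := fun u => indicator_le_self' (fun _ _ => norm_nonneg _) u
  have hqs : LocSummable q := hp.of_norm_le fun u => by
    rw [Real.norm_of_nonneg (hq0 u)]
    exact hqp u
  have hqsum : sumUpTo q t ≤ η * C₂ := by
    refine Real.tsum_le_of_sum_le (fun u => indicator_nonneg (fun u _ => hq0 u) u) fun S => ?_
    calc ∑ u ∈ S, (Ioc 0 t).indicator q u
        ≤ ∑ u ∈ S.filter (· ≤ t), η * κ (jump Z u) := by
          rw [Finset.sum_filter]
          refine Finset.sum_le_sum fun u _ => ?_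
          split_ifs with hut
          · have h0 : 0 ≤ η * κ (jump Z u) := mul_nonneg hηpos.le (hκ _)
            refine indicator_apply_le' (fun _ => ?_) fun _ => h0
            by_cases huD : u ∈ D
            · simpa [hq, huD] using h0
            · have h1 : ‖jump Z u‖ ≤ ε := by
                by_contra! h
                exact huD ((hmemD u).2 ⟨hut, h⟩)
              exact (hqp u).trans
                (hδρ _ (hZ.leftLim_mem_closure hut) _ (h1.trans hεδ))
          · exact (indicator_of_notMem (fun h => hut h.2) q).le
      _ = η * ∑ u ∈ S.filter (· ≤ t), κ (jump Z u) := by rw [Finset.mul_sum]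
      _ ≤ η * C₂ := by
          gcongr
          exact hC₂ _ fun s hs => (Finset.mem_filter.1 hs).2
  filter_upwards [hincr, hbig, eventually_ge_atTop N₀] with n hn1 hn2 hn3 N
  have hterm : ∀ i, ‖r n i - incr (π n) (sumUpTo p) t i‖ ≤ η * κ (incr (π n) Z t i)
      + ∑ u ∈ D, (if i = (π n).index u then η / (D.card + 1) else 0)
      + incr (π n) (sumUpTo q) t i := by
    intro i
    set a := min ((π n).pts i) t with ha
    set b := min ((π n).pts (i + 1)) t with hb
    have hab : a ≤ b := min_le_min_right t ((π n).mono i.le_succ)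
    have hbt : b ≤ t := min_le_right _ _
    have hIoc : ∀ u, u ∈ Ioc a b → u ∈ Ioc ((π n).pts i) ((π n).pts (i + 1)) ∩ Iic t :=
      fun u hu => by
        refine ⟨⟨?_, hu.2.trans (min_le_left _ _)⟩, hu.2.trans hbt⟩
        by_contra! h
        exact absurd (le_min h (hu.2.trans hbt)) hu.1.not_ge
    have hincp : incr (π n) (sumUpTo p) t i = ∑' u, (Ioc a b).indicator p u := hp.sumUpTo_sub hab
    have hincq : incr (π n) (sumUpTo q) t i = ∑' u, (Ioc a b).indicator q u := hqs.sumUpTo_sub hab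
    have hsubt : Ioc a b ⊆ Ioc 0 b := Ioc_subset_Ioc_left zero_le
    have hsq : Summable ((Ioc a b).indicator q) := hqs.summable_indicator hsubt
    have hsub : (Ioc a b ∩ (D : Set ℝ≥0)ᶜ) ⊆ Ioc 0 b := inter_subset_left.trans hsubt
    have hsmallpart : ‖∑' u, (Ioc a b ∩ (D : Set ℝ≥0)ᶜ).indicator p u‖
        ≤ incr (π n) (sumUpTo q) t i := by
      rw [hincq]
      refine tsum_of_norm_bounded hsq.hasSum fun u => ?_
      rw [norm_indicator_eq_indicator_norm, ← indicator_indicator]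
    have hκi : 0 ≤ η * κ (incr (π n) Z t i) := mul_nonneg hηpos.le (hκ _)
    have hD0 : 0 ≤ ∑ u ∈ D, (if i = (π n).index u then η / (D.card + 1) else 0) :=
      Finset.sum_nonneg fun u _ => by split_ifs <;> positivity
    by_cases hex : ∃ u ∈ D, u ∈ Ioc a b
    · obtain ⟨u, huD, hu⟩ := hex
      have hidx : (π n).index u = i := (π n).index_eq (hIoc u hu).1
      have huniq : ∀ v ∈ Ioc a b, v ∈ D → v = u := fun v hv hvD =>
        hN₀ n hn3 i ⟨hIoc v hv, ((hmemD v).1 hvD).2⟩ ⟨hIoc u hu, ((hmemD u).1 huD).2⟩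
      have hsplit : ∑' v, (Ioc a b).indicator p v
          = p u + ∑' v, (Ioc a b ∩ (D : Set ℝ≥0)ᶜ).indicator p v := by
        rw [(hp.summable_indicator hsubt).tsum_eq_add_tsum_ite u, indicator_of_mem hu]
        congr 1
        refine tsum_congr fun v => ?_
        rcases eq_or_ne v u with rfl | hvu
        · rw [if_pos rfl, indicator_of_notMem fun h => h.2 huD]
        · rw [if_neg hvu]
          by_cases hv : v ∈ Ioc a b
          · rw [indicator_of_mem hv, indicator_of_mem
              (show v ∈ Ioc a b ∩ (D : Set ℝ≥0)ᶜ from ⟨hv, fun h => hvu (huniq v hv h)⟩)]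
          · rw [indicator_of_notMem hv, indicator_of_notMem fun h => hv h.1]
      have h1 : ‖r n i - p u‖ ≤ ∑ u ∈ D, (if i = (π n).index u then η / (D.card + 1) else 0) := by
        refine le_trans ?_ (Finset.single_le_sum (f := fun u => if i = (π n).index u then
          η / ((D.card : ℝ) + 1) else 0) (fun u _ => by split_ifs <;> positivity) huD)
        rw [if_pos hidx.symm]
        exact hidx ▸ hn2 u huD
      rw [hincp, hsplit, ← sub_sub]
      refine (norm_sub_le _ _).trans ?_
      linarith
    · have hempty : Ioc a b ∩ (D : Set ℝ≥0)ᶜ = Ioc a b :=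
        inter_eq_left.2 fun u hu huD => hex ⟨u, huD, hu⟩
      rw [hempty, ← hincp] at hsmallpart
      have hnorm : ‖incr (π n) Z t i‖ ≤ δ := by
        rcases le_or_gt t ((π n).pts i) with hti | hti
        · rw [incr_of_le hti, norm_zero]
          exact hδ.le
        refine hn1 i (eq_empty_of_forall_notMem fun u hu => hex ⟨u, (hmemD u).2
          ⟨hu.1.2, hu.2⟩, ?_, le_min hu.1.1.2 hu.1.2⟩)
        exact (min_le_left _ _).trans_lt hu.1.1.1
      have h1 : ‖r n i‖ ≤ η * κ (incr (π n) Z t i) :=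
        hδρ _ (subset_closure ⟨a, mem_Iic.2 (min_le_right _ _), rfl⟩) _ hnorm
      refine (norm_sub_le _ _).trans ?_
      linarith
  refine (Finset.sum_le_sum fun i _ => hterm i).trans ?_
  rw [Finset.sum_add_distrib, Finset.sum_add_distrib, ← Finset.mul_sum, sum_incr]
  have hb1 : ∑ i ∈ Finset.range N, ∑ u ∈ D,
      (if i = (π n).index u then η / ((D.card : ℝ) + 1) else 0) ≤ η := by
    rw [Finset.sum_comm]
    calc _ ≤ ∑ u ∈ D, η / ((D.card : ℝ) + 1) := by
          refine Finset.sum_le_sum fun u _ => ?_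
          rw [Finset.sum_ite_eq']
          split_ifs
          · exact le_rfl
          · positivity
      _ = η * (D.card / (D.card + 1)) := by
          rw [Finset.sum_const, nsmul_eq_mul]
          ring
      _ ≤ η * 1 := by
          gcongr
          rw [div_le_one (by positivity)]
          linarith
      _ = η := mul_one η
  have hb2 : sumUpTo q (min ((π n).pts N) t) - sumUpTo q 0 ≤ η * C₂ := by
    have h1 : sumUpTo q 0 = 0 := by simp [sumUpTo]
    have h2 : 0 ≤ sumUpTo q t - sumUpTo q (min ((π n).pts N) t) := by
      rw [hqs.sumUpTo_sub (min_le_right _ _)]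
      exact tsum_nonneg fun u => indicator_nonneg (fun u _ => hq0 u) u
    linarith
  have hb3 : η * ∑ i ∈ Finset.range N, κ (incr (π n) Z t i) ≤ η * C₁ := by
    gcongr
    exact hC₁ n N
  have hb4 : η * (C₁ + C₂ + 1) = ε₀ := by
    rw [hη]
    field_simp
  linarith

end JumpRemainder

/-! ### Taylor expansion with Gâteaux derivatives -/

section Calculus

theorem exists_norm_sub_le_of_isCompact {S S' : Type*} [NormedAddCommGroup S]
    [NormedAddCommGroup S'] {g : S → S'} {K : Set S} (hK : IsCompact K)
    (hg : Continuous g) {η : ℝ} (hη : 0 < η) :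
    ∃ δ > 0, ∀ z ∈ K, ∀ w, ‖w - z‖ < δ → ‖g w - g z‖ ≤ η := by
  have := hK.uniformContinuousAt_of_continuousAt g (fun z _ => hg.continuousAt)
    (Metric.dist_mem_uniformity hη)
  obtain ⟨δ, hδ, h⟩ := Metric.mem_uniformity_dist.1 this
  refine ⟨δ, hδ, fun z hz w hw => ?_⟩
  have h1 := h (a := z) (b := w) (by rwa [dist_comm, dist_eq_norm]) hz
  rw [← dist_eq_norm, dist_comm]
  exact le_of_lt h1

variable {E : Type*} [NormedAddCommGroup E] [NormedSpace ℝ E]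
  {F : Type*} [NormedAddCommGroup F] [NormedSpace ℝ F]
  {G : Type*} [NormedAddCommGroup G] [NormedSpace ℝ G]
  {H : Type*} [NormedAddCommGroup H] [NormedSpace ℝ H]

/-- On a metric space, continuity on compact sets amounts to continuity, because a convergent
sequence and its limit form a compact set. -/
theorem ContinuousOnCompacts.continuous {S S' : Type*} [TopologicalSpace S] [SequentialSpace S]
    [TopologicalSpace S'] {g : S → S'} (hg : ContinuousOnCompacts g) : Continuous g := by
  refine continuous_iff_seqContinuous.2 fun z a hz => ?_
  have h := hg _ hz.isCompact_insert_range a (mem_insert _ _)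
  exact h.tendsto.comp (tendsto_nhdsWithin_iff.2
    ⟨hz, Eventually.of_forall fun n => mem_insert_of_mem _ (mem_range_self n)⟩)

theorem hasDerivAt_of_hasGateauxDerivAt {g : E → G} {T : E → E →L[ℝ] G}
    (h : ∀ x, HasGateauxDerivAt g (T x) x) (x k : E) (θ : ℝ) :
    HasDerivAt (fun s : ℝ => g (x + s • k)) (T (x + θ • k) k) θ := by
  have h1 : HasDerivAt (fun s : ℝ => g (x + θ • k + s • k)) (T (x + θ • k) k) (θ - θ) := by
    rw [sub_self]
    exact h (x + θ • k) k
  refine (h1.comp_sub_const θ θ).congr_of_eventuallyEq (Eventually.of_forall fun s => ?_)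
  dsimp only
  rw [add_assoc, ← add_smul, add_sub_cancel]

theorem norm_sub_sub_le_of_gateaux {g : E → G} {T : E → E →L[ℝ] G}
    (h : ∀ x, HasGateauxDerivAt g (T x) x) {x k : E} {L : G} {C : ℝ}
    (hC : ∀ θ ∈ Icc (0 : ℝ) 1, ‖T (x + θ • k) k - L‖ ≤ C) : ‖g (x + k) - g x - L‖ ≤ C := by
  have hd : ∀ θ ∈ Icc (0 : ℝ) 1, HasDerivWithinAt (fun s : ℝ => g (x + s • k) - s • L)
      (T (x + θ • k) k - L) (Icc 0 1) θ := fun θ _ => by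
    have := (hasDerivAt_of_hasGateauxDerivAt h x k θ).sub ((hasDerivAt_id θ).smul_const L)
    rw [one_smul] at this
    exact this.hasDerivWithinAt
  have := norm_image_sub_le_of_norm_deriv_le_segment_01' hd fun θ hθ => hC θ ⟨hθ.1, hθ.2.le⟩
  simpa [sub_right_comm] using this

/-- The function `f (a, x)` has a continuous Gâteaux derivative `Da` in `a`, a continuous Gâteaux
derivative `Dx` in `x`, and a second Gâteaux derivative `D2` in `x` which factors through the
bilinear map `B` as a continuous function `Φ`. -/
structure IsC12 (B : E →L[ℝ] E →L[ℝ] H) (f : F × E → G) (Da : F × E → F →L[ℝ] G)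
    (Dx : F × E → E →L[ℝ] G) (D2 : F × E → E →L[ℝ] E →L[ℝ] G) (Φ : F × E → H →L[ℝ] G) :
    Prop where
  hasGateauxDerivAt_fst : ∀ a x, HasGateauxDerivAt (fun a' => f (a', x)) (Da (a, x)) a
  hasGateauxDerivAt_snd : ∀ a x, HasGateauxDerivAt (fun x' => f (a, x')) (Dx (a, x)) x
  hasGateauxDerivAt_snd_snd : ∀ a x, HasGateauxDerivAt (fun x' => Dx (a, x')) (D2 (a, x)) x
  continuous_Da : Continuous Da
  continuous_Dx : Continuous Dx
  apply_eq : ∀ p h k, Φ p (B h k) = D2 p h k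
  continuous_Φ : Continuous Φ

/-- The remainder of the Taylor expansion of `f`, of first order in `a` and second order in `x`. -/
noncomputable def taylorRemainder (B : E →L[ℝ] E →L[ℝ] H) (f : F × E → G)
    (Da : F × E → F →L[ℝ] G) (Dx : F × E → E →L[ℝ] G) (Φ : F × E → H →L[ℝ] G)
    (z w : F × E) : G :=
  f w - f z - Da z (w.1 - z.1) - Dx z (w.2 - z.2)
    - (1 / 2 : ℝ) • Φ z (B (w.2 - z.2) (w.2 - z.2))

variable {B : E →L[ℝ] E →L[ℝ] H} {f : F × E → G} {Da : F × E → F →L[ℝ] G}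
  {Dx : F × E → E →L[ℝ] G} {D2 : F × E → E →L[ℝ] E →L[ℝ] G} {Φ : F × E → H →L[ℝ] G}

theorem IsC12.norm_taylor_snd_le (hf : IsC12 B f Da Dx D2 Φ)
    (hB : ∀ h k, ‖B h k‖ ≤ ‖h‖ * ‖k‖) {a : F} {x k : E} {η : ℝ}
    (h : ∀ θ ∈ Icc (0 : ℝ) 1, ‖Φ (a, x + θ • k) - Φ (a, x)‖ ≤ η) :
    ‖f (a, x + k) - f (a, x) - Dx (a, x) k - (1 / 2 : ℝ) • Φ (a, x) (B k k)‖ ≤ η * ‖k‖ ^ 2 := by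
  have hη : 0 ≤ η := (norm_nonneg _).trans (h 0 ⟨le_rfl, zero_le_one⟩)
  -- First-order expansion of `Dx` along the segment.
  have h1 : ∀ θ ∈ Icc (0 : ℝ) 1,
      ‖Dx (a, x + θ • k) - Dx (a, x) - θ • D2 (a, x) k‖ ≤ η * ‖k‖ := fun θ hθ => by
    refine norm_sub_sub_le_of_gateaux (hf.hasGateauxDerivAt_snd_snd a) fun s hs => ?_
    have hsθ : s * θ ∈ Icc (0 : ℝ) 1 :=
      ⟨mul_nonneg hs.1 hθ.1, mul_le_one₀ hs.2 hθ.1 hθ.2⟩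
    refine ContinuousLinearMap.opNorm_le_bound _ (by positivity) fun y => ?_
    have h2 : (D2 (a, x + s • θ • k) (θ • k) - θ • D2 (a, x) k) y
        = θ • (Φ (a, x + (s * θ) • k) - Φ (a, x)) (B k y) := by
      rw [smul_smul, map_smul, ← smul_sub, smul_apply,
        sub_apply, sub_apply, hf.apply_eq, hf.apply_eq]
    rw [h2, norm_smul, Real.norm_of_nonneg hθ.1]
    calc θ * ‖(Φ (a, x + (s * θ) • k) - Φ (a, x)) (B k y)‖
        ≤ 1 * (η * (‖k‖ * ‖y‖)) := by
          gcongr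
          · exact hθ.2
          · exact (ContinuousLinearMap.le_of_opNorm_le _ (h _ hsθ) _).trans
              (mul_le_mul_of_nonneg_left (hB k y) hη)
      _ = η * ‖k‖ * ‖y‖ := by ring
  have hd : ∀ θ ∈ Icc (0 : ℝ) 1, HasDerivWithinAt
      (fun s : ℝ => f (a, x + s • k) - s • Dx (a, x) k - (s ^ 2 / 2) • Φ (a, x) (B k k))
      ((Dx (a, x + θ • k) - Dx (a, x) - θ • D2 (a, x) k) k) (Icc 0 1) θ := fun θ _ => by
    have e1 := hasDerivAt_of_hasGateauxDerivAt (hf.hasGateauxDerivAt_snd a) x k θ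
    have e2 := (hasDerivAt_id θ).smul_const (Dx (a, x) k)
    have e3 := (((hasDerivAt_id θ).pow 2).div_const 2).smul_const (Φ (a, x) (B k k))
    refine ((e1.sub e2).sub e3).hasDerivWithinAt.congr_deriv ?_
    rw [hf.apply_eq]
    simp
  have h3 := norm_image_sub_le_of_norm_deriv_le_segment_01' hd (C := η * ‖k‖ * ‖k‖)
    fun θ hθ => ContinuousLinearMap.le_of_opNorm_le _ (h1 θ ⟨hθ.1, hθ.2.le⟩) k
  have h4 : f (a, x + k) - f (a, x) - Dx (a, x) k - (1 / 2 : ℝ) • Φ (a, x) (B k k)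
      = (f (a, x + (1 : ℝ) • k) - (1 : ℝ) • Dx (a, x) k
          - ((1 : ℝ) ^ 2 / 2) • Φ (a, x) (B k k))
        - (f (a, x + (0 : ℝ) • k) - (0 : ℝ) • Dx (a, x) k
          - ((0 : ℝ) ^ 2 / 2) • Φ (a, x) (B k k)) := by
    simp
    abel
  rw [h4]
  refine h3.trans (le_of_eq (by ring))

theorem norm_smul_le_of_mem_Icc (y : E) {θ : ℝ} (hθ : θ ∈ Icc (0 : ℝ) 1) : ‖θ • y‖ ≤ ‖y‖ := by
  rw [norm_smul, Real.norm_of_nonneg hθ.1]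
  exact mul_le_of_le_one_left (norm_nonneg _) hθ.2

/-- The Taylor remainder is small compared with `‖a - a'‖ + ‖x - x'‖ ^ 2`, uniformly for base
points in a compact set. -/
theorem IsC12.exists_norm_taylorRemainder_le (hf : IsC12 B f Da Dx D2 Φ)
    (hB : ∀ h k, ‖B h k‖ ≤ ‖h‖ * ‖k‖) {K : Set (F × E)} (hK : IsCompact K) {η : ℝ}
    (hη : 0 < η) : ∃ δ > 0, ∀ z ∈ K, ∀ w, ‖w - z‖ ≤ δ →
      ‖taylorRemainder B f Da Dx Φ z w‖ ≤ η * (‖(w - z).1‖ + ‖(w - z).2‖ ^ 2) := by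
  obtain ⟨δ₁, hδ₁, h1⟩ := exists_norm_sub_le_of_isCompact hK hf.continuous_Da hη
  obtain ⟨δ₂, hδ₂, h2⟩ := exists_norm_sub_le_of_isCompact hK hf.continuous_Φ hη
  refine ⟨min δ₁ δ₂ / 2, by positivity, ?_⟩
  rintro ⟨a, x⟩ hz ⟨a', x'⟩ hw
  obtain ⟨l, rfl⟩ : ∃ l, a' = a + l := ⟨a' - a, by abel⟩
  obtain ⟨k, rfl⟩ : ∃ k, x' = x + k := ⟨x' - x, by abel⟩
  have hlt : ‖((l, k) : F × E)‖ < min δ₁ δ₂ := by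
    have : ((a + l, x + k) : F × E) - (a, x) = (l, k) := by simp
    rw [this] at hw
    have h0 : 0 < min δ₁ δ₂ := lt_min hδ₁ hδ₂
    linarith
  have hl : ‖l‖ < min δ₁ δ₂ := (norm_fst_le (l, k)).trans_lt hlt
  have hk : ‖k‖ < min δ₁ δ₂ := (norm_snd_le (l, k)).trans_lt hlt
  have hsnd := hf.norm_taylor_snd_le hB (a := a) (x := x) (k := k) (η := η) fun θ hθm => by
    refine h2 (a, x) hz _ ?_
    have : ((a, x + θ • k) : F × E) - (a, x) = (0, θ • k) := by simp
    rw [this, Prod.norm_mk, norm_zero, max_eq_right (norm_nonneg _)]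
    exact (norm_smul_le_of_mem_Icc k hθm).trans_lt (hk.trans_le (min_le_right _ _))
  have hfst := norm_sub_sub_le_of_gateaux (fun a => hf.hasGateauxDerivAt_fst a (x + k))
    (x := a) (k := l) (L := Da (a, x) l) (C := η * ‖l‖) fun θ hθm => by
    rw [← sub_apply]
    refine ContinuousLinearMap.le_of_opNorm_le _ (h1 (a, x) hz _ ?_) l
    have : ((a + θ • l, x + k) : F × E) - (a, x) = (θ • l, k) := by simp
    rw [this, Prod.norm_mk]
    exact max_lt ((norm_smul_le_of_mem_Icc l hθm).trans_lt (hl.trans_le (min_le_left _ _)))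
      (hk.trans_le (min_le_left _ _))
  have hsplit : taylorRemainder B f Da Dx Φ (a, x) (a + l, x + k)
      = (f (a + l, x + k) - f (a, x + k) - Da (a, x) l)
        + (f (a, x + k) - f (a, x) - Dx (a, x) k - (1 / 2 : ℝ) • Φ (a, x) (B k k)) := by
    simp only [taylorRemainder, add_sub_cancel_left]
    abel
  rw [hsplit]
  refine (norm_add_le _ _).trans ((add_le_add hfst hsnd).trans (le_of_eq ?_))
  simp only [Prod.mk_sub_mk, add_sub_cancel_left]
  ring

theorem taylorRemainder_self (z : F × E) : taylorRemainder B f Da Dx Φ z z = 0 := by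
  simp [taylorRemainder]

theorem IsC12.continuous (hf : IsC12 B f Da Dx D2 Φ) (hB : ∀ h k, ‖B h k‖ ≤ ‖h‖ * ‖k‖) :
    Continuous f := by
  refine continuous_iff_continuousAt.2 fun z => ?_
  obtain ⟨δ, hδ, h⟩ := hf.exists_norm_taylorRemainder_le hB (isCompact_singleton (x := z)) one_pos
  have hR : Tendsto (taylorRemainder B f Da Dx Φ z) (𝓝 z) (𝓝 0) := by
    have hb : Tendsto (fun w : F × E => 1 * (‖(w - z).1‖ + ‖(w - z).2‖ ^ 2)) (𝓝 z) (𝓝 0) := by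
      have : Continuous fun w : F × E => 1 * (‖(w - z).1‖ + ‖(w - z).2‖ ^ 2) := by fun_prop
      simpa using this.tendsto z
    refine squeeze_zero_norm' ?_ hb
    filter_upwards [Metric.closedBall_mem_nhds z hδ] with w hw
    exact h z rfl w (by rwa [mem_closedBall_iff_norm] at hw)
  have hrest : Tendsto (fun w : F × E => Da z (w.1 - z.1) + Dx z (w.2 - z.2)
      + (1 / 2 : ℝ) • Φ z (B (w.2 - z.2) (w.2 - z.2))) (𝓝 z) (𝓝 0) := by
    have : Continuous fun w : F × E => Da z (w.1 - z.1) + Dx z (w.2 - z.2)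
      + (1 / 2 : ℝ) • Φ z (B (w.2 - z.2) (w.2 - z.2)) := by fun_prop
    simpa using this.tendsto z
  have := (hR.add hrest).const_add (f z)
  rw [add_zero, add_zero] at this
  refine this.congr fun w => ?_
  simp only [taylorRemainder]
  abel

theorem IsC12.continuous_taylorRemainder (hf : IsC12 B f Da Dx D2 Φ)
    (hB : ∀ h k, ‖B h k‖ ≤ ‖h‖ * ‖k‖) :
    Continuous (Function.uncurry (taylorRemainder B f Da Dx Φ)) := by
  have h1 := hf.continuous hB
  have h2 := hf.continuous_Da
  have h3 := hf.continuous_Dx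
  have h4 := hf.continuous_Φ
  unfold taylorRemainder Function.uncurry
  fun_prop

end Calculus

/-! ### Tensor products of operators under a uniform crossnorm -/

section Tensor

theorem norm_tmulL_le {E F : Type*} [NormedAddCommGroup E] [NormedSpace ℝ E]
    [NormedAddCommGroup F] [NormedSpace ℝ F] (α : ReasonableCrossnorm E F) (x : E) (y : F) :
    ‖tmulL α x y‖ ≤ ‖x‖ * ‖y‖ := by
  rw [tmulL_apply, UniformSpace.Completion.norm_coe]
  exact α.apply_tmul_le x y

/-- Squares are not shrunk by a reasonable crossnorm, as tested on `φ ⊗ φ` for a norming functional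
`φ` of `x`. Hence the jumps of the tensor quadratic variation control the squared jumps of the
path. -/
theorem sq_norm_le_norm_tmulL {E : Type*} [NormedAddCommGroup E] [NormedSpace ℝ E]
    (α : ReasonableCrossnorm E E) (x : E) : ‖x‖ ^ 2 ≤ ‖tmulL α x x‖ := by
  rw [tmulL_apply, UniformSpace.Completion.norm_coe]
  obtain ⟨φ, hφ, hφx⟩ := exists_dual_vector'' ℝ x
  have h := α.dual_tmul_le φ φ (x ⊗ₜ[ℝ] x)
  have h0 : 0 ≤ α.toSeminorm (x ⊗ₜ[ℝ] x) := apply_nonneg _ _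
  rw [TensorProduct.map_tmul, LinearMap.mul'_apply] at h
  have h2 : ‖φ x * φ x‖ = ‖x‖ ^ 2 := by
    rw [hφx]
    simp [sq]
  calc ‖x‖ ^ 2 = ‖φ x * φ x‖ := h2.symm
    _ ≤ ‖φ‖ * ‖φ‖ * α.toSeminorm (x ⊗ₜ[ℝ] x) := h
    _ ≤ 1 * 1 * α.toSeminorm (x ⊗ₜ[ℝ] x) := by gcongr
    _ = α.toSeminorm (x ⊗ₜ[ℝ] x) := by ring

variable {E₁ E₂ F₁ F₂ : Type u}
  [NormedAddCommGroup E₁] [NormedSpace ℝ E₁] [CompleteSpace E₁]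
  [NormedAddCommGroup E₂] [NormedSpace ℝ E₂] [CompleteSpace E₂]
  [NormedAddCommGroup F₁] [NormedSpace ℝ F₁] [CompleteSpace F₁]
  [NormedAddCommGroup F₂] [NormedSpace ℝ F₂] [CompleteSpace F₂]

theorem UniformCrossnorm.map_coe (α : UniformCrossnorm.{u}) (T : E₁ →L[ℝ] E₂) (S : F₁ →L[ℝ] F₂)
    (z : NormedTensor (α.norm E₁ F₁)) :
    α.map T S (z : CompletedTensor (α.norm E₁ F₁)) = (α.mapAlg T S z : CompletedTensor _) :=
  ContinuousLinearMap.completion_apply_coe _ _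

theorem UniformCrossnorm.opNorm_map_le (α : UniformCrossnorm.{u}) (T : E₁ →L[ℝ] E₂)
    (S : F₁ →L[ℝ] F₂) : ‖α.map T S‖ ≤ ‖T‖ * ‖S‖ := by
  refine ContinuousLinearMap.opNorm_le_bound _ (by positivity) fun z => ?_
  refine UniformSpace.Completion.induction_on z (isClosed_le (by fun_prop) (by fun_prop))
    fun z => ?_
  rw [α.map_coe, UniformSpace.Completion.norm_coe, UniformSpace.Completion.norm_coe]
  exact α.norm_map_le T S z

theorem UniformCrossnorm.map_sub_map (α : UniformCrossnorm.{u}) (T S : E₁ →L[ℝ] E₂) :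
    α.map T T - α.map S S = α.map (T - S) T + α.map S (T - S) := by
  ext z
  refine UniformSpace.Completion.induction_on z
    (isClosed_eq (by fun_prop) (by fun_prop)) fun z => ?_
  simp only [sub_apply, add_apply, α.map_coe, ← UniformSpace.Completion.coe_sub,
    ← UniformSpace.Completion.coe_add]
  congr 1
  have h : TensorProduct.map (T : E₁ →ₗ[ℝ] E₂) (T : E₁ →ₗ[ℝ] E₂)
      - TensorProduct.map (S : E₁ →ₗ[ℝ] E₂) (S : E₁ →ₗ[ℝ] E₂)
      = TensorProduct.map ((T - S : E₁ →L[ℝ] E₂) : E₁ →ₗ[ℝ] E₂) (T : E₁ →ₗ[ℝ] E₂)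
      + TensorProduct.map (S : E₁ →ₗ[ℝ] E₂) ((T - S : E₁ →L[ℝ] E₂) : E₁ →ₗ[ℝ] E₂) := by
    ext x y
    simp [TensorProduct.sub_tmul, TensorProduct.tmul_sub]
  exact LinearMap.congr_fun h z

theorem UniformCrossnorm.continuous_map_self (α : UniformCrossnorm.{u}) :
    Continuous fun T : E₁ →L[ℝ] E₂ => α.map T T := by
  refine continuous_iff_continuousAt.2 fun S => ?_
  refine tendsto_iff_norm_sub_tendsto_zero.2 ?_
  have hb : Tendsto (fun T : E₁ →L[ℝ] E₂ => ‖T - S‖ * ‖T‖ + ‖S‖ * ‖T - S‖) (𝓝 S) (𝓝 0) := by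
    have : Continuous fun T : E₁ →L[ℝ] E₂ => ‖T - S‖ * ‖T‖ + ‖S‖ * ‖T - S‖ := by fun_prop
    simpa using this.tendsto S
  refine squeeze_zero (fun _ => norm_nonneg _) (fun T => ?_) hb
  rw [α.map_sub_map]
  exact (norm_add_le _ _).trans (add_le_add (α.opNorm_map_le _ _) (α.opNorm_map_le _ _))

end Tensor

/-! ### Sums of control functions over increments and jumps -/

section Control

theorem SumNormTendstoZero.mul_of_sq {a b : ℕ → ℕ → ℝ}
    (ha : SumNormTendstoZero fun n i => a n i ^ 2) {C : ℝ}
    (hb : ∀ n N, ∑ i ∈ Finset.range N, b n i ^ 2 ≤ C) :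
    SumNormTendstoZero fun n i => a n i * b n i := by
  have hC : 0 ≤ C := by simpa using hb 0 0
  intro ε hε
  filter_upwards [ha (ε ^ 2 / (C + 1)) (by positivity)] with n hn N
  refine (pow_le_pow_iff_left₀ (Finset.sum_nonneg fun _ _ => norm_nonneg _) hε.le two_ne_zero).1 ?_
  calc (∑ i ∈ Finset.range N, ‖a n i * b n i‖) ^ 2
      = (∑ i ∈ Finset.range N, |a n i| * |b n i|) ^ 2 := by simp
    _ ≤ (∑ i ∈ Finset.range N, |a n i| ^ 2) * ∑ i ∈ Finset.range N, |b n i| ^ 2 :=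
        Finset.sum_mul_sq_le_sq_mul_sq _ _ _
    _ = (∑ i ∈ Finset.range N, ‖a n i ^ 2‖) * ∑ i ∈ Finset.range N, b n i ^ 2 := by simp
    _ ≤ ε ^ 2 / (C + 1) * C := by
        gcongr
        · exact hn N
        · exact hb n N
    _ ≤ ε ^ 2 / (C + 1) * (C + 1) := by gcongr; linarith
    _ = ε ^ 2 := by field_simp

theorem ApproximatesFromLeft.comp {E F : Type*} [NormedAddCommGroup E] [NormedAddCommGroup F]
    {π : ℕ → HalfLinePartition} {Z : ℝ≥0 → E} (hL : ApproximatesFromLeft π Z) (hZ : IsCadlag Z)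
    {g : E → F} (hg : Continuous g) : ApproximatesFromLeft π fun t => g (Z t) := fun t ht => by
  rw [hZ.leftLim_comp hg]
  exact (hg.tendsto _).comp (hL t ht)

theorem HasFiniteTwoVariation.exists_sum_le {E : Type*} [NormedAddCommGroup E]
    {π : ℕ → HalfLinePartition} {X : ℝ≥0 → E} (hX : HasFiniteTwoVariation π X) (t : ℝ≥0) :
    ∃ C, 0 ≤ C ∧ ∀ n N, ∑ i ∈ Finset.range N, ‖incr (π n) X t i‖ ^ 2 ≤ C := by
  obtain ⟨C, hC⟩ := hX t
  have h : ∀ n N, ∑ i ∈ Finset.range N, ‖incr (π n) X t i‖ ^ 2 ≤ C := fun n N => by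
    obtain ⟨M, hM⟩ := (π n).exists_le_pts t
    have h1 := hC (mem_range_self n)
    rw [finsum_eq_sum_range (π := π n) (t := t) (N := max M N) (fun i hi => by simp [incr_of_le hi])
      (hM.trans ((π n).mono (le_max_left _ _)))] at h1
    refine le_trans (Finset.sum_le_sum_of_subset_of_nonneg
      (Finset.range_mono (le_max_right M N)) fun _ _ _ => by positivity) h1
  exact ⟨C, by simpa using h 0 0, h⟩

variable {V : Type*} [NormedAddCommGroup V] {Z : ℝ≥0 → V} {κ : V → ℝ}

theorem finite_bigJumpTimes {t : ℝ≥0}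
    (hjmp : ∃ C, ∀ S : Finset ℝ≥0, (∀ s ∈ S, s ≤ t) → ∑ s ∈ S, κ (jump Z s) ≤ C)
    {ε c : ℝ} (hc : 0 < c) (h : ∀ v, ε < ‖v‖ → c ≤ κ v) :
    (Iic t ∩ bigJumpTimes Z ε).Finite := by
  obtain ⟨C, hC⟩ := hjmp
  by_contra hinf
  obtain ⟨N, hN⟩ := exists_nat_gt (C / c)
  obtain ⟨S, hS, hcard⟩ := Set.Infinite.exists_subset_card_eq hinf N
  have h1 := hC S fun s hs => (hS hs).1
  have h2 : ∑ _s ∈ S, c ≤ ∑ s ∈ S, κ (jump Z s) :=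
    Finset.sum_le_sum fun s hs => h _ (hS hs).2
  rw [Finset.sum_const, hcard, nsmul_eq_mul] at h2
  rw [div_lt_iff₀ hc] at hN
  linarith

/-- If `ρ` is controlled by `κ` near the diagonal, and `κ` of the jumps is summable, then the
values of `ρ` over the jumps are summable: all but the finitely many big jumps are controlled. -/
theorem locSummable_of_control {G : Type*} [NormedAddCommGroup G] {ρ : V → V → G}
    (hZ : IsCadlag Z) (hκ : ∀ v, 0 ≤ κ v)
    (hsmall : ∀ t : ℝ≥0, ∃ δ > 0, ∀ z ∈ closure (Z '' Iic t), ∀ w, ‖w - z‖ ≤ δ →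
      ‖ρ z w‖ ≤ κ (w - z))
    (hjmp : ∀ t : ℝ≥0,
      ∃ C, ∀ S : Finset ℝ≥0, (∀ s ∈ S, s ≤ t) → ∑ s ∈ S, κ (jump Z s) ≤ C)
    (hfin : ∀ (t : ℝ≥0), ∀ ε > 0, (Iic t ∩ bigJumpTimes Z ε).Finite) :
    LocSummable fun u => ρ (Function.leftLim Z u) (Z u) := fun t => by
  obtain ⟨δ, hδ, h⟩ := hsmall t
  obtain ⟨C, hC⟩ := hjmp t
  have hs : Summable ((Ioc 0 t).indicator fun u => κ (jump Z u)) := by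
    refine summable_of_sum_le (c := C) (fun u => indicator_nonneg (fun _ _ => hκ _) u) fun S => ?_
    classical
    rw [Finset.sum_indicator_eq_sum_filter]
    exact hC _ fun s hs => (Finset.mem_filter.1 hs).2.2
  refine Summable.of_norm_bounded_eventually hs ?_
  filter_upwards [(hfin t δ hδ).compl_mem_cofinite] with u hu
  by_cases hut : u ∈ Ioc 0 t
  · rw [indicator_of_mem hut, indicator_of_mem hut, norm_norm]
    refine h _ (hZ.leftLim_mem_closure hut.2) _ ?_
    by_contra! hlt
    exact hu ⟨hut.2, hlt⟩
  · rw [indicator_of_notMem hut, indicator_of_notMem hut, norm_zero]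

end Control

/-! ### The path of the Itô–Föllmer integral -/

section ItoFormula

variable {E : Type*} [NormedAddCommGroup E] [NormedSpace ℝ E]
  {F : Type*} [NormedAddCommGroup F] [NormedSpace ℝ F]
  {G : Type*} [NormedAddCommGroup G] [NormedSpace ℝ G]
  {H : Type*} [NormedAddCommGroup H] [NormedSpace ℝ H]

/-- The data of the Itô formula: a càdlàg path `A` of finite variation and a càdlàg path `X` with
`B`-quadratic variation `Q` and finite 2-variation along `π`, such that `π` satisfies
Condition (C) for `(A, X)` and approximates it from the left, and a function `f` of class
`C^{1,2}`. The bilinear map `B` is a contraction which does not shrink squares. -/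
structure ItoData (m : Mode) (B : E →L[ℝ] E →L[ℝ] H) (π : ℕ → HalfLinePartition)
    (A : ℝ≥0 → F) (X : ℝ≥0 → E) (Q : ℝ≥0 → H) (f : F × E → G) (Da : F × E → F →L[ℝ] G)
    (Dx : F × E → E →L[ℝ] G) (D2 : F × E → E →L[ℝ] E →L[ℝ] G) (Φ : F × E → H →L[ℝ] G) :
    Prop where
  cadlag_A : IsCadlag A
  finiteVariation_A : HasFiniteVariation A
  cadlag_X : IsCadlag X
  twoVariation_X : HasFiniteTwoVariation π X
  quadraticVariation : IsQuadraticCovariation m B π X X Q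
  conditionC : ConditionC π fun t => (A t, X t)
  approximates : ApproximatesFromLeft π fun t => (A t, X t)
  norm_le : ∀ h k, ‖B h k‖ ≤ ‖h‖ * ‖k‖
  sq_le : ∀ h, ‖h‖ ^ 2 ≤ ‖B h h‖
  isC12 : IsC12 B f Da Dx D2 Φ

namespace ItoData

variable {m : Mode} {B : E →L[ℝ] E →L[ℝ] H} {π : ℕ → HalfLinePartition}
  {A : ℝ≥0 → F} {X : ℝ≥0 → E} {Q : ℝ≥0 → H} {f : F × E → G} {Da : F × E → F →L[ℝ] G}
  {Dx : F × E → E →L[ℝ] G} {D2 : F × E → E →L[ℝ] E →L[ℝ] G} {Φ : F × E → H →L[ℝ] G}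
  (D : ItoData m B π A X Q f Da Dx D2 Φ)

include D

theorem cadlag : IsCadlag fun t => (A t, X t) := D.cadlag_A.prodMk D.cadlag_X

theorem jump_prod (t : ℝ≥0) : jump (fun t => (A t, X t)) t = (jump A t, jump X t) := by
  simp only [jump, D.cadlag_A.leftLim_prodMk D.cadlag_X, Prod.mk_sub_mk]

theorem cadlag_comp {S : Type*} [NormedAddCommGroup S] {g : F × E → S} (hg : Continuous g) :
    IsCadlag fun t => g (A t, X t) :=
  IsCadlag.comp hg D.cadlag

theorem approximates_comp {S : Type*} [NormedAddCommGroup S] {g : F × E → S}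
    (hg : Continuous g) : ApproximatesFromLeft π fun t => g (A t, X t) :=
  D.approximates.comp D.cadlag hg

theorem leftLim_comp {S : Type*} [NormedAddCommGroup S] {g : F × E → S} (hg : Continuous g)
    (t : ℝ≥0) : Function.leftLim (fun t => g (A t, X t)) t
      = g (Function.leftLim A t, Function.leftLim X t) := by
  rw [IsCadlag.leftLim_comp (X := fun t => (A t, X t)) hg D.cadlag,
    D.cadlag_A.leftLim_prodMk D.cadlag_X]

theorem exists_sum_control_incr_le [CompleteSpace F] (t : ℝ≥0) : ∃ C, ∀ n N, ∑ i ∈ Finset.range N,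
    (‖(incr (π n) (fun t => (A t, X t)) t i).1‖
      + ‖(incr (π n) (fun t => (A t, X t)) t i).2‖ ^ 2) ≤ C := by
  obtain ⟨C₁, -, h1⟩ := exists_sum_norm_incr_le D.finiteVariation_A D.cadlag_A t
  obtain ⟨C₂, -, h2⟩ := D.twoVariation_X.exists_sum_le t
  refine ⟨C₁ + C₂, fun n N => ?_⟩
  rw [Finset.sum_add_distrib]
  exact add_le_add (h1 (π n) N) (h2 n N)

theorem exists_sum_norm_defect_le [CompleteSpace H] (t : ℝ≥0) :
    ∃ C, 0 ≤ C ∧ ∀ n N, ∑ i ∈ Finset.range N, ‖defect B (π n) X Q t i‖ ≤ C := by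
  have hQ := D.quadraticVariation
  obtain ⟨C₁, h0, h1⟩ := D.twoVariation_X.exists_sum_le t
  obtain ⟨C₂, h0', h2⟩ := exists_sum_norm_incr_le hQ.hasFiniteVariation hQ.isCadlag t
  refine ⟨C₁ + C₂, add_nonneg h0 h0', fun n N => ?_⟩
  refine (Finset.sum_le_sum fun i _ => (norm_sub_le _ _).trans
    (add_le_add_left (D.norm_le _ _) _)).trans ?_
  rw [Finset.sum_add_distrib]
  refine add_le_add ?_ (h2 (π n) N)
  simpa only [sq] using h1 n N

theorem exists_taylorRemainder_le [CompleteSpace E] [CompleteSpace F] (t : ℝ≥0)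
    {η : ℝ} (hη : 0 < η) :
    ∃ δ > 0, ∀ z ∈ closure ((fun t => (A t, X t)) '' Iic t), ∀ w, ‖w - z‖ ≤ δ →
      ‖taylorRemainder B f Da Dx Φ z w‖ ≤ η * (‖(w - z).1‖ + ‖(w - z).2‖ ^ 2) :=
  D.isC12.exists_norm_taylorRemainder_le D.norm_le (D.cadlag.isCompact_closure_image t) hη

variable [CompleteSpace F] [CompleteSpace H]

theorem exists_sum_control_jump_le (t : ℝ≥0) : ∃ C, ∀ S : Finset ℝ≥0, (∀ s ∈ S, s ≤ t) →
    ∑ s ∈ S, (‖(jump (fun t => (A t, X t)) s).1‖ + ‖(jump (fun t => (A t, X t)) s).2‖ ^ 2)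
      ≤ C := by
  have hQ := D.quadraticVariation
  obtain ⟨C₁, -, h1⟩ := exists_sum_norm_jump_le D.finiteVariation_A D.cadlag_A t
  obtain ⟨C₂, -, h2⟩ := exists_sum_norm_jump_le hQ.hasFiniteVariation hQ.isCadlag t
  refine ⟨C₁ + C₂, fun S hS => ?_⟩
  rw [Finset.sum_add_distrib]
  refine add_le_add ?_ ((Finset.sum_le_sum fun s _ => ?_).trans (h2 S hS))
  · simpa only [D.jump_prod] using h1 S hS
  · rw [D.jump_prod, hQ.jump_eq]
    exact D.sq_le _

theorem finite_bigJumpTimes (t : ℝ≥0) {ε : ℝ} (hε : 0 < ε) :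
    (Iic t ∩ bigJumpTimes (fun t => (A t, X t)) ε).Finite := by
  refine ItoFollmer.finite_bigJumpTimes (κ := fun v : F × E => ‖v.1‖ + ‖v.2‖ ^ 2)
    (D.exists_sum_control_jump_le t) (c := min ε (ε ^ 2)) (by positivity) fun v hv => ?_
  rw [Prod.norm_def, lt_max_iff] at hv
  rcases hv with hv | hv
  · exact (min_le_left _ _).trans (hv.le.trans (le_add_of_nonneg_right (by positivity)))
  · refine (min_le_right _ _).trans (le_trans ?_ (le_add_of_nonneg_left (norm_nonneg _)))
    gcongr

variable [CompleteSpace E]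

theorem locSummable_taylorRemainder : LocSummable fun u => taylorRemainder B f Da Dx Φ
    (Function.leftLim (fun t => (A t, X t)) u) (A u, X u) :=
  locSummable_of_control (κ := fun v : F × E => ‖v.1‖ + ‖v.2‖ ^ 2)
    (ρ := taylorRemainder B f Da Dx Φ) D.cadlag (fun _ => by positivity)
    (fun t => by simpa only [one_mul] using D.exists_taylorRemainder_le t one_pos)
    D.exists_sum_control_jump_le (fun t ε hε => D.finite_bigJumpTimes t hε)

variable [CompleteSpace G]

/-- There is a càdlàg path `Y`, provided by the Itô formula, with the following property: up to an
absolutely summable error which tends to zero, the increments of `Y` are those of the left-point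
Riemann sums plus half the second derivative applied to the defect of the quadratic variation. -/
theorem exists_path : ∃ Y : ℝ≥0 → G, Y 0 = 0 ∧ IsCadlag Y ∧
    (∀ t, jump Y t = Dx (Function.leftLim A t, Function.leftLim X t) (jump X t)) ∧
    ∀ t, ∃ e : ℕ → ℕ → G, SumNormTendstoZero e ∧ ∀ n i, incr (π n) Y t i
      = Dx (A ((π n).pts i), X ((π n).pts i)) (incr (π n) X t i)
        + ((1 / 2 : ℝ) • Φ (A ((π n).pts i), X ((π n).pts i))) (defect B (π n) X Q t i)
        + e n i := by
  have hQ := D.quadraticVariation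
  have cDa := D.isC12.continuous_Da
  have cΦ := D.isC12.continuous_Φ
  have cf := D.isC12.continuous D.norm_le
  have bA := (D.cadlag_comp cDa).isLocBddMeasurable_leftLim (D.approximates_comp cDa)
  have bQ := (D.cadlag_comp cΦ).isLocBddMeasurable_leftLim (D.approximates_comp cΦ)
  set RA := stieltjesIntegral (Function.leftLim fun t => Da (A t, X t)) A D.finiteVariation_A
    with hRA
  set RQ := stieltjesIntegral (Function.leftLim fun t => Φ (A t, X t)) Q hQ.hasFiniteVariation
    with hRQ
  set S := sumUpTo fun u => taylorRemainder B f Da Dx Φ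
    (Function.leftLim (fun t => (A t, X t)) u) (A u, X u) with hS
  have kA : IsCadlag RA := isCadlag_stieltjesIntegral bA D.finiteVariation_A D.cadlag_A
  have kQ : IsCadlag RQ := isCadlag_stieltjesIntegral bQ hQ.hasFiniteVariation hQ.isCadlag
  have kS : IsCadlag S := D.locSummable_taylorRemainder.isCadlag.1
  have kf := D.cadlag_comp cf
  have kQ' : IsCadlag fun t => (1 / 2 : ℝ) • RQ t := kQ.comp (continuous_const_smul _)
  have k1 := kf.sub kA
  have k2 := k1.sub kQ'
  have k3 := k2.sub kS
  set Y₀ : ℝ≥0 → G := fun t => f (A t, X t) - RA t - (1 / 2 : ℝ) • RQ t - S t with hY₀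
  have k4 : IsCadlag fun t => Y₀ t - Y₀ 0 :=
    k3.comp (g := fun y => y - Y₀ 0) (by fun_prop)
  refine ⟨fun t => Y₀ t - Y₀ 0, sub_self _, k4, fun t => ?_, fun t => ?_⟩
  · rcases eq_or_ne t 0 with rfl | ht
    · rw [jump_zero, jump_zero, map_zero]
    have e1 : jump (fun t => Y₀ t - Y₀ 0) t = jump Y₀ t := by
      rw [jump, jump, k3.leftLim_comp (g := fun y => y - Y₀ 0) (by fun_prop)]
      abel
    have e2 : jump (fun t => (1 / 2 : ℝ) • RQ t) t = (1 / 2 : ℝ) • jump RQ t := by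
      rw [jump, jump, kQ.leftLim_comp (continuous_const_smul _), smul_sub]
    have e3 : jump (fun t => f (A t, X t)) t
        = f (A t, X t) - f (Function.leftLim A t, Function.leftLim X t) := by
      rw [jump, D.leftLim_comp cf]
    rw [e1, k2.jump_sub kS, k1.jump_sub kQ', kf.jump_sub kA, e2, e3, hRA, hRQ,
      jump_stieltjesIntegral bA _ D.cadlag_A, jump_stieltjesIntegral bQ _ hQ.isCadlag, hS,
      D.locSummable_taylorRemainder.jump_sumUpTo (pos_iff_ne_zero.2 ht), D.leftLim_comp cDa,
      D.leftLim_comp cΦ, hQ.jump_eq, D.cadlag_A.leftLim_prodMk D.cadlag_X]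
    simp only [taylorRemainder, jump]
    abel
  · have s1 := sumNormTendstoZero_apply_incr_sub (D.cadlag_comp cDa) (D.approximates_comp cDa)
      D.finiteVariation_A D.cadlag_A t
    have s2 := sumNormTendstoZero_apply_incr_sub (D.cadlag_comp cΦ) (D.approximates_comp cΦ)
      hQ.hasFiniteVariation hQ.isCadlag t
    have s3 := sumNormTendstoZero_apply_sub_sumUpTo D.cadlag D.conditionC D.approximates
      (D.isC12.continuous_taylorRemainder D.norm_le)
      (κ := fun v : F × E => ‖v.1‖ + ‖v.2‖ ^ 2) (fun _ => by positivity) (t := t)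
      (fun η hη => D.exists_taylorRemainder_le t hη) (D.exists_sum_control_incr_le t)
      (D.exists_sum_control_jump_le t) (fun ε hε => D.finite_bigJumpTimes t hε)
      D.locSummable_taylorRemainder
    rw [← hRA] at s1
    rw [← hS] at s3
    have s2' := s2.of_norm_le (k := fun n i => (1 / 2 : ℝ) • (
      Φ (A ((π n).pts i), X ((π n).pts i)) (incr (π n) Q t i) - incr (π n) RQ t i))
      fun n i => norm_smul_le_of_mem_Icc _ (by norm_num)
    refine ⟨_, (s1.add s2').add s3, fun n i => ?_⟩
    rcases le_total t ((π n).pts i) with hi | hi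
    · have hi' : t ≤ (π n).pts (i + 1) := hi.trans ((π n).lt_succ i).le
      simp only [incr_of_le hi, defect_of_le hi, min_eq_right hi, min_eq_right hi',
        taylorRemainder_self, map_zero, sub_zero, smul_zero, add_zero]
    · simp only [min_eq_left hi, taylorRemainder, defect, incr, hY₀, smul_apply, map_sub]
      simp only [smul_sub]
      abel

end ItoData

end ItoFormula

/-! ### The quadratic variation of the Itô–Föllmer integral -/

section QuadraticVariation

theorem stieltjesIntegral_zero {E : Type*} [NormedAddCommGroup E] [NormedSpace ℝ E]
    [CompleteSpace E] {G : Type*} [NormedAddCommGroup G] [NormedSpace ℝ G]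
    (η : ℝ≥0 → E →L[ℝ] G) {Q : ℝ≥0 → E} (hQ : HasFiniteVariation Q) :
    stieltjesIntegral η Q hQ 0 = 0 := by
  rw [← norm_le_zero_iff, stieltjesIntegral]
  refine (norm_setIntegral_le hQ le_rfl (by simp)).trans (by simp)

variable {E : Type*} [NormedAddCommGroup E] [NormedSpace ℝ E]
  {F : Type*} [NormedAddCommGroup F] [NormedSpace ℝ F]
  {G : Type*} [NormedAddCommGroup G] [NormedSpace ℝ G]
  {H : Type*} [NormedAddCommGroup H] [NormedSpace ℝ H]
  {m : Mode} {B : E →L[ℝ] E →L[ℝ] H} {π : ℕ → HalfLinePartition}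
  {A : ℝ≥0 → F} {X : ℝ≥0 → E} {Q : ℝ≥0 → H} {f : F × E → G} {Da : F × E → F →L[ℝ] G}
  {Dx : F × E → E →L[ℝ] G} {D2 : F × E → E →L[ℝ] E →L[ℝ] G} {Φ : F × E → H →L[ℝ] G}
  (D : ItoData m B π A X Q f Da Dx D2 Φ)

include D

/-- Convergence of the left Riemann sums, given the expansion of the increments of `Y`. -/
theorem ItoData.isItoFollmerIntegral [CompleteSpace H] {Y : ℝ≥0 → G} (hY0 : Y 0 = 0)
    (hY : ∀ t, ∃ e : ℕ → ℕ → G, SumNormTendstoZero e ∧ ∀ n i, incr (π n) Y t i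
      = Dx (A ((π n).pts i), X ((π n).pts i)) (incr (π n) X t i)
        + ((1 / 2 : ℝ) • Φ (A ((π n).pts i), X ((π n).pts i))) (defect B (π n) X Q t i)
        + e n i) :
    IsItoFollmerIntegral m π (fun s => Dx (A s, X s)) X Y := fun t => by
  obtain ⟨e, he, hinc⟩ := hY t
  obtain ⟨C, -, hC⟩ := D.exists_sum_norm_defect_le t
  have cΦ : Continuous fun z => (1 / 2 : ℝ) • Φ z :=
    D.isC12.continuous_Φ.fun_const_smul _
  have h1 := D.quadraticVariation.converges_sum_apply_defect D.cadlag_X hC (D.cadlag_comp cΦ)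
  choose N hN using fun n => (π n).exists_le_pts t
  have h2 : m.Converges (fun _ : ℕ => Y t) (Y t) := m.converges_of_tendsto tendsto_const_nhds
  have h3 := (h2.sub h1).sub (m.converges_of_tendsto (he.tendsto_sum N))
  rw [sub_zero, sub_zero] at h3
  convert h3 using 2 with n
  rw [finsum_eq_sum_range (fun i hi => by rw [incr_of_le hi, map_zero]) (hN n),
    finsum_eq_sum_range (fun i hi => by rw [defect_of_le hi, map_zero]) (hN n),
    ← sub_zero (Y t), ← hY0, ← sum_incr_eq (X := Y) (hN n), ← Finset.sum_sub_distrib,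
    ← Finset.sum_sub_distrib]
  refine Finset.sum_congr rfl fun i _ => ?_
  rw [hinc]
  abel

/-- The difference between the increments of `Y` and the terms of the Riemann sums is square
summable, and its square sum tends to zero: the squared defects are bounded by the uniformly small
defects times their bounded sum. -/
theorem ItoData.sumNormTendstoZero_sq [CompleteSpace H] {t : ℝ≥0} {e r : ℕ → ℕ → G}
    (he : SumNormTendstoZero e) (hr : ∀ n i, r n i
      = ((1 / 2 : ℝ) • Φ (A ((π n).pts i), X ((π n).pts i))) (defect B (π n) X Q t i) + e n i) :
    SumNormTendstoZero fun n i => ‖r n i‖ ^ 2 := by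
  obtain ⟨C, hC0, hC⟩ := D.exists_sum_norm_defect_le t
  have cΦ : Continuous fun z => (1 / 2 : ℝ) • Φ z :=
    D.isC12.continuous_Φ.fun_const_smul _
  obtain ⟨M, hM0, hM, -⟩ := (D.cadlag_comp cΦ).exists_norm_le t
  intro ε hε
  -- The defects are made so small that they contribute at most `ε / 2` to the square sum; the
  -- errors `e` are made at most `1`, so that their squares are at most `‖e‖`.
  filter_upwards [D.quadraticVariation.eventually_norm_defect_le D.cadlag_X t
    (ε := ε / (4 * (M ^ 2 + 1) * (C + 1))) (by positivity),
    he (min 1 (ε / 4)) (by positivity)] with n hd hen N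
  have hterm : ∀ i ∈ Finset.range N, ‖‖r n i‖ ^ 2‖
      ≤ 2 * (M ^ 2 * (ε / (4 * (M ^ 2 + 1) * (C + 1)))) * ‖defect B (π n) X Q t i‖
        + 2 * ‖e n i‖ := fun i hi => by
    have h1 : ‖e n i‖ ≤ 1 :=
      (Finset.single_le_sum (fun j _ => norm_nonneg (e n j)) hi).trans
        ((hen N).trans (min_le_left _ _))
    have h2 : ‖r n i‖ ≤ M * ‖defect B (π n) X Q t i‖ + ‖e n i‖ := by
      rw [hr]
      refine (norm_add_le _ _).trans (add_le_add_left ?_ _)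
      rcases le_total t ((π n).pts i) with hi | hi
      · rw [defect_of_le hi, map_zero, norm_zero, norm_zero, mul_zero]
      · exact ContinuousLinearMap.le_of_opNorm_le _ (hM _ hi) _
    have h3 : ‖defect B (π n) X Q t i‖ ^ 2
        ≤ ε / (4 * (M ^ 2 + 1) * (C + 1)) * ‖defect B (π n) X Q t i‖ := by
      rw [sq]
      exact mul_le_mul_of_nonneg_right (hd i) (norm_nonneg _)
    have h4 : ‖e n i‖ ^ 2 ≤ ‖e n i‖ := by
      rw [sq]
      exact mul_le_of_le_one_left (norm_nonneg _) h1
    rw [norm_pow, norm_norm]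
    calc ‖r n i‖ ^ 2 ≤ (M * ‖defect B (π n) X Q t i‖ + ‖e n i‖) ^ 2 := by gcongr
      _ ≤ 2 * ((M * ‖defect B (π n) X Q t i‖) ^ 2 + ‖e n i‖ ^ 2) := add_sq_le
      _ = 2 * (M ^ 2 * ‖defect B (π n) X Q t i‖ ^ 2) + 2 * ‖e n i‖ ^ 2 := by ring
      _ ≤ 2 * (M ^ 2 * (ε / (4 * (M ^ 2 + 1) * (C + 1)) * ‖defect B (π n) X Q t i‖))
          + 2 * ‖e n i‖ := by gcongr
      _ = _ := by ring
  refine (Finset.sum_le_sum hterm).trans ?_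
  rw [Finset.sum_add_distrib, ← Finset.mul_sum, ← Finset.mul_sum]
  have h5 : 2 * (M ^ 2 * (ε / (4 * (M ^ 2 + 1) * (C + 1))))
      * ∑ i ∈ Finset.range N, ‖defect B (π n) X Q t i‖ ≤ ε / 2 := by
    calc _ ≤ 2 * ((M ^ 2 + 1) * (ε / (4 * (M ^ 2 + 1) * (C + 1)))) * (C + 1) := by
          gcongr
          · linarith
          · exact (hC n N).trans (by linarith)
      _ = ε / 2 := by field_simp; norm_num
  have h6 : 2 * ∑ i ∈ Finset.range N, ‖e n i‖ ≤ ε / 2 := by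
    have := (hen N).trans (min_le_right _ _)
    linarith
  linarith

/-- If the increments of `Y` are those of the Riemann sums up to an error whose square sum tends
to zero, then squares of increments may be exchanged in quadratic Riemann sums, by the
Cauchy–Schwarz inequality. -/
theorem ItoData.sumNormTendstoZero_apply_incr_sub_apply {H' : Type*} [NormedAddCommGroup H']
    [NormedSpace ℝ H'] (B' : G →L[ℝ] G →L[ℝ] H') {t : ℝ≥0} {y r : ℕ → ℕ → G}
    (hr : SumNormTendstoZero fun n i => ‖r n i‖ ^ 2)
    (hy : ∀ n i, y n i = Dx (A ((π n).pts i), X ((π n).pts i)) (incr (π n) X t i) + r n i) :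
    SumNormTendstoZero fun n i => B' (y n i) (y n i)
      - B' (Dx (A ((π n).pts i), X ((π n).pts i)) (incr (π n) X t i))
          (Dx (A ((π n).pts i), X ((π n).pts i)) (incr (π n) X t i)) := by
  obtain ⟨C, hC0, hC⟩ := D.twoVariation_X.exists_sum_le t
  obtain ⟨M, hM0, hM, -⟩ := (D.cadlag_comp D.isC12.continuous_Dx).exists_norm_le t
  have hb : ∀ n N, ∑ i ∈ Finset.range N, (2 * ‖B'‖ * M * ‖incr (π n) X t i‖) ^ 2
      ≤ (2 * ‖B'‖ * M) ^ 2 * C := fun n N => by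
    simp only [mul_pow _ ‖incr _ _ _ _‖, ← Finset.mul_sum]
    exact mul_le_mul_of_nonneg_left (hC n N) (by positivity)
  have h1 := SumNormTendstoZero.mul_of_sq hr hb
  refine ((hr.const_mul ‖B'‖).add h1).of_norm_le fun n i => ?_
  set d := Dx (A ((π n).pts i), X ((π n).pts i)) (incr (π n) X t i) with hd
  have hdM : ‖d‖ ≤ M * ‖incr (π n) X t i‖ := by
    rcases le_total t ((π n).pts i) with hi | hi
    · rw [hd, incr_of_le hi, map_zero, norm_zero, norm_zero, mul_zero]
    · exact ContinuousLinearMap.le_of_opNorm_le _ (hM _ hi) _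
  have hsplit : B' (y n i) (y n i) - B' d d = B' (r n i) (r n i) + B' (r n i) d + B' d (r n i) := by
    rw [hy]
    simp only [map_add, add_apply]
    abel
  rw [hsplit, Real.norm_of_nonneg (by positivity)]
  calc _ ≤ ‖B'‖ * ‖r n i‖ * ‖r n i‖ + ‖B'‖ * ‖r n i‖ * ‖d‖ + ‖B'‖ * ‖d‖ * ‖r n i‖ :=
        (norm_add₃_le).trans (by gcongr <;> exact B'.le_opNorm₂ _ _)
    _ ≤ ‖B'‖ * ‖r n i‖ * ‖r n i‖ + ‖B'‖ * ‖r n i‖ * (M * ‖incr (π n) X t i‖)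
        + ‖B'‖ * (M * ‖incr (π n) X t i‖) * ‖r n i‖ := by gcongr
    _ = ‖B'‖ * ‖r n i‖ ^ 2 + ‖r n i‖ * (2 * ‖B'‖ * M * ‖incr (π n) X t i‖) := by ring

/-- The transformed path `Y` has `B'`-quadratic variation `∫ Θ(Dx) dQ` whenever the bilinear maps
`B` and `B'` are intertwined by the continuous operator-valued map `Θ`. -/
theorem ItoData.isQuadraticCovariation [CompleteSpace H] {H' : Type*} [NormedAddCommGroup H']
    [NormedSpace ℝ H'] [CompleteSpace H'] {B' : G →L[ℝ] G →L[ℝ] H'} {Θ : (E →L[ℝ] G) → (H →L[ℝ] H')}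
    (hΘ : Continuous Θ) (hΘB : ∀ T h k, Θ T (B h k) = B' (T h) (T k)) {Y : ℝ≥0 → G}
    (hjump : ∀ t, jump Y t = Dx (Function.leftLim A t, Function.leftLim X t) (jump X t))
    (hY : ∀ t, ∃ e : ℕ → ℕ → G, SumNormTendstoZero e ∧ ∀ n i, incr (π n) Y t i
      = Dx (A ((π n).pts i), X ((π n).pts i)) (incr (π n) X t i)
        + ((1 / 2 : ℝ) • Φ (A ((π n).pts i), X ((π n).pts i))) (defect B (π n) X Q t i)
        + e n i) :
    (∀ t, StieltjesIntegrable (fun s => Θ (Dx (Function.leftLim A s, Function.leftLim X s))) Q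
      D.quadraticVariation.hasFiniteVariation t) ∧
    IsQuadraticCovariation m B' π Y Y (stieltjesIntegral
      (fun s => Θ (Dx (Function.leftLim A s, Function.leftLim X s))) Q
      D.quadraticVariation.hasFiniteVariation) := by
  have hQ := D.quadraticVariation
  have cΘ : Continuous fun z => Θ (Dx z) := hΘ.comp D.isC12.continuous_Dx
  have hleft : (fun s => Θ (Dx (Function.leftLim A s, Function.leftLim X s)))
      = Function.leftLim fun s => Θ (Dx (A s, X s)) := funext fun s => (D.leftLim_comp cΘ s).symm
  have hξ := D.cadlag_comp cΘ
  have hL := D.approximates_comp cΘ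
  have hη := hξ.isLocBddMeasurable_leftLim hL
  refine ⟨fun t => ?_, ?_, ?_, fun t => ?_, fun t => ?_⟩
  · rw [hleft]
    exact hη.stieltjesIntegrable _ t
  · rw [hleft]
    exact isCadlag_stieltjesIntegral hη _ hQ.isCadlag
  · rw [hleft]
    exact hasFiniteVariation_stieltjesIntegral hη _ hQ.isCadlag
  · rw [hleft]
    obtain ⟨e, he, hinc⟩ := hY t
    obtain ⟨C, -, hC⟩ := D.exists_sum_norm_defect_le t
    have h1 := hQ.converges_sum_apply_defect D.cadlag_X hC hξ
    have h2 := sumNormTendstoZero_apply_incr_sub hξ hL hQ.hasFiniteVariation hQ.isCadlag t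
    have h3 := D.sumNormTendstoZero_apply_incr_sub_apply B' (D.sumNormTendstoZero_sq he
      fun _ _ => rfl) fun n i => (hinc n i).trans (add_assoc _ _ _)
    set R := stieltjesIntegral (Function.leftLim fun s => Θ (Dx (A s, X s))) Q
      hQ.hasFiniteVariation with hR
    choose N hN using fun n => (π n).exists_le_pts t
    have h4 : m.Converges (fun _ : ℕ => R t) (R t) := m.converges_of_tendsto tendsto_const_nhds
    have h5 := ((h4.add h1).add (m.converges_of_tendsto (h2.tendsto_sum N))).add
      (m.converges_of_tendsto (h3.tendsto_sum N))
    rw [add_zero, add_zero, add_zero] at h5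
    convert h5 using 2 with n
    have hR0 : R 0 = 0 := stieltjesIntegral_zero _ _
    rw [finsum_eq_sum_range (fun i hi => by rw [incr_of_le hi, map_zero]) (hN n),
      finsum_eq_sum_range (fun i hi => by rw [defect_of_le hi, map_zero]) (hN n),
      ← sub_zero (R t), ← hR0, ← sum_incr_eq (X := R) (hN n), ← Finset.sum_add_distrib,
      ← Finset.sum_add_distrib, ← Finset.sum_add_distrib]
    refine Finset.sum_congr rfl fun i _ => ?_
    rw [← hΘB, defect, map_sub]
    abel
  · rw [hleft, jump_stieltjesIntegral hη _ hQ.isCadlag, hQ.jump_eq, hjump, D.leftLim_comp cΘ, hΘB]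

end QuadraticVariation

end ItoFollmer

theorem mainTheorem4
    {E G : Type u} {F : Type v}
    [NormedAddCommGroup E] [NormedSpace ℝ E] [CompleteSpace E]
    [NormedAddCommGroup G] [NormedSpace ℝ G] [CompleteSpace G]
    [NormedAddCommGroup F] [NormedSpace ℝ F] [CompleteSpace F]
    (α : ItoFollmer.UniformCrossnorm.{u}) (m : ItoFollmer.Mode)
    (π : ℕ → ItoFollmer.HalfLinePartition)
    (A : ℝ≥0 → F) (X : ℝ≥0 → E)
    (hA : ItoFollmer.IsCadlag A) (hAV : ItoFollmer.HasFiniteVariation A)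
    (hX : ItoFollmer.IsCadlag X)
    (hXV : ItoFollmer.HasFiniteTwoVariation π X)
    (Q : ℝ≥0 → ItoFollmer.CompletedTensor (α.norm E E))
    (hQ : ItoFollmer.IsTensorQuadraticVariation m (α.norm E E) π X Q)
    (hC : ItoFollmer.ConditionC π (fun t => (A t, X t)))
    (hL : ItoFollmer.ApproximatesFromLeft π (fun t => (A t, X t)))
    (f : F × E → G)
    (Daf : F × E → F →L[ℝ] G) (Dxf : F × E → E →L[ℝ] G) (D2f : F × E → E →L[ℝ] E →L[ℝ] G)
    (D2fα : F × E → ItoFollmer.CompletedTensor (α.norm E E) →L[ℝ] G)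
    (hDaf : ∀ a x, ItoFollmer.HasGateauxDerivAt (fun a' => f (a', x)) (Daf (a, x)) a)
    (hDxf : ∀ a x, ItoFollmer.HasGateauxDerivAt (fun x' => f (a, x')) (Dxf (a, x)) x)
    (hD2f : ∀ a x, ItoFollmer.HasGateauxDerivAt (fun x' => Dxf (a, x')) (D2f (a, x)) x)
    (hDafC : ItoFollmer.ContinuousOnCompacts Daf)
    (hDxfC : ItoFollmer.ContinuousOnCompacts Dxf)
    (hD2fα : ∀ p h k, D2fα p (ItoFollmer.tmulL (α.norm E E) h k) = D2f p h k)
    (hD2fαC : ItoFollmer.ContinuousOnCompacts D2fα) :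
    ∃ Y : ℝ≥0 → G,
      ItoFollmer.IsItoFollmerIntegral m π (fun s => Dxf (A s, X s)) X Y ∧
      ItoFollmer.IsCadlag Y ∧
      (∀ t, ItoFollmer.StieltjesIntegrable
        (fun s => α.map (Dxf (Function.leftLim A s, Function.leftLim X s))
          (Dxf (Function.leftLim A s, Function.leftLim X s))) Q hQ.hasFiniteVariation t) ∧
      ItoFollmer.IsTensorQuadraticVariation m (α.norm G G) π Y
        (fun t => ItoFollmer.stieltjesIntegral
          (fun s => α.map (Dxf (Function.leftLim A s, Function.leftLim X s))
            (Dxf (Function.leftLim A s, Function.leftLim X s))) Q hQ.hasFiniteVariation t) := by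
  have D : ItoFollmer.ItoData m (ItoFollmer.tmulL (α.norm E E)) π A X Q f Daf Dxf D2f D2fα :=
    { cadlag_A := hA
      finiteVariation_A := hAV
      cadlag_X := hX
      twoVariation_X := hXV
      quadraticVariation := hQ
      conditionC := hC
      approximates := hL
      norm_le := ItoFollmer.norm_tmulL_le _
      sq_le := ItoFollmer.sq_norm_le_norm_tmulL _
      isC12 :=
        { hasGateauxDerivAt_fst := hDaf
          hasGateauxDerivAt_snd := hDxf
          hasGateauxDerivAt_snd_snd := hD2f
          continuous_Da := hDafC.continuous
          continuous_Dx := hDxfC.continuous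
          apply_eq := hD2fα
          continuous_Φ := hD2fαC.continuous } }
  obtain ⟨Y, hY0, hYc, hYj, hY⟩ := D.exists_path
  obtain ⟨h1, h2⟩ := D.isQuadraticCovariation α.continuous_map_self
    (fun T h k => α.map_tmulL T T h k) hYj hY
  exact ⟨Y, D.isItoFollmerIntegral hY0 hY, hYc, h1, h2⟩
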